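/- **Setting.** Let $X\in\mathbb R^p$ and $Y\in\{0,1\}$ satisfy $P(Y=1\mid X=x)=\exp(\alpha_0+\beta_0^\top x)/\{1+\exp(\alpha_0+\beta_0^\top x)\}$, and let $h:\mathbb R^p\to\mathbb R^q$ be measurable with $E[h(X)\mid Y=1]\neq E[h(X)\mid Y=0]$. Put $\gamma_0=\log\{P(Y=0)/P(Y=1)\}$, $\alpha_0^*=\gamma_0+\alpha_0$, $\mu_0=E[h(X)]$ and $\theta_0=(\gamma_0,\alpha_0^*,\beta_0,\mu_0)$. For each $n$, the internal data $(y_i,x_i)_{i\le n}$ consist of the first $n_1=n_1(n)$ members of an i.i.d. sequence from the law of $X$ given $Y=1$ (these have $y_i=1$) and the first $n_0=n-n_1$ members of an i.i.d. sequence, independent of the first, from the law of $X$ given $Y=0$ (these have $y_i=0$); $n_1/n$ and $n_0/n$ stay bounded away from $0$ as $n\to\infty$. Let $\tilde\mu=\tilde\mu_n$ be an external estimate of $\mu_0$ based on sample size $N=N(n)$, where $n/N\to c\in(0,\infty)$, and let $W$ be a positive definite $q\times q$ matrix. For $\theta=(\gamma,\alpha^*,\beta,\mu)$ and $\nu\in\mathbb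 R^{1+q}$ let $$H(x;\theta)=\Big(e^{\alpha^*+\beta^\top x}-1,\ \tfrac{e^{\alpha^*+\beta^\top x}+e^{\gamma}}{1+e^{\gamma}}h(x)-\mu\Big),$$ $$l_W(\theta,\nu)=\sum_{i=1}^n\big[y_i(\alpha^*+\beta^\top x_i)-\log(1+\nu^\top H(x_i;\theta))\big]-\tfrac N2(\tilde\mu-\mu)^\top W^{-1}(\tilde\mu-\mu),$$ the latter where $1+\nu^\top H(x_i;\theta)>0$ for all $i$. The estimator $\hat\theta_W$ is the $\theta$-component of a maximizer $(\hat\theta_W,\hat p)$ of $\sum_i[y_i(\alpha^*+\beta^\top x_i)+\log p_i]-\frac N2(\tilde\mu-\mu)^\top W^{-1}(\tilde\mu-\mu)$ over $\theta\in\Theta$ and $p_i>0$ subject to $\sum_ip_i=1$ and $\sum_ip_iH(x_i;\theta)=0$. **Conditions.** (1) $\Theta$ is compact and $\theta_0$ is an interior point of $\Theta$. (2) $E[H(X;\gamma_0,\alpha_0^*,\beta_0,\mu)\mid Y=0]=0$ has the unique solution $\mu=\mu_0$. (3) $E\|X\|^3<\infty$, $E\|h(X)\|^3<\infty$, and $X$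 is not concentrated on a proper affine subspace of $\mathbb R^p$. (4) $\sqrt N(\tilde\mu-\mu_0)\to N(0,V)$ in distribution, for some positive semidefinite $V$. **Theorem.** Let $G_n$ be the event that a maximizer exists and that every maximizer $(\hat\theta_W,\hat p)$ has $\hat\theta_W$ in the interior of $\{\theta:\|\theta-\theta_0\|\le n^{-1/3}\}$ and admits $\hat\nu_W$ such that $1+\hat\nu_W^\top H(x_i;\hat\theta_W)>0$ and $\hat p_i=n^{-1}(1+\hat\nu_W^\top H(x_i;\hat\theta_W))^{-1}$ for all $i$, and $\hat\eta_W=(\hat\theta_W,\hat\nu_W)$ satisfies $\partial l_W(\hat\eta_W)/\partial\eta=0$. Under the above assumptions: (i) $G_n$ holds with probability tending to one as $n\to\infty$. (ii) With probability one, if $n^{1/3}(\tilde\mu_n-\mu_0)\to0$, then $G_n$ holds for all sufficiently large $n$. (iii) Any estimator sequence $\hat\theta_W=(\hat\gamma_W,\hat\alpha^*_W,\hat\beta_W,\hat\mu_W)$ that is the $\theta$-component of a maximizer whenever one exists is consistent: in probability, $\hat\theta_W\to\theta_0$, $\hat\alpha^*_W-\hat\gamma_W\to\alpha_0$ and $1/(1+e^{\hat\gamma_W})\to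 P(Y=1)$. (iv) The intercept $\alpha_0$ and the case proportion $P(Y=1)$ are identified: any other law of $(X,Y)$ that follows a logistic model and has the same conditional laws of $X$ given $Y=1$ and given $Y=0$ and the same $E[h(X)]$ has the same intercept and the same case proportion. -/

import Mathlib

open MeasureTheory ProbabilityTheory Filter Topology

noncomputable section

namespace CaseControl

/-- Covariate and summary vectors, with the Euclidean norm. -/
abbrev Vec (d : ℕ) : Type := EuclideanSpace ℝ (Fin d)

/-- The finite-dimensional parameter `θ = (γ, α*, β, μ)` as one Euclidean vector; the four blocks
of coordinates are, in this order, `γ`, `α*`, `β`, `μ`. -/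
abbrev Param (p q : ℕ) : Type := EuclideanSpace ℝ (Unit ⊕ Unit ⊕ Fin p ⊕ Fin q)

/-- The Lagrange multiplier `ν`, a vector of dimension `1 + q`. -/
abbrev Mult (q : ℕ) : Type := EuclideanSpace ℝ (Unit ⊕ Fin q)

variable {p q : ℕ}

def mkParam (γ a : ℝ) (β : Vec p) (μ : Vec q) : Param p q :=
  WithLp.toLp 2 (Sum.elim (fun _ => γ) (Sum.elim (fun _ => a) (Sum.elim (fun j => β j)
    (fun j => μ j))))

def gam (θ : Param p q) : ℝ := θ (Sum.inl ())

def astar (θ : Param p q) : ℝ := θ (Sum.inr (Sum.inl ()))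

def bet (θ : Param p q) : Vec p := WithLp.toLp 2 fun j => θ (Sum.inr (Sum.inr (Sum.inl j)))

def mom (θ : Param p q) : Vec q := WithLp.toLp 2 fun j => θ (Sum.inr (Sum.inr (Sum.inr j)))

/-! ### The population -/

/-- The logistic model `P(Y = 1 | X = x) = exp(α + βᵀx) / (1 + exp(α + βᵀx))` for the joint law
`Pop` of `(X, Y)`; the response value `1` is `true`, the value `0` is `false`. -/
def IsLogistic (Pop : Measure (Vec p × Bool)) (α : ℝ) (β : Vec p) : Prop :=
  ∀ A : Set (Vec p), MeasurableSet A →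
    Pop (A ×ˢ {true}) = ∫⁻ x in A, ENNReal.ofReal
      (Real.exp (α + inner ℝ β x) / (1 + Real.exp (α + inner ℝ β x))) ∂Pop.fst

/-- The marginal case proportion `P(Y = 1)`. -/
def caseProp (Pop : Measure (Vec p × Bool)) : ℝ := Pop.real (Prod.snd ⁻¹' {true})

/-- The conditional law of `X` given `Y = b`. -/
def condLaw (Pop : Measure (Vec p × Bool)) (b : Bool) : Measure (Vec p) :=
  (ProbabilityTheory.cond Pop (Prod.snd ⁻¹' {b})).map Prod.fst

/-- The true value `γ₀ = log [P(Y = 0) / P(Y = 1)]`. -/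
def gammaTrue (Pop : Measure (Vec p × Bool)) : ℝ :=
  Real.log (Pop.real (Prod.snd ⁻¹' {false}) / Pop.real (Prod.snd ⁻¹' {true}))

/-- The true value `θ₀ = (γ₀, γ₀ + α₀, β₀, E[h(X)])`. -/
def thetaTrue (Pop : Measure (Vec p × Bool)) (α : ℝ) (β : Vec p) (h : Vec p → Vec q) :
    Param p q :=
  mkParam (gammaTrue Pop) (gammaTrue Pop + α) β (∫ x, h x ∂Pop.fst)

/-! ### The empirical likelihood -/

/-- The exponential tilt `exp(α* + βᵀx)`. -/
def tilt (θ : Param p q) (x : Vec p) : ℝ := Real.exp (astar θ + inner ℝ (bet θ) x)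

/-- The estimating function
`H(x; θ) = (exp(α* + βᵀx) - 1, (exp(α* + βᵀx) + exp γ) / (1 + exp γ) • h(x) - μ)`. -/
def H (h : Vec p → Vec q) (θ : Param p q) (x : Vec p) : Mult q :=
  WithLp.toLp 2 (Sum.elim (fun _ => tilt θ x - 1)
    (fun j => (tilt θ x + Real.exp (gam θ)) / (1 + Real.exp (gam θ)) * h x j - mom θ j))

/-- `N (μ̃ - μ)ᵀ W⁻¹ (μ̃ - μ) / 2`. -/
def penalty (W : Matrix (Fin q) (Fin q) ℝ) (N : ℕ) (mtilde : Vec q) (μ : Vec q) : ℝ :=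
  N * dotProduct (⇑(mtilde - μ)) (W⁻¹.mulVec (⇑(mtilde - μ))) / 2

variable {ι : Type*} [Fintype ι]

/-- The log-likelihood `∑ᵢ [yᵢ(α* + βᵀxᵢ) + log pᵢ] - N (μ̃ - μ)ᵀ W⁻¹ (μ̃ - μ) / 2`. -/
def objective (W : Matrix (Fin q) (Fin q) ℝ) (N : ℕ) (mtilde : Vec q) (y : ι → ℝ) (x : ι → Vec p)
    (θ : Param p q) (w : ι → ℝ) : ℝ :=
  ∑ i, (y i * (astar θ + inner ℝ (bet θ) (x i)) + Real.log (w i)) - penalty W N mtilde (mom θ)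

/-- The constraints on `(θ, p₁, …, pₙ)`. The weights are positive because `log 0` stands for `-∞`
in the objective. -/
structure Feasible (h : Vec p → Vec q) (Θ : Set (Param p q)) (x : ι → Vec p) (θ : Param p q)
    (w : ι → ℝ) : Prop where
  mem : θ ∈ Θ
  pos : ∀ i, 0 < w i
  total : ∑ i, w i = 1
  total_tilt : ∑ i, tilt θ (x i) * w i = 1
  moment : ∑ i, (((tilt θ (x i) + Real.exp (gam θ)) / (1 + Real.exp (gam θ))) * w i) • h (x i)
    = mom θ

/-- `(θ, p)` maximizes the objective subject to the constraints. -/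
structure IsMaximizer (h : Vec p → Vec q) (Θ : Set (Param p q)) (W : Matrix (Fin q) (Fin q) ℝ)
    (N : ℕ) (mtilde : Vec q) (y : ι → ℝ) (x : ι → Vec p) (θ : Param p q) (w : ι → ℝ) : Prop where
  feasible : Feasible h Θ x θ w
  le : ∀ θ' w', Feasible h Θ x θ' w' →
    objective W N mtilde y x θ' w' ≤ objective W N mtilde y x θ w

/-- The profile empirical log-likelihood `l_W(θ, ν)`, a function of `η = (θ, ν)`. It is meaningful
where `1 + νᵀH(xᵢ; θ) > 0` for all `i`. -/
def profileLogLik (h : Vec p → Vec q) (W : Matrix (Fin q) (Fin q) ℝ) (N : ℕ) (mtilde : Vec q)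
    (y : ι → ℝ) (x : ι → Vec p) (η : Param p q × Mult q) : ℝ :=
  ∑ i, (y i * (astar η.1 + inner ℝ (bet η.1) (x i))
      - Real.log (1 + inner ℝ η.2 (H h η.1 (x i))))
    - penalty W N mtilde (mom η.1)

/-- `η = (θ, ν)` lies in the domain of `l_W` and `∂l_W/∂η` vanishes there. -/
def IsStationary (h : Vec p → Vec q) (W : Matrix (Fin q) (Fin q) ℝ) (N : ℕ) (mtilde : Vec q)
    (y : ι → ℝ) (x : ι → Vec p) (η : Param p q × Mult q) : Prop :=
  (∀ i, 0 < 1 + inner ℝ η.2 (H h η.1 (x i))) ∧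
    HasFDerivAt (profileLogLik h W N mtilde y x) (0 : Param p q × Mult q →L[ℝ] ℝ) η

/-- The estimation problem has a solution, and every solution `(θ̂, p̂)` has `θ̂` in the interior
of the ball of radius `n^(-1/3)` about `θ₀` and comes with a multiplier `ν̂` such that
`p̂ᵢ = n⁻¹ (1 + ν̂ᵀH(xᵢ; θ̂))⁻¹` and `(θ̂, ν̂)` is a stationary point of `l_W`. -/
def GoodEstimator (h : Vec p → Vec q) (Θ : Set (Param p q)) (W : Matrix (Fin q) (Fin q) ℝ)
    (N : ℕ) (mtilde : Vec q) (y : ι → ℝ) (x : ι → Vec p) (θ₀ : Param p q) : Prop :=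
  (∃ θ w, IsMaximizer h Θ W N mtilde y x θ w) ∧
  ∀ θ w, IsMaximizer h Θ W N mtilde y x θ w →
    θ ∈ interior (Metric.closedBall θ₀ ((Fintype.card ι : ℝ) ^ (-(1 / 3) : ℝ))) ∧
    ∃ ν : Mult q,
      (∀ i, w i = (Fintype.card ι : ℝ)⁻¹ * (1 + inner ℝ ν (H h θ (x i)))⁻¹) ∧
      IsStationary h W N mtilde y x (θ, ν)

/-! ### The case-control sample -/

/-- The responses of a sample of `n₁` cases and `n₀` controls. -/
def response (n₁ n₀ : ℕ) : Fin n₁ ⊕ Fin n₀ → ℝ := Sum.elim (fun _ => 1) (fun _ => 0)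

/-- The covariates of `n₁` cases and `n₀` controls, the first members of the sequences
`X true` of cases and `X false` of controls. -/
def covariate {Ω : Type*} (X : Bool → ℕ → Ω → Vec p) (n₁ n₀ : ℕ) (ω : Ω) :
    Fin n₁ ⊕ Fin n₀ → Vec p :=
  Sum.elim (fun i => X true i ω) (fun i => X false i ω)

end CaseControl

end

open MeasureTheory ProbabilityTheory Filter Topology

noncomputable section

namespace CaseControl

variable {p q : ℕ}

/-! The proof compares the constrained likelihood with the ordinary logistic likelihood of the
pooled sample, and never analyses the saddle point in (θ, ν). Put a_i = w_i (n₀ + n₁ tilt θ (x_i)).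
The two mass constraints say exactly that the a_i average to one (`Feasible.sum_mul_eq`), so Σ log
a_i ≤ 0. The objective is the logistic log-likelihood plus Σ log a_i minus the penalty
(`Feasible.objective_eq_logisticLik`). It is thus bounded above by a function strongly concave in
(α*, β) on bounded sets. Conversely, the weights 1/(n₀ + n₁ tilt θ₀), once normalized, give a
feasible point near θ₀ that attains the logistic likelihood at the truth up to the penalty
(`RegularSample.exists_feasible`).

A maximizer therefore has three small deficits at once, each of order n(εr)² with r = n^(-1/3). The
quadratic loss of the logistic likelihood controls (α*, β), and the penalty controls μ. Smallness of
-Σ log a_i is a Hellinger-type bound which makes the a_i close to one in a weighted ℓ¹ sense. The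
moment constraint then equates μ, up to O(εr), with a mixture of the case and control means of h in
proportions fixed by γ; as these means differ, γ is controlled too (`exists_norm_sub_le`). For small
ε the maximizer lies strictly inside the r-ball and in the interior of Θ, where
`IsMaximizer.exists_multiplier` supplies ν̂ and stationarity. Existence is compactness of a
superlevel set.

All randomness is confined to `RegularSample`: finitely many averages must be within εr of their
means, third moments bounded and a Gram matrix nondegenerate. The combined sample has intensity (n₀
+ n₁t) dF₀, where F₀ is the law of the controls and t the density of the cases, so the denominators
n₀ + n₁t cancel in the means. The accuracy o(n^(-1/3)) under three moments comes from truncation at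
n^(1/3), Bernstein's inequality and Borel–Cantelli (`ae_tendsto_rate_sum`). The external estimate
has error O(N^(-1/2)) in probability, which is below n^(-1/3).

Identification is separate: the mean of h determines the mixing proportion because the conditional
means differ. The logistic functions then agree almost everywhere, and nondegeneracy of X separates
the intercept from the slope. -/

/-! ### Smoothness and derivatives of the estimating function -/

lemma contDiff_astar : ContDiff ℝ ⊤ (astar : Param p q → ℝ) := by
  unfold astar; fun_prop

lemma contDiff_gam : ContDiff ℝ ⊤ (gam : Param p q → ℝ) := by
  unfold gam; fun_prop

lemma contDiff_bet : ContDiff ℝ ⊤ (bet : Param p q → Vec p) := by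
  unfold bet
  rw [contDiff_piLp]
  intro i
  simp only
  fun_prop

lemma contDiff_linPred (x : Vec p) :
    ContDiff ℝ ⊤ (fun θ : Param p q => astar θ + inner ℝ (bet θ) x) :=
  contDiff_astar.add (contDiff_bet.inner ℝ contDiff_const)

lemma contDiff_tilt (x : Vec p) : ContDiff ℝ ⊤ (fun θ : Param p q => tilt θ x) := by
  unfold tilt
  exact (contDiff_linPred x).exp

lemma contDiff_H (h : Vec p → Vec q) (x : Vec p) :
    ContDiff ℝ ⊤ (fun θ : Param p q => H h θ x) := by
  unfold H
  rw [contDiff_piLp]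
  intro i
  rcases i with i | i
  · simpa using (contDiff_tilt x).sub contDiff_const
  · have h1 : ∀ θ : Param p q, 1 + Real.exp (gam θ) ≠ 0 := fun θ => by positivity
    have h2 : ContDiff ℝ ⊤ (fun θ : Param p q => (mom θ) i) := by
      unfold mom; simp only; fun_prop
    exact ((((contDiff_tilt x).add contDiff_gam.exp).div
      (contDiff_const.add contDiff_gam.exp) h1).mul contDiff_const).sub h2

lemma contDiff_penalty (W : Matrix (Fin q) (Fin q) ℝ) (N : ℕ) (m : Vec q) :
    ContDiff ℝ ⊤ (fun θ : Param p q => penalty W N m (mom θ)) := by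
  have h2 : ∀ i, ContDiff ℝ ⊤ (fun θ : Param p q => (mom θ) i) := fun i => by
    unfold mom; simp only; fun_prop
  unfold penalty Matrix.mulVec dotProduct
  simp only [PiLp.sub_apply]
  fun_prop

lemma H_inl (h : Vec p → Vec q) (θ : Param p q) (x : Vec p) (i : Unit) :
    H h θ x (Sum.inl i) = tilt θ x - 1 := rfl

lemma H_inr (h : Vec p → Vec q) (θ : Param p q) (x : Vec p) (j : Fin q) :
    H h θ x (Sum.inr j) = (tilt θ x + Real.exp (gam θ)) / (1 + Real.exp (gam θ)) * h x j
      - θ (Sum.inr (Sum.inr (Sum.inr j))) := rfl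

variable {ι : Type*} [Fintype ι]

/-- Unit total mass pulls the constants 1 and μ out of the sums. The tilt and moment constraints
become one vector equation, the form needed for multipliers. -/
lemma sum_smul_H (h : Vec p → Vec q) (θ : Param p q) (x : ι → Vec p) (w : ι → ℝ)
    (hw : ∑ i, w i = 1) :
    ∑ i, w i • H h θ (x i) = 0 ↔ (∑ i, tilt θ (x i) * w i = 1 ∧
      ∑ i, (((tilt θ (x i) + Real.exp (gam θ)) / (1 + Real.exp (gam θ))) * w i) • h (x i)
        = mom θ) := by
  constructor
  · intro H0
    refine ⟨?_, ?_⟩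
    · have := congrArg (fun v : Mult q => v (Sum.inl ())) H0
      simp only [WithLp.ofLp_sum, WithLp.ofLp_smul, Finset.sum_apply, Pi.smul_apply, H_inl,
        smul_eq_mul, mul_sub, Finset.sum_sub_distrib, mul_one, hw] at this
      simp only [PiLp.zero_apply] at this
      simp_rw [mul_comm (tilt _ _)]
      linarith
    · ext j
      have := congrArg (fun v : Mult q => v (Sum.inr j)) H0
      simp only [WithLp.ofLp_sum, WithLp.ofLp_smul, Finset.sum_apply, Pi.smul_apply, H_inr,
        smul_eq_mul, mul_sub, Finset.sum_sub_distrib, ← Finset.sum_mul, hw] at this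
      simp only [PiLp.zero_apply] at this
      simp only [WithLp.ofLp_sum, WithLp.ofLp_smul, Finset.sum_apply, Pi.smul_apply, smul_eq_mul,
        mom]
      rw [one_mul, sub_eq_zero] at this
      rw [← this]
      exact Finset.sum_congr rfl fun i _ => by ring
  · rintro ⟨h1, h2⟩
    ext j
    rcases j with j | j
    · simp only [WithLp.ofLp_sum, WithLp.ofLp_smul, Finset.sum_apply, Pi.smul_apply, H_inl,
        smul_eq_mul, mul_sub, Finset.sum_sub_distrib, mul_one, hw]
      simp_rw [mul_comm (tilt _ _)] at h1
      simp [h1]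
    · have := congrArg (fun v : Vec q => v j) h2
      simp only [WithLp.ofLp_sum, WithLp.ofLp_smul, Finset.sum_apply, Pi.smul_apply, smul_eq_mul,
        mom] at this
      simp only [WithLp.ofLp_sum, WithLp.ofLp_smul, Finset.sum_apply, Pi.smul_apply, H_inr,
        smul_eq_mul, mul_sub, Finset.sum_sub_distrib, ← Finset.sum_mul, hw]
      rw [← this]
      simp only [PiLp.zero_apply, one_mul]
      rw [sub_eq_zero]
      exact Finset.sum_congr rfl fun i _ => by ring

/-- The derivative of `H` in `θ` along the `μ`-coordinates. -/
lemma fderiv_H_mom (h : Vec p → Vec q) (θ : Param p q) (x : Vec p) (j : Fin q) :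
    fderiv ℝ (fun θ : Param p q => H h θ x) θ
      (EuclideanSpace.single (Sum.inr (Sum.inr (Sum.inr j))) 1)
      = - EuclideanSpace.single (Sum.inr j) 1 := by
  set v : Param p q := EuclideanSpace.single (Sum.inr (Sum.inr (Sum.inr j))) 1 with hv
  have hd := ((contDiff_H h x).differentiable (by simp) θ).hasFDerivAt.hasLineDerivAt v
  have h2 : HasLineDerivAt ℝ (fun θ : Param p q => H h θ x)
      (- EuclideanSpace.single (Sum.inr j) 1) θ v := by
    have : (fun t : ℝ => H h (θ + t • v) x)
        = fun t : ℝ => H h θ x + t • (- EuclideanSpace.single (Sum.inr j) 1 : Mult q) := by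
      funext t
      have e1 : tilt (θ + t • v) x = tilt θ x := by
        have : bet (θ + t • v) = bet θ := by ext k; simp [bet, hv]
        unfold tilt
        rw [this]
        simp [astar, hv]
      have e2 : gam (θ + t • v) = gam θ := by simp [gam, hv]
      ext k
      rcases k with k | k
      · simp [H_inl, e1]
      · rw [H_inr, e1, e2]
        simp [H_inr, hv]
        ring
    unfold HasLineDerivAt
    rw [this]
    simpa using ((hasDerivAt_id (0 : ℝ)).smul_const
      (- EuclideanSpace.single (Sum.inr j) 1 : Mult q)).const_add (H h θ x)
  exact hd.unique h2

/-- The first coordinate of the derivative of `H` in `θ` along the `α*`-coordinate. -/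
lemma fderiv_H_astar (h : Vec p → Vec q) (θ : Param p q) (x : Vec p) :
    (fderiv ℝ (fun θ : Param p q => H h θ x) θ
      (EuclideanSpace.single (Sum.inr (Sum.inl ())) 1)) (Sum.inl ()) = tilt θ x := by
  set v : Param p q := EuclideanSpace.single (Sum.inr (Sum.inl ())) 1 with hv
  have hd := ((contDiff_H h x).differentiable (by simp) θ).hasFDerivAt.hasLineDerivAt v
  unfold HasLineDerivAt at hd
  have hd' := (PiLp.proj (𝕜 := ℝ) 2 (fun _ : Unit ⊕ Fin q => ℝ)
    (Sum.inl ())).hasFDerivAt.comp_hasDerivAt (0 : ℝ) hd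
  have e : (fun t : ℝ => H h (θ + t • v) x (Sum.inl ()))
      = fun t : ℝ => Real.exp t * tilt θ x - 1 := by
    funext t
    have : bet (θ + t • v) = bet θ := by ext k; simp [bet, hv]
    simp only [H_inl, tilt, this]
    rw [← Real.exp_add]
    simp [astar, hv]
    ring_nf
  have hd'' : HasDerivAt (fun t : ℝ => H h (θ + t • v) x (Sum.inl ()))
    ((fderiv ℝ (fun θ : Param p q => H h θ x) θ v) (Sum.inl ())) 0 := hd'
  rw [e] at hd''
  have h2 : HasDerivAt (fun t : ℝ => Real.exp t * tilt θ x - 1) (tilt θ x) 0 := by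
    simpa using ((Real.hasDerivAt_exp 0).mul_const (tilt θ x)).sub_const 1
  exact hd''.unique h2

lemma objective_eq (W : Matrix (Fin q) (Fin q) ℝ) (N : ℕ) (m : Vec q) (y : ι → ℝ)
    (x : ι → Vec p) (θ : Param p q) (w : ι → ℝ) :
    objective W N m y x θ w = (∑ i, y i * (astar θ + inner ℝ (bet θ) (x i))
      - penalty W N m (mom θ)) + ∑ i, Real.log (w i) := by
  simp only [objective, Finset.sum_add_distrib]; ring

lemma contDiff_loglik (W : Matrix (Fin q) (Fin q) ℝ) (N : ℕ) (m : Vec q) (y : ι → ℝ)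
    (x : ι → Vec p) :
    ContDiff ℝ ⊤ (fun θ : Param p q => ∑ i, y i * (astar θ + inner ℝ (bet θ) (x i))
      - penalty W N m (mom θ)) :=
  (ContDiff.sum fun i _ => contDiff_const.mul (contDiff_linPred (x i))).sub
    (contDiff_penalty W N m)

/-! ### Lagrange multipliers at an interior maximizer -/

variable {ι : Type*} [Fintype ι]

lemma hasStrictFDerivAt_sum_log (w : ι → ℝ) (hw : ∀ i, 0 < w i) :
    HasStrictFDerivAt (fun w : ι → ℝ => ∑ i, Real.log (w i))
      (∑ i, (w i)⁻¹ • ContinuousLinearMap.proj (R := ℝ) (φ := fun _ : ι => ℝ) i) w := by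
  refine HasStrictFDerivAt.fun_sum fun i _ => ?_
  exact (Real.hasStrictDerivAt_log (hw i).ne').comp_hasStrictFDerivAt w
    (ContinuousLinearMap.proj (R := ℝ) (φ := fun _ : ι => ℝ) i).hasStrictFDerivAt

lemma hasStrictFDerivAt_constraint (h : Vec p → Vec q) (x : ι → Vec p) (θ : Param p q)
    (w : ι → ℝ) :
    HasStrictFDerivAt (fun z : Param p q × (ι → ℝ) => (∑ i, z.2 i, ∑ i, z.2 i • H h z.1 (x i)))
      (∑ i, ((ContinuousLinearMap.proj (R := ℝ) (φ := fun _ : ι => ℝ) i).comp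
          (ContinuousLinearMap.snd ℝ (Param p q) (ι → ℝ))).prod
        (w i • (fderiv ℝ (fun θ => H h θ (x i)) θ).comp
            (ContinuousLinearMap.fst ℝ (Param p q) (ι → ℝ)) +
          ((ContinuousLinearMap.proj (R := ℝ) (φ := fun _ : ι => ℝ) i).comp
          (ContinuousLinearMap.snd ℝ (Param p q) (ι → ℝ))).smulRight (H h θ (x i)))) (θ, w) := by
  have key : ∀ i, HasStrictFDerivAt (fun z : Param p q × (ι → ℝ) =>
      (z.2 i, z.2 i • H h z.1 (x i)))
      (((ContinuousLinearMap.proj (R := ℝ) (φ := fun _ : ι => ℝ) i).comp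
          (ContinuousLinearMap.snd ℝ (Param p q) (ι → ℝ))).prod
        (w i • (fderiv ℝ (fun θ => H h θ (x i)) θ).comp
            (ContinuousLinearMap.fst ℝ (Param p q) (ι → ℝ)) +
          ((ContinuousLinearMap.proj (R := ℝ) (φ := fun _ : ι => ℝ) i).comp
          (ContinuousLinearMap.snd ℝ (Param p q) (ι → ℝ))).smulRight (H h θ (x i)))) (θ, w) := by
    intro i
    have h1 : HasStrictFDerivAt (fun z : Param p q × (ι → ℝ) => z.2 i)
        ((ContinuousLinearMap.proj (R := ℝ) (φ := fun _ : ι => ℝ) i).comp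
          (ContinuousLinearMap.snd ℝ (Param p q) (ι → ℝ))) (θ, w) :=
      ((ContinuousLinearMap.proj (R := ℝ) (φ := fun _ : ι => ℝ) i).comp
          (ContinuousLinearMap.snd ℝ (Param p q) (ι → ℝ))).hasStrictFDerivAt
    have h2 : HasStrictFDerivAt (fun z : Param p q × (ι → ℝ) => H h z.1 (x i))
        ((fderiv ℝ (fun θ => H h θ (x i)) θ).comp
            (ContinuousLinearMap.fst ℝ (Param p q) (ι → ℝ))) (θ, w) :=
      HasStrictFDerivAt.comp (θ, w)
        ((contDiff_H h (x i)).contDiffAt.hasStrictFDerivAt (by simp))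
        hasStrictFDerivAt_fst
    exact h1.prodMk (h1.smul h2)
  have := HasStrictFDerivAt.fun_sum (u := Finset.univ) fun i _ => key i
  refine this.congr_of_eventuallyEq (Eventually.of_forall fun z => ?_)
  simp [Prod.ext_iff, Prod.fst_sum, Prod.snd_sum]

/-- Lagrange multipliers: a maximizer whose parameter is interior has weights of the empirical
likelihood form and yields a stationary point of the profile log-likelihood. -/
theorem IsMaximizer.exists_multiplier {h : Vec p → Vec q} {Θ : Set (Param p q)}
    {W : Matrix (Fin q) (Fin q) ℝ} {N : ℕ} {m : Vec q} {y : ι → ℝ} {x : ι → Vec p}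
    {θ : Param p q} {w : ι → ℝ} (hmax : IsMaximizer h Θ W N m y x θ w) (hθ : θ ∈ interior Θ) :
    ∃ ν : Mult q, (∀ i, w i = (Fintype.card ι : ℝ)⁻¹ * (1 + inner ℝ ν (H h θ (x i)))⁻¹) ∧
      IsStationary h W N m y x (θ, ν) := by
  classical
  have hpos := hmax.feasible.pos
  have htot := hmax.feasible.total
  have hH0 : ∑ i, w i • H h θ (x i) = 0 :=
    (sum_smul_H h θ x w htot).2 ⟨hmax.feasible.total_tilt, hmax.feasible.moment⟩
  set A : Param p q → ℝ := fun θ => ∑ i, y i * (astar θ + inner ℝ (bet θ) (x i))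
      - penalty W N m (mom θ) with hA
  set D : ι → (Param p q →L[ℝ] Mult q) := fun i => fderiv ℝ (fun θ => H h θ (x i)) θ with hD
  have hA' : HasStrictFDerivAt A (fderiv ℝ A θ) θ :=
    (contDiff_loglik W N m y x).contDiffAt.hasStrictFDerivAt (by simp)
  have hφ : HasStrictFDerivAt (fun z : Param p q × (ι → ℝ) => A z.1 + ∑ i, Real.log (z.2 i))
      ((fderiv ℝ A θ).comp (ContinuousLinearMap.fst ℝ (Param p q) (ι → ℝ)) +
        (∑ i, (w i)⁻¹ • ContinuousLinearMap.proj (R := ℝ) (φ := fun _ : ι => ℝ) i).comp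
        (ContinuousLinearMap.snd ℝ (Param p q) (ι → ℝ))) (θ, w) :=
    HasStrictFDerivAt.fun_add (f := fun z : Param p q × (ι → ℝ) => A z.1)
      (g := fun z : Param p q × (ι → ℝ) => ∑ i, Real.log (z.2 i))
      (HasStrictFDerivAt.comp (θ, w) hA' hasStrictFDerivAt_fst)
      (HasStrictFDerivAt.comp (g := fun w : ι → ℝ => ∑ i, Real.log (w i)) (θ, w)
        (hasStrictFDerivAt_sum_log w hpos) hasStrictFDerivAt_snd)
  have hext : IsLocalExtrOn (fun z : Param p q × (ι → ℝ) => A z.1 + ∑ i, Real.log (z.2 i))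
      {z | (fun z : Param p q × (ι → ℝ) => (∑ i, z.2 i, ∑ i, z.2 i • H h z.1 (x i))) z
        = (fun z : Param p q × (ι → ℝ) => (∑ i, z.2 i, ∑ i, z.2 i • H h z.1 (x i))) (θ, w)}
      (θ, w) := by
    right
    -- Membership in Θ and positivity of the weights are open conditions at this point, so locally
    -- only the equality constraints remain.
    have h1 : ∀ᶠ z : Param p q × (ι → ℝ) in 𝓝 (θ, w), z.1 ∈ Θ :=
      continuous_fst.continuousAt.eventually_mem (mem_interior_iff_mem_nhds.1 hθ)
    have h2 : ∀ᶠ z : Param p q × (ι → ℝ) in 𝓝 (θ, w), ∀ i, 0 < z.2 i := by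
      rw [eventually_all]
      intro i
      have : Continuous fun z : Param p q × (ι → ℝ) => z.2 i := by fun_prop
      exact this.continuousAt.eventually_mem (lt_mem_nhds (hpos i))
    filter_upwards [nhdsWithin_le_nhds h1, nhdsWithin_le_nhds h2, self_mem_nhdsWithin]
      with z hz1 hz2 hz3
    simp only [Prod.mk.injEq, htot, hH0] at hz3
    have h3 := (sum_smul_H h z.1 x z.2 hz3.1).1 hz3.2
    have := hmax.le z.1 z.2 ⟨hz1, hz2, hz3.1, h3.1, h3.2⟩
    rw [objective_eq, objective_eq] at this
    exact this
  -- This multiplier rule needs no constraint qualification; it only gives a nonzero pair (Λ, Λ₀),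
  -- and the abnormal case Λ₀ = 0 has to be excluded below.
  obtain ⟨Λ, Λ₀, hne, hΛ⟩ := hext.exists_linear_map_of_hasStrictFDerivAt
    (hasStrictFDerivAt_constraint h x θ w) hφ
  obtain ⟨ν', hν'⟩ : ∃ ν' : Mult q, ∀ v, Λ (0, v) = inner ℝ ν' v := by
    refine ⟨(InnerProductSpace.toDual ℝ (Mult q)).symm
      (LinearMap.toContinuousLinearMap (Λ.comp (LinearMap.inr ℝ ℝ (Mult q)))), fun v => ?_⟩
    rw [InnerProductSpace.toDual_symm_apply]
    simp
  set a := Λ (1, 0) with ha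
  have hΛeq : ∀ s v, Λ (s, v) = a * s + inner ℝ ν' v := by
    intro s v
    rw [← hν', ha, mul_comm, ← smul_eq_mul, ← map_smul, ← map_add]
    simp
  have hw : ∀ i, a + inner ℝ ν' (H h θ (x i)) + Λ₀ * (w i)⁻¹ = 0 := by
    intro i
    have := hΛ (0, Pi.single i 1)
    simpa [hΛeq, Pi.single_apply, Finset.sum_ite_eq, _root_.sum_apply, Prod.fst_sum,
      Prod.snd_sum, inner_smul_right] using this
  have hθ' : ∀ v : Param p q, ∑ i, w i * inner ℝ ν' (D i v) + Λ₀ * fderiv ℝ A θ v = 0 := by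
    intro v
    have := hΛ (v, 0)
    simpa [hΛeq, _root_.sum_apply, Prod.fst_sum, Prod.snd_sum, inner_sum,
      inner_smul_right] using this
  -- Weighting the i-th equation by w_i and summing removes the H term through the constraint, which
  -- fixes the multiplier of the total mass.
  have hsum : a + Λ₀ * Fintype.card ι = 0 := by
    have h1 : ∑ i, w i * (a + inner ℝ ν' (H h θ (x i)) + Λ₀ * (w i)⁻¹) = 0 :=
      Finset.sum_eq_zero fun i _ => by rw [hw i, mul_zero]
    have h2 : ∑ i, w i * inner ℝ ν' (H h θ (x i)) = 0 := by
      rw [← inner_zero_right (𝕜 := ℝ) ν', ← hH0, inner_sum]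
      simp [inner_smul_right]
    have h3 : ∀ i, w i * (Λ₀ * (w i)⁻¹) = Λ₀ := fun i => by
      field_simp [(hpos i).ne']
    simp only [mul_add, Finset.sum_add_distrib, h2, h3, ← Finset.sum_mul, htot] at h1
    simpa [mul_comm] using h1
  -- If Λ₀ = 0 then a = 0. The μ-directions, where the derivative of H is minus a unit vector, kill
  -- the last q coordinates of ν'; the α*-direction then kills the first, since Σ tilt · w = 1.
  have hΛ₀ : Λ₀ ≠ 0 := by
    rintro rfl
    have ha0 : a = 0 := by simpa using hsum
    apply hne
    have h1 : ν' = 0 := by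
      have hj : ∀ j, ν' (Sum.inr j) = 0 := by
        intro j
        have := hθ' (EuclideanSpace.single (Sum.inr (Sum.inr (Sum.inr j))) 1)
        simp only [hD, fderiv_H_mom, inner_neg_right, EuclideanSpace.inner_single_right,
          zero_mul, add_zero, ← Finset.sum_mul, htot] at this
        simpa using this
      have h0 : ν' (Sum.inl ()) = 0 := by
        have := hθ' (EuclideanSpace.single (Sum.inr (Sum.inl ())) 1)
        simp only [PiLp.inner_apply, Fintype.sum_sum_type, hj, hD, fderiv_H_astar,
          zero_mul, add_zero, Finset.univ_unique, Finset.sum_singleton, PUnit.default_eq_unit,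
          inner_zero_left, Finset.sum_const_zero] at this
        have ht := hmax.feasible.total_tilt
        simp only [RCLike.inner_apply, conj_trivial] at this
        have e : ∑ i, w i * (tilt θ (x i) * ν' (Sum.inl ())) = ν' (Sum.inl ()) := by
          calc _ = (∑ i, tilt θ (x i) * w i) * ν' (Sum.inl ()) := by
                rw [Finset.sum_mul]; exact Finset.sum_congr rfl fun i _ => by ring
            _ = _ := by rw [ht, one_mul]
        rw [← e]; exact this
      ext k
      rcases k with k | k
      · exact h0
      · exact hj k
    have : Λ = 0 := by
      apply LinearMap.ext
      rintro ⟨s, v⟩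
      rw [hΛeq, ha0, h1]; simp
    simp [this]
  set n : ℝ := (Fintype.card ι : ℝ) with hn
  have hn0 : n ≠ 0 := by
    intro h0
    have : IsEmpty ι := Fintype.card_eq_zero_iff.1 (Nat.cast_eq_zero.1 (hn ▸ h0))
    simp at htot
  -- With a = -nΛ₀, this scaling turns the weight equation into n w_i (1 + νᵀH_i) = 1.
  set ν : Mult q := -(n * Λ₀)⁻¹ • ν' with hν
  have hwi : ∀ i, n * w i * (1 + inner ℝ ν (H h θ (x i))) = 1 := by
    intro i
    have h1 := hw i
    rw [show a = -Λ₀ * n by linarith] at h1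
    rw [hν, inner_smul_left]
    have := (hpos i).ne'
    simp only [conj_trivial]
    field_simp at h1 ⊢
    linear_combination (-1 : ℝ) * h1
  have hpos' : ∀ i, 0 < 1 + inner ℝ ν (H h θ (x i)) := by
    intro i
    have hn' : 0 < n := lt_of_le_of_ne (by positivity) hn0.symm
    by_contra hc
    have := mul_nonpos_of_nonneg_of_nonpos (mul_pos hn' (hpos i)).le (not_lt.1 hc)
    linarith [hwi i]
  refine ⟨ν, fun i => ?_, hpos', ?_⟩
  · have := hwi i
    have h2 := (hpos' i).ne'
    field_simp
    linarith
  · have hH' : ∀ i, HasFDerivAt (fun η : Param p q × Mult q => 1 + inner ℝ η.2 (H h η.1 (x i)))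
        ((fderivInnerCLM ℝ (ν, H h θ (x i))).comp
          ((ContinuousLinearMap.snd ℝ (Param p q) (Mult q)).prod
          ((D i).comp (ContinuousLinearMap.fst ℝ (Param p q) (Mult q))))) (θ, ν) := by
      intro i
      have hd : HasFDerivAt (fun η : Param p q × Mult q => H h η.1 (x i))
          ((D i).comp (ContinuousLinearMap.fst ℝ (Param p q) (Mult q))) (θ, ν) :=
        HasFDerivAt.comp (g := fun θ => H h θ (x i)) (f := Prod.fst) (θ, ν)
          ((contDiff_H h (x i)).differentiable (by simp) θ).hasFDerivAt hasFDerivAt_fst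
      exact (HasFDerivAt.inner ℝ hasFDerivAt_snd hd).const_add 1
    have hl : HasFDerivAt (fun η : Param p q × Mult q => A η.1
        - ∑ i, Real.log (1 + inner ℝ η.2 (H h η.1 (x i))))
        ((fderiv ℝ A θ).comp (ContinuousLinearMap.fst ℝ (Param p q) (Mult q)) -
          ∑ i, (1 + inner ℝ ν (H h θ (x i)))⁻¹ • ((fderivInnerCLM ℝ (ν, H h θ (x i))).comp
          ((ContinuousLinearMap.snd ℝ (Param p q) (Mult q)).prod
          ((D i).comp (ContinuousLinearMap.fst ℝ (Param p q) (Mult q)))))) (θ, ν) :=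
      (HasFDerivAt.comp (g := A) (f := Prod.fst) (θ, ν) hA'.hasFDerivAt hasFDerivAt_fst).fun_sub
        (HasFDerivAt.fun_sum fun i _ => (hH' i).log (hpos' i).ne')
    have e1 : profileLogLik h W N m y x = fun η : Param p q × Mult q => A η.1
        - ∑ i, Real.log (1 + inner ℝ η.2 (H h η.1 (x i))) := by
      funext η
      simp only [profileLogLik, hA, Finset.sum_sub_distrib]
      ring
    rw [e1]
    convert hl using 1
    symm
    have hinv : ∀ i, (1 + inner ℝ ν (H h θ (x i)))⁻¹ = n * w i := fun i => by
      have h2 := (hpos' i).ne'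
      rw [inv_eq_one_div, div_eq_iff h2]
      linarith [hwi i]
    apply ContinuousLinearMap.ext
    rintro ⟨v, u⟩
    -- Stationarity in ν is the constraint itself; stationarity in θ is the multiplier equation
    -- `hθ'` rescaled.
    have hu : ∑ i, n * w i * inner ℝ u (H h θ (x i)) = 0 := by
      rw [show (0 : ℝ) = n * inner ℝ u (0 : Mult q) by simp, ← hH0, inner_sum, Finset.mul_sum]
      exact Finset.sum_congr rfl fun i _ => by rw [inner_smul_right]; ring
    have hv : fderiv ℝ A θ v = ∑ i, n * w i * inner ℝ ν (D i v) := by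
      have h1 := hθ' v
      have h2 : ∑ i, n * w i * inner ℝ ν (D i v) = -Λ₀⁻¹ * ∑ i, w i * inner ℝ ν' (D i v) := by
        rw [Finset.mul_sum]
        refine Finset.sum_congr rfl fun i _ => ?_
        rw [hν, inner_smul_left]
        simp only [conj_trivial]
        field_simp
      rw [h2]
      field_simp
      linarith
    simp only [hinv, _root_.sub_apply, _root_.sum_apply,
      _root_.smul_apply, ContinuousLinearMap.comp_apply,
      ContinuousLinearMap.prod_apply, fderivInnerCLM_apply, ContinuousLinearMap.coe_fst',
      ContinuousLinearMap.coe_snd', smul_eq_mul, mul_add, Finset.sum_add_distrib, hu, hv]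
    simp

/-! ### Bounds on the penalty and existence of a maximizer -/

variable {ι : Type*} [Fintype ι]

/-- The penalty is comparable to the squared Euclidean distance. -/
lemma exists_penalty_bounds {W : Matrix (Fin q) (Fin q) ℝ} (hW : W.PosDef) :
    ∃ c C : ℝ, 0 < c ∧ 0 < C ∧ ∀ (N : ℕ) (m μ : Vec q),
      c * N * ‖m - μ‖ ^ 2 ≤ penalty W N m μ ∧ penalty W N m μ ≤ C * N * ‖m - μ‖ ^ 2 := by
  set Q : Vec q → ℝ := fun v => dotProduct v.ofLp (W⁻¹.mulVec v.ofLp) with hQ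
  have hcont : Continuous Q := by
    unfold Q Matrix.mulVec dotProduct
    fun_prop
  have hpos : ∀ v, v ≠ 0 → 0 < Q v := fun v hv => by
    have := hW.inv.dotProduct_mulVec_pos (x := v.ofLp) (by
      intro h0; apply hv; ext i; simp [h0])
    simpa [hQ] using this
  have hhom : ∀ (a : ℝ) (v : Vec q), Q (a • v) = a ^ 2 * Q v := fun a v => by
    simp only [hQ, WithLp.ofLp_smul, Matrix.mulVec_smul, smul_dotProduct, dotProduct_smul,
      smul_eq_mul]
    ring
  obtain ⟨c, C, hc, hC, hb⟩ : ∃ c C : ℝ, 0 < c ∧ 0 < C ∧ ∀ v : Vec q, ‖v‖ = 1 →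
      c ≤ Q v ∧ Q v ≤ C := by
    -- The sphere is empty when q = 0; any positive constants serve then.
    by_cases hne : (Metric.sphere (0 : Vec q) 1).Nonempty
    · obtain ⟨v, hv, hmin⟩ := (isCompact_sphere (0 : Vec q) 1).exists_isMinOn hne
        hcont.continuousOn
      obtain ⟨u, hu, hmax⟩ := (isCompact_sphere (0 : Vec q) 1).exists_isMaxOn hne
        hcont.continuousOn
      refine ⟨Q v, Q u, hpos v ?_, hpos u ?_, fun z hz => ⟨hmin (by simpa using hz),
        hmax (by simpa using hz)⟩⟩
      · rintro rfl; simp at hv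
      · rintro rfl; simp at hu
    · refine ⟨1, 1, one_pos, one_pos, fun v hv => (hne ⟨v, by simpa using hv⟩).elim⟩
  have hb' : ∀ v : Vec q, c * ‖v‖ ^ 2 ≤ Q v ∧ Q v ≤ C * ‖v‖ ^ 2 := by
    intro v
    by_cases hv : v = 0
    · subst hv; simp [hQ]
    have hn : ‖v‖ ≠ 0 := by simpa using hv
    have h1 := hb (‖v‖⁻¹ • v) (by rw [norm_smul, norm_inv, norm_norm, inv_mul_cancel₀ hn])
    have h2 := hhom ‖v‖ (‖v‖⁻¹ • v)
    rw [smul_smul, mul_inv_cancel₀ hn, one_smul] at h2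
    rw [h2]
    have : 0 ≤ ‖v‖ ^ 2 := by positivity
    constructor <;> nlinarith [h1.1, h1.2]
  refine ⟨c / 2, C / 2, by positivity, by positivity, fun N m μ => ?_⟩
  have h3 := hb' (m - μ)
  have hN : (0 : ℝ) ≤ N := by positivity
  have h4 : penalty W N m μ = N * Q (m - μ) / 2 := rfl
  rw [h4]
  constructor <;> nlinarith [mul_le_mul_of_nonneg_left h3.1 hN, mul_le_mul_of_nonneg_left h3.2 hN]

lemma Feasible.le_one {h : Vec p → Vec q} {Θ : Set (Param p q)} {x : ι → Vec p}
    {θ : Param p q} {w : ι → ℝ} (hf : Feasible h Θ x θ w) (i : ι) : w i ≤ 1 := by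
  rw [← hf.total]
  exact Finset.single_le_sum (fun j _ => (hf.pos j).le) (Finset.mem_univ i)

/-- A maximizer exists as soon as the constraints can be met. -/
theorem exists_isMaximizer {h : Vec p → Vec q} {Θ : Set (Param p q)} (hΘ : IsCompact Θ)
    (W : Matrix (Fin q) (Fin q) ℝ) (N : ℕ) (m : Vec q) (y : ι → ℝ)
    {x : ι → Vec p} (hne : ∃ θ w, Feasible h Θ x θ w) :
    ∃ θ w, IsMaximizer h Θ W N m y x θ w := by
  classical
  obtain ⟨θ₁, w₁, hf₁⟩ := hne
  set A : Param p q → ℝ := fun θ => ∑ i, y i * (astar θ + inner ℝ (bet θ) (x i))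
      - penalty W N m (mom θ) with hA
  have hAc : Continuous A := (contDiff_loglik W N m y x).continuous
  obtain ⟨B, hB⟩ := hΘ.exists_bound_of_continuousOn hAc.continuousOn
  set c := objective W N m y x θ₁ w₁ with hc
  -- All weights are at most one, so each log w_j ≤ 0 and a single small weight already ruins the
  -- objective. Superlevel sets thus stay away from the singularity of the logarithm.
  have hlow : ∀ θ w, Feasible h Θ x θ w → c ≤ objective W N m y x θ w →
      ∀ i, Real.exp (c - B) ≤ w i := by
    intro θ w hf hle i
    rw [objective_eq] at hle
    have h1 : A θ ≤ B := (le_abs_self _).trans (hB θ hf.mem)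
    have h2 : ∑ j, Real.log (w j) ≤ Real.log (w i) := by
      rw [← Finset.add_sum_erase _ _ (Finset.mem_univ i)]
      have : ∑ j ∈ Finset.univ.erase i, Real.log (w j) ≤ 0 :=
        Finset.sum_nonpos fun j _ => Real.log_nonpos (hf.pos j).le (hf.le_one j)
      linarith
    rw [← Real.le_log_iff_exp_le (hf.pos i)]
    have h3 : c ≤ A θ + ∑ j, Real.log (w j) := hle
    linarith
  set K : Set (Param p q × (ι → ℝ)) :=
    (Θ ×ˢ Set.Icc (fun _ : ι => Real.exp (c - B)) (fun _ : ι => (1 : ℝ))) ∩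
    {z | ∑ i, z.2 i = 1 ∧ ∑ i, z.2 i • H h z.1 (x i) = 0} with hK
  have hKc : IsCompact K := by
    refine (hΘ.prod isCompact_Icc).inter_right ?_
    refine IsClosed.and ?_ ?_
    · exact isClosed_eq (by fun_prop) continuous_const
    · refine isClosed_eq ?_ continuous_const
      refine continuous_finsetSum _ fun i _ => ?_
      have := (contDiff_H h (x i)).continuous
      fun_prop
  have hKf : ∀ z ∈ K, Feasible h Θ x z.1 z.2 := by
    rintro ⟨θ, w⟩ ⟨⟨h1, h2⟩, h3, h4⟩
    obtain ⟨h5, h6⟩ := (sum_smul_H h θ x w h3).1 h4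
    exact ⟨h1, fun i => (Real.exp_pos _).trans_le (h2.1 i), h3, h5, h6⟩
  have hfK : ∀ θ w, Feasible h Θ x θ w → c ≤ objective W N m y x θ w → (θ, w) ∈ K := by
    intro θ w hf hle
    exact ⟨⟨hf.mem, fun i => hlow θ w hf hle i, fun i => hf.le_one i⟩, hf.total,
      (sum_smul_H h θ x w hf.total).2 ⟨hf.total_tilt, hf.moment⟩⟩
  have hcont : ContinuousOn (fun z : Param p q × (ι → ℝ) => A z.1 + ∑ i, Real.log (z.2 i)) K := by
    refine (hAc.comp continuous_fst).continuousOn.add ?_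
    refine continuousOn_finsetSum _ fun i _ => ContinuousOn.log ?_ ?_
    · exact Continuous.continuousOn (by fun_prop)
    · intro z hz
      exact ((hKf z hz).pos i).ne'
  obtain ⟨z, hz, hmax⟩ := hKc.exists_isMaxOn ⟨_, hfK θ₁ w₁ hf₁ le_rfl⟩ hcont
  have hobj : ∀ z : Param p q × (ι → ℝ), objective W N m y x z.1 z.2
      = A z.1 + ∑ i, Real.log (z.2 i) := fun z => objective_eq W N m y x z.1 z.2
  refine ⟨z.1, z.2, hKf z hz, fun θ' w' hf' => ?_⟩
  by_cases hle : c ≤ objective W N m y x θ' w'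
  · have := hmax (hfK θ' w' hf' hle)
    rw [hobj z]
    refine le_trans (le_of_eq (hobj (θ', w'))) this
  · have h1 := hmax (hfK θ₁ w₁ hf₁ le_rfl)
    rw [hobj z]
    exact (not_le.1 hle).le.trans (le_trans (le_of_eq (hobj (θ₁, w₁))) h1)

/-! ### Elementary inequalities -/

lemma add_mul_exp_pos {a b : ℝ} (ha : 0 < a) (hb : 0 < b) (u : ℝ) : 0 < a + b * Real.exp u := by
  positivity

lemma add_mul_exp_le {a b B u : ℝ} (ha : 0 < a) (hb : 0 < b) (hu : |u| ≤ B) :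
    a + b * Real.exp u ≤ (a + b) * Real.exp B := by
  have hB : 0 ≤ B := (abs_nonneg u).trans hu
  have h1 : Real.exp u ≤ Real.exp B := Real.exp_le_exp.2 ((le_abs_self u).trans hu)
  have h2 : 1 ≤ Real.exp B := Real.one_le_exp hB
  nlinarith

/-- Strong monotonicity of the logistic function on bounded intervals. -/
lemma logistic_strong_mono {a b κ B u v : ℝ} (hκ : 0 < κ) (hab : 0 < a + b)
    (ha : κ * (a + b) ≤ a) (hb : κ * (a + b) ≤ b) (hu : |u| ≤ B) (hv : |v| ≤ B) (huv : v ≤ u) :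
    κ ^ 2 * Real.exp (-3 * B) * (u - v) ≤
      b * Real.exp u / (a + b * Real.exp u) - b * Real.exp v / (a + b * Real.exp v) := by
  have ha0 : 0 < a := (mul_pos hκ hab).trans_le ha
  have hb0 : 0 < b := (mul_pos hκ hab).trans_le hb
  have pu := add_mul_exp_pos ha0 hb0 u
  have pv := add_mul_exp_pos ha0 hb0 v
  have e1 : b * Real.exp u / (a + b * Real.exp u) - b * Real.exp v / (a + b * Real.exp v)
      = a * b * (Real.exp u - Real.exp v) / ((a + b * Real.exp u) * (a + b * Real.exp v)) := by
    field_simp; ring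
  -- The difference of exponentials is at least e^(-B) (u - v), and the denominator is at most ((a +
  -- b) e^B)²; hence the exponent -3B.
  rw [e1, le_div_iff₀ (mul_pos pu pv)]
  have h1 : Real.exp (-B) * (u - v) ≤ Real.exp u - Real.exp v := by
    have : Real.exp u = Real.exp v * Real.exp (u - v) := by rw [← Real.exp_add]; ring_nf
    have h2 := Real.add_one_le_exp (u - v)
    have h3 : Real.exp (-B) ≤ Real.exp v := Real.exp_le_exp.2 (by linarith [neg_abs_le v])
    have h4 := Real.exp_pos v
    rw [this]
    nlinarith
  have h2 : (a + b * Real.exp u) * (a + b * Real.exp v) ≤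
      ((a + b) * Real.exp B) * ((a + b) * Real.exp B) :=
    mul_le_mul (add_mul_exp_le ha0 hb0 hu) (add_mul_exp_le ha0 hb0 hv) pv.le (by positivity)
  have h3 : Real.exp (-3 * B) * (Real.exp B * Real.exp B) = Real.exp (-B) := by
    rw [← Real.exp_add, ← Real.exp_add]; ring_nf
  have h4 : (κ * (a + b)) * (κ * (a + b)) ≤ a * b :=
    mul_le_mul ha hb (by positivity) ha0.le
  have h5 : 0 ≤ u - v := by linarith
  calc κ ^ 2 * Real.exp (-3 * B) * (u - v) * ((a + b * Real.exp u) * (a + b * Real.exp v))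
      ≤ κ ^ 2 * Real.exp (-3 * B) * (u - v) * (((a + b) * Real.exp B) * ((a + b) * Real.exp B)) :=
        mul_le_mul_of_nonneg_left h2 (by positivity)
    _ = (κ * (a + b)) * (κ * (a + b)) * ((Real.exp (-3 * B) * (Real.exp B * Real.exp B))
          * (u - v)) := by ring
    _ = (κ * (a + b)) * (κ * (a + b)) * (Real.exp (-B) * (u - v)) := by rw [h3]
    _ ≤ a * b * (Real.exp u - Real.exp v) := by
        apply mul_le_mul h4 h1 (by positivity) (by positivity)

/-- Strong convexity of `u ↦ log (a + b eᵘ)` on bounded intervals. -/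
lemma log_add_mul_exp_strong_convex {a b κ B u v : ℝ} (hκ : 0 < κ) (hab : 0 < a + b)
    (ha : κ * (a + b) ≤ a) (hb : κ * (a + b) ≤ b) (hu : |u| ≤ B) (hv : |v| ≤ B) :
    κ ^ 2 * Real.exp (-3 * B) / 2 * (u - v) ^ 2 ≤
      Real.log (a + b * Real.exp u) - Real.log (a + b * Real.exp v)
        - b * Real.exp v / (a + b * Real.exp v) * (u - v) := by
  have ha0 : 0 < a := (mul_pos hκ hab).trans_le ha
  have hb0 : 0 < b := (mul_pos hκ hab).trans_le hb
  set c := κ ^ 2 * Real.exp (-3 * B) with hc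
  set g := b * Real.exp v / (a + b * Real.exp v) with hg
  set D : ℝ → ℝ := fun w => Real.log (a + b * Real.exp w) - g * w - c / 2 * (w - v) ^ 2 with hD
  have hd : ∀ w, HasDerivAt D (b * Real.exp w / (a + b * Real.exp w) - g - c * (w - v)) w := by
    intro w
    have h1 : HasDerivAt (fun w => Real.log (a + b * Real.exp w))
        (b * Real.exp w / (a + b * Real.exp w)) w :=
      (((Real.hasDerivAt_exp w).const_mul b).const_add a).log (add_mul_exp_pos ha0 hb0 w).ne'
    have h2 : HasDerivAt (fun w => g * w) g w := by simpa using (hasDerivAt_id w).const_mul g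
    have h3 : HasDerivAt (fun w => c / 2 * (w - v) ^ 2) (c * (w - v)) w := by
      have := (((hasDerivAt_id' w).sub_const v).fun_pow 2).const_mul (c / 2)
      refine this.congr_deriv ?_
      push_cast
      ring
    exact (h1.sub h2).sub h3
  -- The derivative of D has the sign of w - v on [-B, B] by `logistic_strong_mono`, so D is
  -- smallest at v there; the mean value theorem makes this precise on either side.
  suffices D v ≤ D u by
    simp only [hD, sub_self] at this
    linarith
  have hcont : Continuous D := continuous_iff_continuousAt.2 fun w => (hd w).continuousAt
  have hvb := abs_le.1 hv
  have hub := abs_le.1 hu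
  rcases lt_trichotomy v u with h | h | h
  · obtain ⟨ξ, hξ, he⟩ := exists_hasDerivAt_eq_slope D _ h hcont.continuousOn fun w _ => hd w
    have := logistic_strong_mono hκ hab ha hb (u := ξ) (v := v) (B := B)
      (abs_le.2 ⟨by linarith [hξ.1], by linarith [hξ.2]⟩) hv hξ.1.le
    rw [← sub_nonneg]
    rw [eq_div_iff (by linarith)] at he
    rw [← he]
    apply mul_nonneg <;> linarith
  · rw [h]
  · obtain ⟨ξ, hξ, he⟩ := exists_hasDerivAt_eq_slope D _ h hcont.continuousOn fun w _ => hd w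
    have := logistic_strong_mono hκ hab ha hb (u := v) (v := ξ) (B := B) hv
      (abs_le.2 ⟨by linarith [hξ.1], by linarith [hξ.2]⟩) hξ.2.le
    rw [← sub_nonpos]
    rw [eq_div_iff (by linarith)] at he
    rw [← he]
    apply mul_nonpos_of_nonpos_of_nonneg <;> linarith

/-- The denominators absorb the exponential growth, so the Lipschitz constant is free of u and v.
This allows weights at θ and θ₀ to be compared over unbounded covariates. -/
lemma abs_inv_add_mul_exp_sub_le {a b : ℝ} (ha : 0 < a) (hb : 0 < b) (u v : ℝ) :
    |(a + b * Real.exp u)⁻¹ - (a + b * Real.exp v)⁻¹| ≤ a⁻¹ * |u - v| := by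
  wlog huv : v ≤ u generalizing u v
  · rw [abs_sub_comm, abs_sub_comm u v]
    exact this v u (not_le.1 huv).le
  have pu := add_mul_exp_pos ha hb u
  have pv := add_mul_exp_pos ha hb v
  have h1 : Real.exp u - Real.exp v ≤ Real.exp u * (u - v) := by
    have : Real.exp v = Real.exp u * Real.exp (v - u) := by rw [← Real.exp_add]; ring_nf
    have h2 := Real.add_one_le_exp (v - u)
    have h4 := Real.exp_pos u
    rw [this]
    nlinarith
  have h0 : Real.exp v ≤ Real.exp u := Real.exp_le_exp.2 huv
  have h5 : 0 ≤ u - v := by linarith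
  rw [inv_sub_inv pu.ne' pv.ne', abs_div, abs_of_pos (mul_pos pu pv),
    abs_of_nonneg h5, abs_of_nonpos (by nlinarith), div_le_iff₀ (mul_pos pu pv)]
  calc -(a + b * Real.exp v - (a + b * Real.exp u)) = b * (Real.exp u - Real.exp v) := by ring
    _ ≤ b * (Real.exp u * (u - v)) := mul_le_mul_of_nonneg_left h1 hb.le
    _ = (u - v) * (b * Real.exp u) := by ring
    _ ≤ (u - v) * (a + b * Real.exp u) := mul_le_mul_of_nonneg_left (by linarith) h5
    _ = a⁻¹ * (u - v) * ((a + b * Real.exp u) * a) := by field_simp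
    _ ≤ a⁻¹ * (u - v) * ((a + b * Real.exp u) * (a + b * Real.exp v)) := by
        apply mul_le_mul_of_nonneg_left _ (by positivity)
        apply mul_le_mul_of_nonneg_left _ pu.le
        have := Real.exp_pos v
        nlinarith

lemma abs_exp_div_sub_le {a b : ℝ} (ha : 0 < a) (hb : 0 < b) (u v : ℝ) :
    |Real.exp u / (a + b * Real.exp u) - Real.exp v / (a + b * Real.exp v)| ≤
      b⁻¹ * |u - v| := by
  have pu := add_mul_exp_pos ha hb u
  have pv := add_mul_exp_pos ha hb v
  have e : ∀ w, Real.exp w / (a + b * Real.exp w) = b⁻¹ * (1 - a * (a + b * Real.exp w)⁻¹) := by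
    intro w
    have := add_mul_exp_pos ha hb w
    field_simp; ring
  rw [e, e, show b⁻¹ * (1 - a * (a + b * Real.exp u)⁻¹) - b⁻¹ * (1 - a * (a + b * Real.exp v)⁻¹)
    = -(b⁻¹ * (a * ((a + b * Real.exp u)⁻¹ - (a + b * Real.exp v)⁻¹))) by ring, abs_neg, abs_mul,
    abs_mul, abs_of_pos ha, abs_of_pos (inv_pos.2 hb)]
  have := abs_inv_add_mul_exp_sub_le ha hb u v
  apply mul_le_mul_of_nonneg_left _ (inv_pos.2 hb).le
  calc a * _ ≤ a * (a⁻¹ * |u - v|) := mul_le_mul_of_nonneg_left this ha.le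
    _ = |u - v| := by field_simp

/-- If positive numbers with mean one have a small negative log-likelihood, they are close to one
in a weighted `ℓ¹` sense. -/
lemma sum_abs_sub_one_mul_le {ι : Type*} [Fintype ι] {a k : ι → ℝ} {K L : ℝ}
    (ha : ∀ i, 0 < a i) (hsum : ∑ i, a i = Fintype.card ι) (hK : -∑ i, Real.log (a i) ≤ K)
    (hk : ∀ i, 0 ≤ k i) (hL0 : 0 ≤ L) (hL : ∀ i, k i ≤ L) :
    ∑ i, |a i - 1| * k i ≤ K * L + 2 * √(K * ∑ i, k i ^ 2) := by
  -- This is log √a ≤ √a - 1. Summed, the terms a_i - 1 cancel by the mean-one condition, leaving -Σ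
  -- log a_i.
  have hs : ∀ i, (√(a i) - 1) ^ 2 ≤ a i - 1 - Real.log (a i) := by
    intro i
    have h1 := Real.log_le_sub_one_of_pos (Real.sqrt_pos.2 (ha i))
    rw [Real.log_sqrt (ha i).le] at h1
    have h2 := Real.sq_sqrt (ha i).le
    nlinarith
  have hsq : ∑ i, (√(a i) - 1) ^ 2 ≤ K := by
    calc _ ≤ ∑ i, (a i - 1 - Real.log (a i)) := Finset.sum_le_sum fun i _ => hs i
      _ = -∑ i, Real.log (a i) := by simp [Finset.sum_sub_distrib, hsum]
      _ ≤ K := hK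
  -- With s = √a - 1 one has a - 1 = s² + 2s. The quadratic part uses the uniform bound L, the
  -- linear part Cauchy–Schwarz.
  have hpt : ∀ i, |a i - 1| * k i ≤ (√(a i) - 1) ^ 2 * L + 2 * (|√(a i) - 1| * k i) := by
    intro i
    have h2 := Real.sq_sqrt (ha i).le
    have h3 : |a i - 1| ≤ (√(a i) - 1) ^ 2 + 2 * |√(a i) - 1| := by
      have : a i - 1 = (√(a i) - 1) ^ 2 + 2 * (√(a i) - 1) := by nlinarith
      rw [this]
      refine (abs_add_le _ _).trans ?_
      rw [abs_of_nonneg (sq_nonneg _), abs_mul, abs_two]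
    have h4 := mul_le_mul_of_nonneg_right h3 (hk i)
    have h5 := mul_le_mul_of_nonneg_left (hL i) (sq_nonneg (√(a i) - 1))
    linarith
  have hcs : ∑ i, |√(a i) - 1| * k i ≤ √(K * ∑ i, k i ^ 2) := by
    apply Real.le_sqrt_of_sq_le
    refine (Finset.sum_mul_sq_le_sq_mul_sq _ _ _).trans ?_
    simp only [sq_abs]
    exact mul_le_mul_of_nonneg_right hsq (Finset.sum_nonneg fun i _ => sq_nonneg _)
  calc _ ≤ ∑ i, ((√(a i) - 1) ^ 2 * L + 2 * (|√(a i) - 1| * k i)) :=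
        Finset.sum_le_sum fun i _ => hpt i
      _ = (∑ i, (√(a i) - 1) ^ 2) * L + 2 * ∑ i, |√(a i) - 1| * k i := by
        rw [Finset.sum_add_distrib, Finset.sum_mul, Finset.mul_sum]
      _ ≤ _ := by
        have := mul_le_mul_of_nonneg_right hsq hL0
        linarith

/-! ### Parameter blocks -/

@[simp] lemma gam_mkParam (γ a : ℝ) (β : Vec p) (μ : Vec q) : gam (mkParam γ a β μ) = γ := rfl

@[simp] lemma astar_mkParam (γ a : ℝ) (β : Vec p) (μ : Vec q) : astar (mkParam γ a β μ) = a := rfl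

@[simp] lemma bet_mkParam (γ a : ℝ) (β : Vec p) (μ : Vec q) : bet (mkParam γ a β μ) = β := rfl

@[simp] lemma mom_mkParam (γ a : ℝ) (β : Vec p) (μ : Vec q) : mom (mkParam γ a β μ) = μ := rfl

lemma norm_sq_eq_blocks (θ : Param p q) :
    ‖θ‖ ^ 2 = gam θ ^ 2 + astar θ ^ 2 + ‖bet θ‖ ^ 2 + ‖mom θ‖ ^ 2 := by
  simp only [EuclideanSpace.norm_sq_eq, Fintype.sum_sum_type, gam, astar, bet, mom,
    Finset.univ_unique, Finset.sum_singleton, PUnit.default_eq_unit, Real.norm_eq_abs, sq_abs]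
  ring

lemma norm_le_sum_blocks (θ : Param p q) :
    ‖θ‖ ≤ |gam θ| + |astar θ| + ‖bet θ‖ + ‖mom θ‖ := by
  have h1 := norm_sq_eq_blocks θ
  have h2 := abs_nonneg (gam θ)
  have h3 := abs_nonneg (astar θ)
  have h4 := norm_nonneg (bet θ)
  have h5 := norm_nonneg (mom θ)
  apply abs_le_of_sq_le_sq' _ (by positivity) |>.2
  rw [h1, ← sq_abs (gam θ), ← sq_abs (astar θ)]
  nlinarith [mul_nonneg h2 h3, mul_nonneg h2 h4, mul_nonneg h2 h5, mul_nonneg h3 h4,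
    mul_nonneg h3 h5, mul_nonneg h4 h5]

lemma abs_gam_le (θ : Param p q) : |gam θ| ≤ ‖θ‖ := by
  apply abs_le_of_sq_le_sq _ (norm_nonneg _)
  rw [norm_sq_eq_blocks]
  nlinarith [sq_nonneg (astar θ), sq_nonneg ‖bet θ‖, sq_nonneg ‖mom θ‖]

lemma abs_astar_le (θ : Param p q) : |astar θ| ≤ ‖θ‖ := by
  apply abs_le_of_sq_le_sq _ (norm_nonneg _)
  rw [norm_sq_eq_blocks]
  nlinarith [sq_nonneg (gam θ), sq_nonneg ‖bet θ‖, sq_nonneg ‖mom θ‖]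

lemma norm_bet_le (θ : Param p q) : ‖bet θ‖ ≤ ‖θ‖ := by
  apply (abs_le_of_sq_le_sq' _ (norm_nonneg _)).2
  rw [norm_sq_eq_blocks]
  nlinarith [sq_nonneg (gam θ), sq_nonneg (astar θ), sq_nonneg ‖mom θ‖]

lemma gam_sub (θ θ' : Param p q) : gam (θ - θ') = gam θ - gam θ' := rfl

lemma astar_sub (θ θ' : Param p q) : astar (θ - θ') = astar θ - astar θ' := rfl

lemma bet_sub (θ θ' : Param p q) : bet (θ - θ') = bet θ - bet θ' := rfl

lemma mom_sub (θ θ' : Param p q) : mom (θ - θ') = mom θ - mom θ' := rfl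

lemma tilt_pos (θ : Param p q) (x : Vec p) : 0 < tilt θ x := Real.exp_pos _

/-! ### Regular samples -/

variable {ι : Type*} [Fintype ι]

/-- The empirical averages entering the analysis of a case-control sample of `n₁` cases and `n₀`
controls are within `ε r` of their population values, where `r = n^(-1/3)`. -/
structure RegularSample (h : Vec p → Vec q) (θ₀ : Param p q) (E₀ E₁ : Vec q) (κ M cG B : ℝ)
    (n₁ n₀ r ε : ℝ) (y : ι → ℝ) (x : ι → Vec p) : Prop where
  r_pos : 0 < r
  card_eq : n₀ + n₁ = Fintype.card ι
  card_mul : (Fintype.card ι : ℝ) * r ^ 3 = 1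
  controls : κ * Fintype.card ι ≤ n₀
  cases : κ * Fintype.card ι ≤ n₁
  response : ∑ i, y i = n₁
  inv_mass : |∑ i, (n₀ + n₁ * tilt θ₀ (x i))⁻¹ - 1| ≤ ε * r
  tilt_mass : |∑ i, tilt θ₀ (x i) / (n₀ + n₁ * tilt θ₀ (x i)) - 1| ≤ ε * r
  inv_summary : ‖∑ i, (n₀ + n₁ * tilt θ₀ (x i))⁻¹ • h (x i) - E₀‖ ≤ ε * r
  tilt_summary : ‖∑ i, (tilt θ₀ (x i) / (n₀ + n₁ * tilt θ₀ (x i))) •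
    h (x i) - E₁‖ ≤ ε * r
  score : ‖∑ i, (y i - n₁ * (tilt θ₀ (x i) /
    (n₀ + n₁ * tilt θ₀ (x i)))) • x i‖ ≤ ε * (Fintype.card ι * r)
  moment : ∑ i, (1 + ‖x i‖ + ‖h (x i)‖) ^ 3 ≤ M * Fintype.card ι
  gram : ∀ (a : ℝ) (b : Vec p), cG * Fintype.card ι * (a ^ 2 + ‖b‖ ^ 2) ≤
    ∑ i, Real.exp (-B * ‖x i‖) * (a + inner ℝ b (x i)) ^ 2

section

variable {h : Vec p → Vec q} {θ₀ : Param p q} {E₀ E₁ : Vec q} {κ M cG B n₁ n₀ r ε : ℝ} {y : ι → ℝ}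
  {x : ι → Vec p}

lemma RegularSample.card_pos (S : RegularSample h θ₀ E₀ E₁ κ M cG B n₁ n₀ r ε y x) :
    0 < (Fintype.card ι : ℝ) := by
  have := S.card_mul
  rcases (Nat.cast_nonneg (α := ℝ) (Fintype.card ι)).lt_or_eq with h | h
  · exact h
  · rw [← h] at this; simp at this

lemma RegularSample.cases_pos (S : RegularSample h θ₀ E₀ E₁ κ M cG B n₁ n₀ r ε y x)
    (hκ : 0 < κ) : 0 < n₁ :=
  (mul_pos hκ S.card_pos).trans_le S.cases

lemma RegularSample.controls_pos (S : RegularSample h θ₀ E₀ E₁ κ M cG B n₁ n₀ r ε y x)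
    (hκ : 0 < κ) : 0 < n₀ :=
  (mul_pos hκ S.card_pos).trans_le S.controls

lemma RegularSample.error_nonneg (S : RegularSample h θ₀ E₀ E₁ κ M cG B n₁ n₀ r ε y x) :
    0 ≤ ε * r := (abs_nonneg _).trans S.inv_mass

end

/-- The logistic log-likelihood at `θ`, up to sign of the intercept offset. -/
def logisticLik (n₁ n₀ : ℝ) (y : ι → ℝ) (x : ι → Vec p) (θ : Param p q) : ℝ :=
  ∑ i, (y i * (astar θ + inner ℝ (bet θ) (x i)) - Real.log (n₀ + n₁ * tilt θ (x i)))

lemma abs_log_le {s : ℝ} (hs : |s - 1| ≤ 1 / 2) : |Real.log s| ≤ 2 * |s - 1| := by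
  obtain ⟨h1, h2⟩ := abs_le.1 hs
  have hs0 : 0 < s := by linarith
  have h3 := Real.log_le_sub_one_of_pos hs0
  have h4 := Real.one_sub_inv_le_log_of_pos hs0
  have h5 : -(2 * |s - 1|) ≤ 1 - s⁻¹ := by
    have : 1 - s⁻¹ = (s - 1) / s := by field_simp
    rw [this, le_div_iff₀ hs0]
    nlinarith [abs_nonneg (s - 1), neg_abs_le (s - 1)]
  exact abs_le.2 ⟨by linarith, by linarith [le_abs_self (s - 1), abs_nonneg (s - 1)]⟩

/-- The cost of normalizing an average whose total mass is only approximately one. -/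
lemma norm_inv_smul_sub_le {s e : ℝ} {A E : Vec q} (hs : |s - 1| ≤ e) (he : e ≤ 1 / 2)
    (hA : ‖A - E‖ ≤ e) : ‖s⁻¹ • A - E‖ ≤ 2 * (1 + ‖E‖) * e := by
  obtain ⟨h1, h2⟩ := abs_le.1 hs
  have hs0 : 1 / 2 ≤ s := by linarith
  have hs' : s⁻¹ ≤ 2 := by
    rw [inv_le_comm₀ (by linarith) (by norm_num)]; linarith
  have hs'' : 0 < s⁻¹ := by positivity
  have e1 : s⁻¹ • A - E = s⁻¹ • (A - E) + (s⁻¹ * (1 - s)) • E := by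
    rw [mul_sub, inv_mul_cancel₀ (by linarith)]
    module
  rw [e1]
  refine (norm_add_le _ _).trans ?_
  rw [norm_smul, norm_smul, Real.norm_eq_abs, Real.norm_eq_abs, abs_mul, abs_of_pos hs'',
    abs_sub_comm 1 s]
  have h3 : s⁻¹ * ‖A - E‖ ≤ 2 * e := mul_le_mul hs' hA (norm_nonneg _) (by norm_num)
  have h4 : s⁻¹ * |s - 1| ≤ 2 * e := mul_le_mul hs' hs (abs_nonneg _) (by norm_num)
  nlinarith [mul_le_mul_of_nonneg_right h4 (norm_nonneg E)]

/-- On a regular sample some parameter close to the truth is feasible and has an objective not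
smaller than the logistic log-likelihood at the truth, up to the penalty. -/
theorem RegularSample.exists_feasible {h : Vec p → Vec q} {θ₀ : Param p q} {E₀ E₁ : Vec q}
    {κ M cG B n₁ n₀ r ε : ℝ} {y : ι → ℝ} {x : ι → Vec p}
    (S : RegularSample h θ₀ E₀ E₁ κ M cG B n₁ n₀ r ε y x) (hκ : 0 < κ) (hε : ε * r ≤ 1 / 2)
    (hμ : mom θ₀ = (1 + Real.exp (gam θ₀))⁻¹ • (E₁ + Real.exp (gam θ₀) • E₀)) :
    ∃ θ w, Feasible h Set.univ x θ w ∧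
      ‖θ - θ₀‖ ≤ (4 + 2 * (1 + ‖E₀‖) + 2 * (1 + ‖E₁‖)) * (ε * r) ∧
      ‖mom θ - mom θ₀‖ ≤ (2 * (1 + ‖E₀‖) + 2 * (1 + ‖E₁‖)) * (ε * r) ∧
      ∀ W N m, logisticLik n₁ n₀ y x θ₀ - penalty W N m (mom θ) ≤ objective W N m y x θ w := by
  have hn := S.card_pos
  have hn1 := S.cases_pos hκ
  have hn0 := S.controls_pos hκ
  have he0 : 0 ≤ ε * r := (abs_nonneg _).trans S.inv_mass
  set d : ι → ℝ := fun i => n₀ + n₁ * tilt θ₀ (x i) with hd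
  have hdpos : ∀ i, 0 < d i := fun i => by
    have := tilt_pos θ₀ (x i)
    positivity
  set s := ∑ i, (d i)⁻¹ with hs
  set s' := ∑ i, tilt θ₀ (x i) / d i with hs'
  have Hs : |s - 1| ≤ ε * r := S.inv_mass
  have Hs' : |s' - 1| ≤ ε * r := S.tilt_mass
  have hs0 : 0 < s := by linarith [(abs_le.1 Hs).1]
  have hs0' : 0 < s' := by linarith [(abs_le.1 Hs').1]
  have hss : n₀ * s + n₁ * s' = Fintype.card ι := by
    have : ∀ i, n₀ * (d i)⁻¹ + n₁ * (tilt θ₀ (x i) / d i) = 1 := fun i => by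
      have := (hdpos i).ne'
      field_simp
      simp [hd]
    rw [hs, hs', Finset.mul_sum, Finset.mul_sum, ← Finset.sum_add_distrib]
    simp [this]
  -- The weights (s d_i)⁻¹ have mass one but tilted mass s'/s; shifting the intercept by log (s/s')
  -- repairs this. γ and β keep their true values, and μ is then dictated by the moment constraint.
  set δ := Real.log s - Real.log s' with hδ
  have hexp : Real.exp δ = s / s' := by
    rw [hδ, Real.exp_sub, Real.exp_log hs0, Real.exp_log hs0']
  set g := Real.exp (gam θ₀) with hg
  have hg0 : 0 < g := Real.exp_pos _
  set μ : Vec q := (1 + g)⁻¹ • (s'⁻¹ • ∑ i, (tilt θ₀ (x i) / d i) • h (x i)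
    + g • (s⁻¹ • ∑ i, (d i)⁻¹ • h (x i))) with hμdef
  set θ : Param p q := mkParam (gam θ₀) (astar θ₀ + δ) (bet θ₀) μ with hθ
  have htilt : ∀ z, tilt θ z = s / s' * tilt θ₀ z := by
    intro z
    simp only [tilt, hθ, astar_mkParam, bet_mkParam]
    rw [← hexp, ← Real.exp_add]
    ring_nf
  have hB : ‖μ - mom θ₀‖ ≤ (2 * (1 + ‖E₀‖) + 2 * (1 + ‖E₁‖)) * (ε * r) := by
    have e1 : μ - mom θ₀ = (1 + g)⁻¹ • ((s'⁻¹ • ∑ i, (tilt θ₀ (x i) / d i) • h (x i) - E₁)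
        + g • (s⁻¹ • ∑ i, (d i)⁻¹ • h (x i) - E₀)) := by
      rw [hμ, hμdef]; module
    have b1 := norm_inv_smul_sub_le Hs' hε S.tilt_summary
    have b0 := norm_inv_smul_sub_le Hs hε S.inv_summary
    rw [e1, norm_smul, norm_inv, Real.norm_of_nonneg (by positivity : 0 ≤ 1 + g),
      inv_mul_le_iff₀ (by positivity)]
    refine (norm_add_le _ _).trans ?_
    rw [norm_smul, Real.norm_of_nonneg hg0.le]
    have b2 := mul_le_mul_of_nonneg_left b0 hg0.le
    have p0 : 0 ≤ 2 * (1 + ‖E₀‖) * (ε * r) := by positivity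
    have p1 : 0 ≤ 2 * (1 + ‖E₁‖) * (ε * r) := by positivity
    nlinarith [mul_nonneg hg0.le p1]
  have hδ' : |δ| ≤ 4 * (ε * r) := by
    have b1 := abs_log_le (Hs.trans hε)
    have b2 := abs_log_le (Hs'.trans hε)
    have := abs_sub (Real.log s) (Real.log s')
    linarith
  set w : ι → ℝ := fun i => s⁻¹ * (d i)⁻¹ with hw
  refine ⟨θ, w, ⟨Set.mem_univ _, fun i => ?_, ?_, ?_, ?_⟩, ?_, hB, ?_⟩
  · have := hdpos i
    positivity
  · rw [hw, ← Finset.mul_sum, inv_mul_cancel₀ hs0.ne']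
  · calc ∑ i, tilt θ (x i) * w i = s'⁻¹ * ∑ i, tilt θ₀ (x i) / d i := by
          rw [Finset.mul_sum]
          refine Finset.sum_congr rfl fun i _ => ?_
          rw [htilt, hw]
          have := (hdpos i).ne'
          field_simp
      _ = 1 := inv_mul_cancel₀ hs0'.ne'
  · simp only [hθ, mom_mkParam, gam_mkParam]
    rw [← hθ, hμdef, Finset.smul_sum, Finset.smul_sum, Finset.smul_sum, ← Finset.sum_add_distrib,
      Finset.smul_sum]
    refine Finset.sum_congr rfl fun i _ => ?_
    rw [htilt, hw, smul_smul, smul_smul, smul_smul, ← add_smul, smul_smul]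
    congr 1
    have := (hdpos i).ne'
    rw [← hg]
    field_simp
  · refine (norm_le_sum_blocks _).trans ?_
    rw [gam_sub, astar_sub, bet_sub, mom_sub]
    simp only [hθ, gam_mkParam, astar_mkParam, bet_mkParam, mom_mkParam, sub_self, abs_zero,
      norm_zero, add_sub_cancel_left]
    linarith
  · intro W N m
    have hlog : ∀ i, Real.log (w i) = -Real.log s - Real.log (d i) := fun i => by
      rw [hw, Real.log_mul (by positivity) (inv_ne_zero (hdpos i).ne'), Real.log_inv, Real.log_inv]
      ring
    have e1 : objective W N m y x θ w = logisticLik n₁ n₀ y x θ₀ - penalty W N m (mom θ)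
        + (n₁ * δ - Fintype.card ι * Real.log s) := by
      simp only [objective, logisticLik, hlog, hθ, astar_mkParam, bet_mkParam]
      have : ∀ i, y i * (astar θ₀ + δ + inner ℝ (bet θ₀) (x i)) + (-Real.log s - Real.log (d i))
          = (y i * (astar θ₀ + inner ℝ (bet θ₀) (x i)) - Real.log (n₀ + n₁ * tilt θ₀ (x i)))
            + (y i * δ - Real.log s) := fun i => by simp only [hd]; ring
      simp only [this]
      rw [Finset.sum_add_distrib, Finset.sum_sub_distrib (f := fun i => y i * δ),
        ← Finset.sum_mul, S.response]
      simp
      ring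
    rw [e1]
    have l1 := Real.log_le_sub_one_of_pos hs0
    have l2 := Real.log_le_sub_one_of_pos hs0'
    -- The expression equals -n₀ log s - n₁ log s', which is at least n₀(1 - s) + n₁(1 - s') = 0 by
    -- `hss`. Normalization costs nothing in the objective.
    have : 0 ≤ n₁ * δ - Fintype.card ι * Real.log s := by
      rw [← S.card_eq, hδ]
      have hc := S.card_eq
      nlinarith [mul_le_mul_of_nonneg_left l1 hn0.le, mul_le_mul_of_nonneg_left l2 hn1.le]
    linarith

/-! ### Comparison with the logistic likelihood and localization -/

variable {ι : Type*} [Fintype ι]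

lemma abs_linPred_le {Λ : ℝ} {θ : Param p q} (hθ : ‖θ‖ ≤ Λ) (x : Vec p) :
    |astar θ + inner ℝ (bet θ) x| ≤ Λ * (1 + ‖x‖) := by
  have h1 := (abs_astar_le θ).trans hθ
  have h2 := (norm_bet_le θ).trans hθ
  have h3 := abs_real_inner_le_norm (bet θ) x
  have h4 := abs_add_le (astar θ) (inner ℝ (bet θ) x)
  have h5 := mul_le_mul_of_nonneg_right h2 (norm_nonneg x)
  linarith

lemma abs_linPred_sub_le (θ θ' : Param p q) (x : Vec p) :
    |(astar θ + inner ℝ (bet θ) x) - (astar θ' + inner ℝ (bet θ') x)| ≤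
      (|astar θ - astar θ'| + ‖bet θ - bet θ'‖) * (1 + ‖x‖) := by
  have e : (astar θ + inner ℝ (bet θ) x) - (astar θ' + inner ℝ (bet θ') x)
      = (astar θ - astar θ') + inner ℝ (bet θ - bet θ') x := by
    rw [inner_sub_left]; ring
  rw [e]
  have h3 := abs_real_inner_le_norm (bet θ - bet θ') x
  have h4 := abs_add_le (astar θ - astar θ') (inner ℝ (bet θ - bet θ') x)
  nlinarith [abs_nonneg (astar θ - astar θ'), norm_nonneg (bet θ - bet θ'), norm_nonneg x,
    mul_nonneg (abs_nonneg (astar θ - astar θ')) (norm_nonneg x)]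

/-- When n₀ + n₁ is the sample size, the factors w_i (n₀ + n₁ tilt) average to one, so their
logarithms have nonpositive sum. This is what bounds the empirical likelihood by the logistic one.
-/
lemma Feasible.sum_mul_eq {h : Vec p → Vec q} {Θ : Set (Param p q)} {x : ι → Vec p}
    {θ : Param p q} {w : ι → ℝ} (hf : Feasible h Θ x θ w) (n₁ n₀ : ℝ) :
    ∑ i, w i * (n₀ + n₁ * tilt θ (x i)) = n₀ + n₁ := by
  calc _ = n₀ * ∑ i, w i + n₁ * ∑ i, tilt θ (x i) * w i := by
        rw [Finset.mul_sum, Finset.mul_sum, ← Finset.sum_add_distrib]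
        exact Finset.sum_congr rfl fun i _ => by ring
    _ = _ := by rw [hf.total, hf.total_tilt]; ring

lemma Feasible.objective_eq_logisticLik {h : Vec p → Vec q} {Θ : Set (Param p q)} {x : ι → Vec p}
    {θ : Param p q} {w : ι → ℝ} (hf : Feasible h Θ x θ w) {n₁ n₀ : ℝ} (h1 : 0 < n₁)
    (h0 : 0 < n₀) (W : Matrix (Fin q) (Fin q) ℝ) (N : ℕ) (m : Vec q) (y : ι → ℝ) :
    objective W N m y x θ w = logisticLik n₁ n₀ y x θ
      + ∑ i, Real.log (w i * (n₀ + n₁ * tilt θ (x i))) - penalty W N m (mom θ) := by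
  simp only [objective, logisticLik]
  rw [← Finset.sum_add_distrib]
  congr 1
  refine Finset.sum_congr rfl fun i _ => ?_
  have := tilt_pos θ (x i)
  rw [Real.log_mul (hf.pos i).ne' (by positivity)]
  ring

/-- The logistic log-likelihood drops quadratically away from the truth. -/
lemma RegularSample.logisticLik_le {h : Vec p → Vec q} {θ₀ : Param p q} {E₀ E₁ : Vec q}
    {κ M cG Λ n₁ n₀ r ε : ℝ} {y : ι → ℝ} {x : ι → Vec p}
    (S : RegularSample h θ₀ E₀ E₁ κ M cG (3 * Λ) n₁ n₀ r ε y x) (hκ : 0 < κ) (hcG : 0 ≤ cG)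
    (hθ₀ : ‖θ₀‖ ≤ Λ) {θ : Param p q} (hθ : ‖θ‖ ≤ Λ) :
    logisticLik n₁ n₀ y x θ ≤ logisticLik n₁ n₀ y x θ₀
      + Fintype.card ι * (ε * r) * (|astar θ - astar θ₀| + ‖bet θ - bet θ₀‖)
      - κ ^ 2 * Real.exp (-3 * Λ) / 2 * (cG / 2) * Fintype.card ι *
        (|astar θ - astar θ₀| + ‖bet θ - bet θ₀‖) ^ 2 := by
  have hn := S.card_pos
  have hn1 := S.cases_pos hκ
  have hn0 := S.controls_pos hκ
  set n : ℝ := (Fintype.card ι : ℝ) with hndef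
  set Δa := astar θ - astar θ₀ with hΔa
  set Δb := bet θ - bet θ₀ with hΔb
  -- Residuals of the logistic fit at the truth: Σ v_i and Σ v_i x_i are the scores for the
  -- intercept and the slope.
  set v : ι → ℝ := fun i => y i - n₁ * (tilt θ₀ (x i) / (n₀ + n₁ * tilt θ₀ (x i))) with hv
  set C := κ ^ 2 * Real.exp (-3 * Λ) / 2 with hC
  have hpt : ∀ i, (y i * (astar θ + inner ℝ (bet θ) (x i)) - Real.log (n₀ + n₁ * tilt θ (x i)))
      ≤ (y i * (astar θ₀ + inner ℝ (bet θ₀) (x i)) - Real.log (n₀ + n₁ * tilt θ₀ (x i)))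
        + (v i * Δa + inner ℝ Δb (v i • x i))
        - C * (Real.exp (-(3 * Λ) * ‖x i‖) * (Δa + inner ℝ Δb (x i)) ^ 2) := by
    intro i
    have hk := log_add_mul_exp_strong_convex (a := n₀) (b := n₁) (κ := κ) hκ
      (by linarith) (by rw [S.card_eq]; exact S.controls) (by rw [S.card_eq]; exact S.cases)
      (abs_linPred_le hθ (x i)) (abs_linPred_le hθ₀ (x i))
    -- The linear predictor is bounded only by Λ(1 + ‖x‖), so the curvature constant decays in ‖x‖;
    -- this is why the Gram condition carries an exponential weight.
    have e1 : Real.exp (-3 * (Λ * (1 + ‖x i‖)))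
        = Real.exp (-3 * Λ) * Real.exp (-(3 * Λ) * ‖x i‖) := by
      rw [← Real.exp_add]; ring_nf
    have e2 : (astar θ + inner ℝ (bet θ) (x i)) - (astar θ₀ + inner ℝ (bet θ₀) (x i))
        = Δa + inner ℝ Δb (x i) := by
      rw [hΔb, inner_sub_left]; ring
    rw [e1, e2] at hk
    simp only [tilt, inner_smul_right, hv]
    have e3 : astar θ + inner ℝ (bet θ) (x i)
        = astar θ₀ + inner ℝ (bet θ₀) (x i) + (Δa + inner ℝ Δb (x i)) := by linarith
    rw [mul_div_assoc n₁] at hk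
    have e4 : y i * (astar θ + inner ℝ (bet θ) (x i)) = y i * (astar θ₀ + inner ℝ (bet θ₀) (x i))
        + y i * (Δa + inner ℝ Δb (x i)) := by rw [e3]; ring
    rw [e4, hC]
    linarith
  have hsum : logisticLik n₁ n₀ y x θ ≤ logisticLik n₁ n₀ y x θ₀
      + ((∑ i, v i) * Δa + inner ℝ Δb (∑ i, v i • x i))
      - C * ∑ i, Real.exp (-(3 * Λ) * ‖x i‖) * (Δa + inner ℝ Δb (x i)) ^ 2 := by
    refine (Finset.sum_le_sum fun i (_ : i ∈ Finset.univ) => hpt i).trans_eq ?_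
    rw [Finset.sum_sub_distrib, Finset.sum_add_distrib, Finset.sum_add_distrib, ← Finset.sum_mul,
      ← inner_sum, ← Finset.mul_sum]
    rfl
  have hg := S.gram Δa Δb
  have hv1 : |∑ i, v i| ≤ n * (ε * r) := by
    have : ∑ i, v i = -n₁ * (∑ i, tilt θ₀ (x i) / (n₀ + n₁ * tilt θ₀ (x i)) - 1) := by
      simp only [hv]
      rw [Finset.sum_sub_distrib, S.response, ← Finset.mul_sum]; ring
    rw [this, abs_mul, abs_neg, abs_of_pos hn1]
    exact mul_le_mul (by linarith [S.card_eq]) S.tilt_mass (abs_nonneg _) hn.le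
  have hv2 : ‖∑ i, v i • x i‖ ≤ n * (ε * r) := S.score.trans_eq (by ring)
  have h1 : (∑ i, v i) * Δa ≤ n * (ε * r) * |Δa| := by
    refine (le_abs_self _).trans ?_
    rw [abs_mul]
    exact mul_le_mul_of_nonneg_right hv1 (abs_nonneg _)
  have h2 : inner ℝ Δb (∑ i, v i • x i) ≤ n * (ε * r) * ‖Δb‖ := by
    refine (real_inner_le_norm _ _).trans ?_
    rw [mul_comm]
    exact mul_le_mul_of_nonneg_right hv2 (norm_nonneg _)
  have hC0 : 0 ≤ C := by positivity
  have h3 : cG / 2 * n * (|Δa| + ‖Δb‖) ^ 2 ≤ cG * n * (Δa ^ 2 + ‖Δb‖ ^ 2) := by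
    rw [← sq_abs Δa]
    have : 0 ≤ cG * n := by positivity
    nlinarith [mul_nonneg this (sq_nonneg (|Δa| - ‖Δb‖))]
  have h4 := mul_le_mul_of_nonneg_left (h3.trans hg) hC0
  linarith

/-- Splits the error by a c - c₀ = (a - 1) c + (c - c₀) into the deviation of the weights from the
likelihood form and the effect of moving the parameter. -/
lemma norm_sum_smul_sub_le {H : Type*} [NormedAddCommGroup H] [NormedSpace ℝ H] {a c c₀ k : ι → ℝ}
    {z : ι → H} {E : H} {L D e : ℝ} (hc0 : ∀ i, 0 ≤ c i) (hc : ∀ i, c i ≤ L)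
    (hcc : ∀ i, |c i - c₀ i| ≤ L * (D * k i)) (hE : ‖∑ i, c₀ i • z i - E‖ ≤ e) :
    ‖∑ i, (a i * c i) • z i - E‖ ≤
      L * (∑ i, |a i - 1| * ‖z i‖ + D * ∑ i, k i * ‖z i‖) + e := by
  have e1 : ∑ i, (a i * c i) • z i - E = ∑ i, (((a i - 1) * c i) • z i + (c i - c₀ i) • z i)
      + (∑ i, c₀ i • z i - E) := by
    rw [← add_sub_assoc, ← Finset.sum_add_distrib]
    congr 1
    refine Finset.sum_congr rfl fun i _ => ?_
    module
  rw [e1]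
  refine (norm_add_le _ _).trans (add_le_add ?_ hE)
  rw [Finset.mul_sum, ← Finset.sum_add_distrib, Finset.mul_sum]
  refine norm_sum_le_of_le _ fun i _ => ?_
  refine (norm_add_le _ _).trans ?_
  rw [norm_smul, norm_smul, Real.norm_eq_abs, Real.norm_eq_abs, abs_mul, abs_of_nonneg (hc0 i)]
  have h1 : |a i - 1| * c i ≤ |a i - 1| * L := mul_le_mul_of_nonneg_left (hc i) (abs_nonneg _)
  have h2 := mul_le_mul_of_nonneg_right h1 (norm_nonneg (z i))
  have h3 := mul_le_mul_of_nonneg_right (hcc i) (norm_nonneg (z i))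
  linarith

/-- The moment constraint determines `γ` when the two conditional means differ. -/
lemma abs_gam_sub_le {E₀ E₁ A B μ μ₀ : Vec q} {g g₀ Λ e : ℝ} (hE : E₀ ≠ E₁) (hg : |g| ≤ Λ)
    (hg₀ : |g₀| ≤ Λ) (hμ : μ = (1 + Real.exp g)⁻¹ • (B + Real.exp g • A))
    (hμ₀ : μ₀ = (1 + Real.exp g₀)⁻¹ • (E₁ + Real.exp g₀ • E₀)) (hA : ‖A - E₀‖ ≤ e)
    (hB : ‖B - E₁‖ ≤ e) (hm : ‖μ - μ₀‖ ≤ e) :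
    |g - g₀| ≤ Real.exp Λ * (1 + Real.exp Λ) ^ 2 * (3 / ‖E₀ - E₁‖) * e := by
  have hD : 0 < ‖E₀ - E₁‖ := norm_pos_iff.2 (sub_ne_zero.2 hE)
  have p1 := Real.exp_pos g
  have p2 := Real.exp_pos g₀
  -- In terms of the control proportion s the mean is the convex combination (1 - s) B + s A, so s -
  -- s₀ is read off along E₀ - E₁. Passing back from s to g costs the exponential constants.
  set s := Real.exp g / (1 + Real.exp g) with hs
  set s₀ := Real.exp g₀ / (1 + Real.exp g₀) with hs₀
  have e1 : (1 + Real.exp g)⁻¹ = 1 - s := by rw [hs]; field_simp; ring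
  have e2 : (1 + Real.exp g₀)⁻¹ = 1 - s₀ := by rw [hs₀]; field_simp; ring
  have e3 : (1 + Real.exp g)⁻¹ * Real.exp g = s := by rw [hs]; field_simp
  have e4 : (1 + Real.exp g₀)⁻¹ * Real.exp g₀ = s₀ := by rw [hs₀]; field_simp
  have s1 : 0 ≤ s := by positivity
  have s2 : 0 ≤ 1 - s := by rw [← e1]; positivity
  rw [smul_add, smul_smul, e3, e1] at hμ
  rw [smul_add, smul_smul, e4, e2] at hμ₀
  have key : (s - s₀) • (E₀ - E₁) = (μ - μ₀) - ((1 - s) • (B - E₁) + s • (A - E₀)) := by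
    rw [hμ, hμ₀]; module
  have hk : |s - s₀| * ‖E₀ - E₁‖ ≤ 3 * e := by
    rw [← Real.norm_eq_abs, ← norm_smul, key]
    refine (norm_sub_le _ _).trans ?_
    have := norm_add_le ((1 - s) • (B - E₁)) (s • (A - E₀))
    rw [norm_smul, norm_smul, Real.norm_of_nonneg s1, Real.norm_of_nonneg s2] at this
    have he : 0 ≤ e := (norm_nonneg _).trans hA
    nlinarith [mul_le_mul_of_nonneg_left hB s2, mul_le_mul_of_nonneg_left hA s1]
  have hk' : |s - s₀| ≤ 3 / ‖E₀ - E₁‖ * e := by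
    rw [div_mul_eq_mul_div, le_div_iff₀ hD]; exact hk
  have hexp : Real.exp g - Real.exp g₀ = (s - s₀) * ((1 + Real.exp g) * (1 + Real.exp g₀)) := by
    rw [hs, hs₀]; field_simp; ring
  have u1 : Real.exp g ≤ Real.exp Λ := Real.exp_le_exp.2 ((le_abs_self _).trans hg)
  have u2 : Real.exp g₀ ≤ Real.exp Λ := Real.exp_le_exp.2 ((le_abs_self _).trans hg₀)
  have hexp' : |Real.exp g - Real.exp g₀| ≤ (1 + Real.exp Λ) ^ 2 * (3 / ‖E₀ - E₁‖ * e) := by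
    rw [hexp, abs_mul, abs_of_pos (by positivity : 0 < (1 + Real.exp g) * (1 + Real.exp g₀)),
      mul_comm, sq]
    exact mul_le_mul (mul_le_mul (by linarith) (by linarith) (by positivity) (by positivity)) hk'
      (abs_nonneg _) (by positivity)
  have hlow : ∀ a b : ℝ, |a| ≤ Λ → |b| ≤ Λ → b ≤ a →
      Real.exp (-Λ) * (a - b) ≤ Real.exp a - Real.exp b := by
    intro a b _ hb hab
    have : Real.exp a = Real.exp b * Real.exp (a - b) := by rw [← Real.exp_add]; ring_nf
    have h2 := Real.add_one_le_exp (a - b)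
    have h3 : Real.exp (-Λ) ≤ Real.exp b := Real.exp_le_exp.2 (by linarith [neg_abs_le b])
    have h4 := Real.exp_pos b
    rw [this]
    nlinarith
  have hlow' : Real.exp (-Λ) * |g - g₀| ≤ |Real.exp g - Real.exp g₀| := by
    rcases le_total g₀ g with h | h
    · rw [abs_of_nonneg (by linarith : 0 ≤ g - g₀)]
      exact (hlow g g₀ hg hg₀ h).trans (le_abs_self _)
    · rw [abs_sub_comm g, abs_sub_comm (Real.exp g), abs_of_nonneg (by linarith : 0 ≤ g₀ - g)]
      exact (hlow g₀ g hg₀ hg h).trans (le_abs_self _)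
  have h5 := mul_le_mul_of_nonneg_left (hlow'.trans hexp') (Real.exp_pos Λ).le
  rw [← mul_assoc, ← Real.exp_add, add_neg_cancel, Real.exp_zero, one_mul] at h5
  linarith

lemma RegularSample.sum_summary_le {ι : Type*} [Fintype ι] {h : Vec p → Vec q} {θ₀ : Param p q}
    {E₀ E₁ : Vec q} {κ M cG B n₁ n₀ r ε : ℝ} {y : ι → ℝ} {x : ι → Vec p}
    (S : RegularSample h θ₀ E₀ E₁ κ M cG B n₁ n₀ r ε y x) :
    ∑ i, (1 + ‖x i‖) * ‖h (x i)‖ ≤ M * Fintype.card ι := by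
  refine le_trans (Finset.sum_le_sum fun i _ => ?_) S.moment
  have h1 := norm_nonneg (x i)
  have h2 := norm_nonneg (h (x i))
  have h3 := mul_nonneg h1 h2
  have h4 : (1 + ‖x i‖ + ‖h (x i)‖) ^ 2 ≤ (1 + ‖x i‖ + ‖h (x i)‖) ^ 3 :=
    pow_le_pow_right₀ (by linarith) (by norm_num)
  nlinarith

lemma RegularSample.sum_sq_summary_le {ι : Type*} [Fintype ι] {h : Vec p → Vec q} {θ₀ : Param p q}
    {E₀ E₁ : Vec q} {κ M cG B n₁ n₀ r ε : ℝ} {y : ι → ℝ} {x : ι → Vec p}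
    (S : RegularSample h θ₀ E₀ E₁ κ M cG B n₁ n₀ r ε y x) :
    ∑ i, ‖h (x i)‖ ^ 2 ≤ M * Fintype.card ι := by
  refine le_trans (Finset.sum_le_sum fun i _ => ?_) S.moment
  have h1 := norm_nonneg (x i)
  have h2 := norm_nonneg (h (x i))
  have h3 := mul_nonneg h1 h2
  have h4 : (1 + ‖x i‖ + ‖h (x i)‖) ^ 2 ≤ (1 + ‖x i‖ + ‖h (x i)‖) ^ 3 :=
    pow_le_pow_right₀ (by linarith) (by norm_num)
  nlinarith

/-- One term of the third-moment sum is at most M n = M r⁻³, and M ≤ M³. The size 1/r of the largest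
summary is what the accuracy r can just absorb. -/
lemma RegularSample.summary_le {ι : Type*} [Fintype ι] {h : Vec p → Vec q} {θ₀ : Param p q}
    {E₀ E₁ : Vec q} {κ M cG B n₁ n₀ r ε : ℝ} {y : ι → ℝ} {x : ι → Vec p}
    (S : RegularSample h θ₀ E₀ E₁ κ M cG B n₁ n₀ r ε y x) (hM : 1 ≤ M) (i : ι) :
    ‖h (x i)‖ ≤ M / r := by
  have hr := S.r_pos
  have h1 := norm_nonneg (x i)
  have h2 := norm_nonneg (h (x i))
  have h3 : ‖h (x i)‖ ^ 3 ≤ M * Fintype.card ι := by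
    calc _ ≤ (1 + ‖x i‖ + ‖h (x i)‖) ^ 3 := pow_le_pow_left₀ h2 (by linarith) 3
      _ ≤ ∑ i, (1 + ‖x i‖ + ‖h (x i)‖) ^ 3 :=
        Finset.single_le_sum (f := fun i => (1 + ‖x i‖ + ‖h (x i)‖) ^ 3)
          (fun j _ => by positivity) (Finset.mem_univ i)
      _ ≤ _ := S.moment
  rw [le_div_iff₀ hr]
  refine (pow_le_pow_iff_left₀ (by positivity) (by linarith) (by norm_num : (3 : ℕ) ≠ 0)).1 ?_
  calc (‖h (x i)‖ * r) ^ 3 = ‖h (x i)‖ ^ 3 * r ^ 3 := by ring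
    _ ≤ M * Fintype.card ι * r ^ 3 := mul_le_mul_of_nonneg_right h3 (by positivity)
    _ = M := by rw [mul_assoc, S.card_mul, mul_one]
    _ ≤ M ^ 3 := le_self_pow₀ hM (by norm_num)

set_option maxHeartbeats 1000000 in
/-- On a regular sample, every feasible parameter whose objective is almost as large as the
logistic log-likelihood at the truth is close to the truth. -/
theorem exists_norm_sub_le {h : Vec p → Vec q} {θ₀ : Param p q}
    {E₀ E₁ : Vec q} (hE : E₀ ≠ E₁)
    (hμ : mom θ₀ = (1 + Real.exp (gam θ₀))⁻¹ • (E₁ + Real.exp (gam θ₀) • E₀))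
    {κ M cG Λ cp cN C₀ : ℝ} (hκ : 0 < κ) (hM : 1 ≤ M) (hcG : 0 < cG) (hΛ : ‖θ₀‖ ≤ Λ)
    (hcp : 0 < cp) (hcN : 0 < cN) (hC₀ : 0 ≤ C₀) :
    ∃ C : ℝ, 0 < C ∧ ∀ {ι : Type} [Fintype ι] {n₁ n₀ r ε : ℝ} {y : ι → ℝ} {x : ι → Vec p},
      RegularSample h θ₀ E₀ E₁ κ M cG (3 * Λ) n₁ n₀ r ε y x → ε ≤ 1 →
      ∀ (W : Matrix (Fin q) (Fin q) ℝ) (N : ℕ) (m : Vec q),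
      (∀ μ, cp * N * ‖m - μ‖ ^ 2 ≤ penalty W N m μ) → cN * Fintype.card ι ≤ N →
      ‖m - mom θ₀‖ ≤ ε * r → ∀ θ w, Feasible h Set.univ x θ w → ‖θ‖ ≤ Λ →
      logisticLik n₁ n₀ y x θ₀ - C₀ * (ε * r) ^ 2 * Fintype.card ι ≤ objective W N m y x θ w →
      ‖θ - θ₀‖ ≤ C * (ε * r) := by
  set c := κ ^ 2 * Real.exp (-3 * Λ) / 2 * (cG / 2) with hc
  have hc0 : 0 < c := by positivity
  -- C₁ bounds the error of (α*, β), C₂ the leftover log-weight and penalty deficits, C₃ the error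
  -- of μ, C₄ that of the two reweighted means of h, and C₆ that of γ, each in units of εr.
  set C₁ := (1 + C₀) / c + 1 with hC₁
  have hC₁0 : 0 < C₁ := by positivity
  set C₂ := C₁ + C₀ with hC₂
  have hC₂0 : 0 < C₂ := by positivity
  set C₃ := √(C₂ / (cp * cN)) + 1 with hC₃
  have hC₃0 : 0 < C₃ := by positivity
  set Kw := C₂ * M + 2 * √(C₂ * M) with hKw
  have hKw0 : 0 ≤ Kw := by positivity
  set C₄ := κ⁻¹ * (Kw + C₁ * M) + 1 with hC₄
  have hC₄0 : 0 < C₄ := by positivity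
  set C₆ := Real.exp Λ * (1 + Real.exp Λ) ^ 2 * (3 / ‖E₀ - E₁‖) * (C₃ + C₄) with hC₆
  have hC₆0 : 0 ≤ C₆ := by positivity
  refine ⟨C₆ + C₁ + C₃, by positivity, ?_⟩
  intro ι _ n₁ n₀ r ε y x S hε W N m hpen hN hm θ w hf hθ hobj
  have hn := S.card_pos
  have hn1 := S.cases_pos hκ
  have hn0 := S.controls_pos hκ
  have hr := S.r_pos
  have he0 := S.error_nonneg
  -- Here ε ≤ 1 is used: a deficit of order (εr)² per observation, multiplied by the largest summary
  -- of order 1/r, is still O(εr).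
  have hεr : (ε * r) * (ε * r) / r ≤ ε * r := by
    rw [div_le_iff₀ hr]
    have : ε * r ≤ 1 * r := mul_le_mul_of_nonneg_right hε hr.le
    nlinarith
  set e := ε * r with he
  set n : ℝ := (Fintype.card ι : ℝ) with hndef
  set D := |astar θ - astar θ₀| + ‖bet θ - bet θ₀‖ with hD
  have hD0 : 0 ≤ D := by positivity
  set a : ι → ℝ := fun i => w i * (n₀ + n₁ * tilt θ (x i)) with ha
  have ha0 : ∀ i, 0 < a i := fun i => by
    have h1 := hf.pos i
    have h2 := tilt_pos θ (x i)
    positivity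
  have hasum : ∑ i, a i = Fintype.card ι := by rw [ha, hf.sum_mul_eq, S.card_eq]
  set T := -∑ i, Real.log (a i) with hT
  have hT0 : 0 ≤ T := by
    have : ∑ i, Real.log (a i) ≤ ∑ i, (a i - 1) :=
      Finset.sum_le_sum fun i _ => Real.log_le_sub_one_of_pos (ha0 i)
    simp [Finset.sum_sub_distrib, hasum] at this
    linarith
  have hpen' := hpen (mom θ)
  have hpen0 : 0 ≤ penalty W N m (mom θ) := le_trans (by positivity) hpen'
  have hL : logisticLik n₁ n₀ y x θ ≤ logisticLik n₁ n₀ y x θ₀ + n * e * D - c * n * D ^ 2 :=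
    S.logisticLik_le hκ hcG.le hΛ hθ
  rw [hf.objective_eq_logisticLik hn1 hn0] at hobj
  -- The three terms on the left are nonnegative, so near-optimality controls them all together.
  have hmain : c * n * D ^ 2 + T + penalty W N m (mom θ) ≤ n * e * D + C₀ * e ^ 2 * n := by
    linarith
  have hDe : D ≤ C₁ * e := by
    -- If D > C₁e then D > e, hence C₀e² ≤ C₀eD; one factor D cancels and leaves D ≤ (1 + C₀)e/c.
    by_contra hcon
    push Not at hcon
    have h1 : e ≤ C₁ * e := by
      have : 0 ≤ (1 + C₀) / c * e := by positivity
      rw [hC₁]; linarith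
    have h2 : e < D := h1.trans_lt hcon
    have hDpos : 0 < D := he0.trans_lt h2
    have h3 : n * (c * D ^ 2) ≤ n * (e * D + C₀ * e ^ 2) := by linarith
    have h4 := le_of_mul_le_mul_left h3 hn
    have h5 : D * (c * D) ≤ D * ((1 + C₀) * e) := by
      have : C₀ * (e * e) ≤ C₀ * (e * D) :=
        mul_le_mul_of_nonneg_left (mul_le_mul_of_nonneg_left h2.le he0) hC₀
      linarith
    have h6 := le_of_mul_le_mul_left h5 hDpos
    have h7 : D ≤ (1 + C₀) / c * e := by
      rw [div_mul_eq_mul_div, le_div_iff₀ hc0]; linarith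
    rw [hC₁] at hcon
    linarith
  have hTP : T + penalty W N m (mom θ) ≤ C₂ * e ^ 2 * n := by
    have h1 : n * e * D ≤ n * e * (C₁ * e) := mul_le_mul_of_nonneg_left hDe (by positivity)
    have h2 : 0 ≤ c * n * D ^ 2 := by positivity
    rw [hC₂]
    linarith
  have hmm : ‖m - mom θ‖ ≤ √(C₂ / (cp * cN)) * e := by
    apply (abs_le_of_sq_le_sq' _ (by positivity)).2
    rw [mul_pow, Real.sq_sqrt (by positivity), div_mul_eq_mul_div, le_div_iff₀ (by positivity)]
    have h1 : cp * (cN * n) * ‖m - mom θ‖ ^ 2 ≤ C₂ * e ^ 2 * n :=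
      le_trans (mul_le_mul_of_nonneg_right (mul_le_mul_of_nonneg_left hN hcp.le) (by positivity))
        (by linarith)
    refine le_of_mul_le_mul_right ?_ hn
    linarith
  have hmu : ‖mom θ - mom θ₀‖ ≤ C₃ * e := by
    have h1 := norm_sub_le_norm_sub_add_norm_sub (mom θ) m (mom θ₀)
    rw [norm_sub_rev (mom θ) m] at h1
    rw [hC₃]
    linarith
  have hw : ∑ i, |a i - 1| * ‖h (x i)‖ ≤ Kw * (e * n) := by
    have h1 := sum_abs_sub_one_mul_le (K := C₂ * e ^ 2 * n) (L := M / r)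
      (k := fun i => ‖h (x i)‖) ha0 hasum (by linarith) (fun i => norm_nonneg _) (by positivity)
      (S.summary_le hM)
    refine h1.trans ?_
    have h2 : √(C₂ * e ^ 2 * n * ∑ i, ‖h (x i)‖ ^ 2) ≤ √(C₂ * M) * (e * n) := by
      rw [← Real.sqrt_sq (by positivity : 0 ≤ e * n), ← Real.sqrt_mul (by positivity)]
      apply Real.sqrt_le_sqrt
      have := mul_le_mul_of_nonneg_left S.sum_sq_summary_le
        (by positivity : 0 ≤ C₂ * e ^ 2 * n)
      refine this.trans_eq (by ring)
    have h3 : C₂ * e ^ 2 * n * (M / r) ≤ C₂ * M * (e * n) := by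
      calc C₂ * e ^ 2 * n * (M / r) = C₂ * M * n * (e * e / r) := by ring
        _ ≤ C₂ * M * n * e := mul_le_mul_of_nonneg_left hεr (by positivity)
        _ = _ := by ring
    rw [hKw]
    linarith
  have hbound : (κ * n)⁻¹ * (∑ i, |a i - 1| * ‖h (x i)‖ + D * ∑ i, (1 + ‖x i‖) * ‖h (x i)‖) + e
      ≤ C₄ * e := by
    have h1 : D * ∑ i, (1 + ‖x i‖) * ‖h (x i)‖ ≤ C₁ * e * (M * n) :=
      mul_le_mul hDe S.sum_summary_le (Finset.sum_nonneg fun i _ => by positivity) (by positivity)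
    have h2 := mul_le_mul_of_nonneg_left (add_le_add hw h1) (by positivity : 0 ≤ (κ * n)⁻¹)
    have h3 : (κ * n)⁻¹ * (Kw * (e * n) + C₁ * e * (M * n)) = κ⁻¹ * (Kw + C₁ * M) * e := by
      field_simp
    rw [hC₄]
    linarith
  have hΔ := fun i => abs_linPred_sub_le θ θ₀ (x i)
  have hi0 : n₀⁻¹ ≤ (κ * n)⁻¹ := inv_anti₀ (by positivity) S.controls
  have hi1 : n₁⁻¹ ≤ (κ * n)⁻¹ := inv_anti₀ (by positivity) S.cases
  have hA := norm_sum_smul_sub_le (a := a) (c := fun i => (n₀ + n₁ * tilt θ (x i))⁻¹)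
    (L := (κ * n)⁻¹) (D := D) (k := fun i => 1 + ‖x i‖)
    (fun i => by have := tilt_pos θ (x i); positivity)
    (fun i => by
      have := tilt_pos θ (x i)
      refine (inv_anti₀ hn0 ?_).trans hi0
      linarith [mul_pos hn1 this])
    (fun i => by
      refine (abs_inv_add_mul_exp_sub_le hn0 hn1 _ _).trans ?_
      exact mul_le_mul hi0 (hΔ i) (abs_nonneg _) (by positivity)) S.inv_summary
  have hB := norm_sum_smul_sub_le (a := a) (c := fun i => tilt θ (x i) / (n₀ + n₁ * tilt θ (x i)))
    (L := (κ * n)⁻¹) (D := D) (k := fun i => 1 + ‖x i‖)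
    (fun i => by have := tilt_pos θ (x i); positivity)
    (fun i => by
      have := tilt_pos θ (x i)
      refine le_trans ?_ hi1
      rw [div_le_iff₀ (by positivity)]
      field_simp
      linarith)
    (fun i => by
      refine (abs_exp_div_sub_le hn0 hn1 _ _).trans ?_
      exact mul_le_mul hi1 (hΔ i) (abs_nonneg _) (by positivity)) S.tilt_summary
  -- Writing w_i = a_i / (n₀ + n₁ tilt) turns the moment constraint into a mixture of the two
  -- reweighted means, which `hA` and `hB` place near E₀ and E₁.
  have hmom : mom θ = (1 + Real.exp (gam θ))⁻¹ •
      (∑ i, (a i * (tilt θ (x i) / (n₀ + n₁ * tilt θ (x i)))) • h (x i)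
        + Real.exp (gam θ) • ∑ i, (a i * (n₀ + n₁ * tilt θ (x i))⁻¹) • h (x i)) := by
    rw [← hf.moment, Finset.smul_sum, ← Finset.sum_add_distrib, Finset.smul_sum]
    refine Finset.sum_congr rfl fun i _ => ?_
    rw [smul_smul, ← add_smul, smul_smul]
    congr 1
    have h1 := tilt_pos θ (x i)
    have h2 : n₀ + n₁ * tilt θ (x i) ≠ 0 := by positivity
    simp only [ha]
    field_simp
  have hγ := abs_gam_sub_le (e := (C₃ + C₄) * e) hE ((abs_gam_le θ).trans hθ)
    ((abs_gam_le θ₀).trans hΛ) hmom hμ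
    ((hA.trans hbound).trans (mul_le_mul_of_nonneg_right (by linarith) he0))
    ((hB.trans hbound).trans (mul_le_mul_of_nonneg_right (by linarith) he0))
    (hmu.trans (mul_le_mul_of_nonneg_right (by linarith) he0))
  rw [← mul_assoc, ← hC₆] at hγ
  refine (norm_le_sum_blocks _).trans ?_
  rw [gam_sub, astar_sub, bet_sub, mom_sub]
  linarith

/-! ### The deterministic conclusion for regular samples -/

lemma Feasible.mono {ι : Type*} [Fintype ι] {h : Vec p → Vec q} {Θ Θ' : Set (Param p q)}
    {x : ι → Vec p} {θ : Param p q} {w : ι → ℝ} (hf : Feasible h Θ x θ w) (hθ : θ ∈ Θ') :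
    Feasible h Θ' x θ w :=
  ⟨hθ, hf.pos, hf.total, hf.total_tilt, hf.moment⟩

lemma rpow_neg_third_eq {n r : ℝ} (hr : 0 < r) (h : n * r ^ 3 = 1) :
    n ^ (-(1 / 3) : ℝ) = r := by
  rw [eq_inv_of_mul_eq_one_left h, Real.rpow_neg (by positivity), Real.inv_rpow (by positivity),
    inv_inv, ← Real.rpow_natCast, ← Real.rpow_mul hr.le]
  norm_num

/-- On a sufficiently regular sample the estimator is good. -/
theorem exists_goodEstimator {h : Vec p → Vec q} {θ₀ : Param p q}
    {E₀ E₁ : Vec q} (hE : E₀ ≠ E₁)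
    (hμ : mom θ₀ = (1 + Real.exp (gam θ₀))⁻¹ • (E₁ + Real.exp (gam θ₀) • E₀))
    {Θ : Set (Param p q)} (hΘ : IsCompact Θ) (hθ₀ : θ₀ ∈ interior Θ)
    {W : Matrix (Fin q) (Fin q) ℝ} (hW : W.PosDef)
    {κ M cG Λ cN CN : ℝ} (hκ : 0 < κ) (hM : 1 ≤ M) (hcG : 0 < cG) (hΛ : ∀ θ ∈ Θ, ‖θ‖ ≤ Λ)
    (hcN : 0 < cN) (hCN : 0 < CN) :
    ∃ ε : ℝ, 0 < ε ∧ ∀ {ι : Type} [Fintype ι] {n₁ n₀ r : ℝ} {y : ι → ℝ} {x : ι → Vec p},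
      RegularSample h θ₀ E₀ E₁ κ M cG (3 * Λ) n₁ n₀ r ε y x →
      ∀ (N : ℕ) (m : Vec q), cN * Fintype.card ι ≤ N → N ≤ CN * Fintype.card ι →
      ‖m - mom θ₀‖ ≤ ε * r → GoodEstimator h Θ W N m y x θ₀ := by
  obtain ⟨ρ, hρ, hball⟩ := Metric.mem_nhds_iff.1 (mem_interior_iff_mem_nhds.1 hθ₀)
  obtain ⟨cp, Cp, hcp, hCp, hpen⟩ := exists_penalty_bounds hW
  set K₁ := 4 + 2 * (1 + ‖E₀‖) + 2 * (1 + ‖E₁‖) with hK₁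
  set K₂ := 2 * (1 + ‖E₀‖) + 2 * (1 + ‖E₁‖) with hK₂
  have hK₁0 : 0 < K₁ := by positivity
  have hK₂0 : 0 < K₂ := by positivity
  obtain ⟨C, hC, hloc⟩ := exists_norm_sub_le (C₀ := Cp * CN * (1 + K₂) ^ 2) hE hμ hκ hM hcG
    (hΛ θ₀ (interior_subset hθ₀)) hcp hcN (by positivity)
  -- The three bounds serve, in turn, the construction of the feasible point, a distance strictly
  -- below r for every maximizer, and membership of both points in the ρ-ball inside Θ.
  set ε := min (1 / 2) (min (1 / (2 * C)) (ρ / (2 * (K₁ + C)))) with hεdef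
  have hε0 : 0 < ε := by positivity
  have hε1 : ε ≤ 1 / 2 := min_le_left _ _
  have hε2 : ε * C < 1 := by
    have : ε ≤ 1 / (2 * C) := (min_le_right _ _).trans (min_le_left _ _)
    rw [le_div_iff₀ (by positivity)] at this
    linarith
  have hε3 : ε * (K₁ + C) < ρ := by
    have : ε ≤ ρ / (2 * (K₁ + C)) := (min_le_right _ _).trans (min_le_right _ _)
    rw [le_div_iff₀ (by positivity)] at this
    linarith
  refine ⟨ε, hε0, ?_⟩
  intro ι _ n₁ n₀ r y x S N m hN1 hN2 hm
  have hr := S.r_pos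
  have hn := S.card_pos
  have hr1 : r ≤ 1 := by
    have h1 : (1 : ℝ) ≤ Fintype.card ι := by
      have : 0 < Fintype.card ι := by exact_mod_cast hn
      exact_mod_cast this
    have h2 : r ^ 3 ≤ 1 := by
      rw [← S.card_mul]
      exact le_mul_of_one_le_left (by positivity) h1
    exact (pow_le_one_iff_of_nonneg hr.le (by norm_num)).1 h2
  have her : ε * r ≤ ε := mul_le_of_le_one_right hε0.le hr1
  obtain ⟨θc, wc, hfc, hθc, hμc, hobjc⟩ := S.exists_feasible hκ (her.trans hε1) hμ
  have hfcΘ : Feasible h Θ x θc wc := by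
    refine hfc.mono (hball ?_)
    rw [mem_ball_iff_norm]
    refine hθc.trans_lt ?_
    nlinarith
  have hpenc : penalty W N m (mom θc) ≤
      Cp * CN * (1 + K₂) ^ 2 * (ε * r) ^ 2 * Fintype.card ι := by
    refine (hpen N m (mom θc)).2.trans ?_
    have h1 : ‖m - mom θc‖ ≤ (1 + K₂) * (ε * r) := by
      have := norm_sub_le_norm_sub_add_norm_sub m (mom θ₀) (mom θc)
      rw [norm_sub_rev (mom θ₀)] at this
      linarith
    have h2 := pow_le_pow_left₀ (norm_nonneg _) h1 2
    calc Cp * N * ‖m - mom θc‖ ^ 2 ≤ Cp * (CN * Fintype.card ι) * ((1 + K₂) * (ε * r)) ^ 2 :=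
          mul_le_mul (mul_le_mul_of_nonneg_left hN2 hCp.le) h2 (by positivity) (by positivity)
      _ = _ := by ring
  refine ⟨exists_isMaximizer hΘ W N m y ⟨θc, wc, hfcΘ⟩, fun θ w hmax => ?_⟩
  have hobj := hmax.le θc wc hfcΘ
  have hdist := hloc S (by linarith) W N m (fun μ => (hpen N m μ).1) hN1 hm θ w
    (hmax.feasible.mono (Set.mem_univ _)) (hΛ θ hmax.feasible.mem)
    (by have := hobjc W N m; linarith)
  constructor
  · apply Metric.ball_subset_interior_closedBall
    rw [mem_ball_iff_norm, rpow_neg_third_eq hr S.card_mul]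
    refine hdist.trans_lt ?_
    nlinarith
  · apply hmax.exists_multiplier
    rw [mem_interior_iff_mem_nhds, Metric.mem_nhds_iff]
    refine ⟨ρ - dist θ θ₀, ?_, ?_⟩
    · rw [dist_eq_norm]
      nlinarith
    · exact (Metric.ball_subset_ball' (by linarith)).trans hball

/-! ### A rate in the strong law for triangular arrays -/

/-- The localization rate `n^(-1/3)`. -/
def rate (n : ℕ) : ℝ := (n : ℝ) ^ (-(1 / 3) : ℝ)

lemma rate_pos {n : ℕ} (hn : 0 < n) : 0 < rate n := by
  unfold rate; positivity

lemma rate_nonneg (n : ℕ) : 0 ≤ rate n := by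
  unfold rate; positivity

lemma mul_rate_pow {n : ℕ} (hn : 0 < n) : (n : ℝ) * rate n ^ 3 = 1 := by
  have h : (0 : ℝ) < n := by exact_mod_cast hn
  unfold rate
  rw [← Real.rpow_natCast, ← Real.rpow_mul h.le]
  norm_num
  rw [Real.rpow_neg_one, mul_inv_cancel₀ h.ne']

lemma tendsto_rate : Tendsto rate atTop (𝓝 0) :=
  (tendsto_rpow_neg_atTop (by norm_num : (0 : ℝ) < 1 / 3)).comp tendsto_natCast_atTop_atTop

/-- The sixth power of n^(1/3) is n², so the sixth term of the exponential series gives domination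
by a multiple of 1/n². -/
lemma summable_exp_neg_div_rate {c : ℝ} (hc : 0 < c) :
    Summable fun n : ℕ => Real.exp (-(c * (rate n)⁻¹)) := by
  have hs : Summable fun n : ℕ => 720 / c ^ 6 * (1 / (n : ℝ) ^ 2) :=
    (Real.summable_one_div_nat_pow.2 (by norm_num)).mul_left _
  refine hs.of_norm_bounded_eventually_nat ?_
  filter_upwards [eventually_gt_atTop 0] with n hn
  have hr := rate_pos hn
  have hn' : (0 : ℝ) < n := by exact_mod_cast hn
  rw [Real.norm_of_nonneg (Real.exp_pos _).le, Real.exp_neg]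
  have h1 := Real.pow_div_factorial_le_exp (c * (rate n)⁻¹) (by positivity) 6
  have h2 : (c * (rate n)⁻¹) ^ 6 = c ^ 6 * (n : ℝ) ^ 2 := by
    have h3 : (n : ℝ) = (rate n ^ 3)⁻¹ := eq_inv_of_mul_eq_one_left (mul_rate_pow hn)
    rw [h3, mul_pow, inv_pow, inv_pow]
    ring
  rw [h2, show ((Nat.factorial 6 : ℕ) : ℝ) = 720 by norm_num [Nat.factorial]] at h1
  calc (Real.exp (c * (rate n)⁻¹))⁻¹ ≤ (c ^ 6 * (n : ℝ) ^ 2 / 720)⁻¹ :=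
        inv_anti₀ (by positivity) h1
    _ = _ := by field_simp

section Bernstein

variable {S Ω : Type*} [MeasurableSpace S] [MeasurableSpace Ω] {P : Measure Ω}
  [IsProbabilityMeasure P] {ξ : ℕ → Ω → S} {F : Measure S} [IsProbabilityMeasure F]

/-- The condition 2lb ≤ 1 puts the exponent in [-1, 1], where exp x ≤ 1 + x + x². The linear term
integrates to zero and the quadratic one to at most l²v. -/
lemma integral_exp_mul_sub_le {f : S → ℝ} (hf : Measurable f) {b v l : ℝ}
    (hb : ∀ s, |f s| ≤ b) (hv : ∫ s, f s ^ 2 ∂F ≤ v) (hl : 0 ≤ l) (hlb : 2 * l * b ≤ 1) :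
    ∫ s, Real.exp (l * (f s - ∫ s, f s ∂F)) ∂F ≤ Real.exp (l ^ 2 * v) := by
  set c := ∫ s, f s ∂F with hc
  have hfi : Integrable f F :=
    Integrable.of_bound hf.aestronglyMeasurable b (Eventually.of_forall hb)
  have hf2 : Integrable (fun s => f s ^ 2) F :=
    Integrable.of_bound (hf.pow_const 2).aestronglyMeasurable (b ^ 2)
      (Eventually.of_forall fun s => by
        rw [Real.norm_of_nonneg (sq_nonneg _), ← sq_abs]
        exact pow_le_pow_left₀ (abs_nonneg _) (hb s) 2)
  have hcb : |c| ≤ b := by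
    have := norm_integral_le_of_norm_le_const (μ := F) (f := f) (Eventually.of_forall hb)
    simpa using this
  have hx : ∀ s, |l * (f s - c)| ≤ 1 := fun s => by
    rw [abs_mul, abs_of_nonneg hl]
    have := abs_sub (f s) c
    have h1 : |f s - c| ≤ 2 * b := by linarith [hb s]
    calc l * |f s - c| ≤ l * (2 * b) := mul_le_mul_of_nonneg_left h1 hl
      _ ≤ 1 := by linarith
  have hpt : ∀ s, Real.exp (l * (f s - c)) ≤
      1 + l * (f s - c) + l ^ 2 * (f s ^ 2 - 2 * c * f s + c ^ 2) := fun s => by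
    have := (abs_le.1 (Real.abs_exp_sub_one_sub_id_le (hx s))).2
    nlinarith
  have hi : Integrable (fun s => 1 + l * (f s - c) + l ^ 2 * (f s ^ 2 - 2 * c * f s + c ^ 2)) F :=
    ((integrable_const 1).add ((hfi.sub (integrable_const c)).const_mul l)).add
      (((hf2.sub (hfi.const_mul (2 * c))).add (integrable_const _)).const_mul _)
  calc ∫ s, Real.exp (l * (f s - c)) ∂F
      ≤ ∫ s, (1 + l * (f s - c) + l ^ 2 * (f s ^ 2 - 2 * c * f s + c ^ 2)) ∂F :=
        integral_mono_of_nonneg (Eventually.of_forall fun s => (Real.exp_pos _).le) hi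
          (Eventually.of_forall hpt)
    _ = 1 + l ^ 2 * (∫ s, f s ^ 2 ∂F - c ^ 2) := by
        have e : ∀ s, 1 + l * (f s - c) + l ^ 2 * (f s ^ 2 - 2 * c * f s + c ^ 2)
            = (1 - l * c + l ^ 2 * c ^ 2) + ((l - 2 * c * l ^ 2) * f s + l ^ 2 * f s ^ 2) :=
          fun s => by ring
        have i1 : Integrable (fun s => (l - 2 * c * l ^ 2) * f s) F := hfi.const_mul _
        have i2 : Integrable (fun s => l ^ 2 * f s ^ 2) F := hf2.const_mul _
        have i3 : Integrable (fun s => (l - 2 * c * l ^ 2) * f s + l ^ 2 * f s ^ 2) F := i1.add i2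
        simp only [e]
        rw [integral_add (integrable_const _) i3, integral_add i1 i2, integral_const_mul,
          integral_const_mul, ← hc]
        simp
        ring
    _ ≤ l ^ 2 * v + 1 := by nlinarith [sq_nonneg l, sq_nonneg c, sq_nonneg (l * c)]
    _ ≤ Real.exp (l ^ 2 * v) := Real.add_one_le_exp _

/-- Bernstein's inequality for bounded functions of an independent sample. -/
lemma measureReal_sum_ge_le (hξm : ∀ i, Measurable (ξ i)) (hind : iIndepFun ξ P)
    (hlaw : ∀ i, P.map (ξ i) = F) {f : S → ℝ} (hf : Measurable f) {b v l : ℝ}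
    (hb : ∀ s, |f s| ≤ b) (hv : ∫ s, f s ^ 2 ∂F ≤ v) (hl : 0 ≤ l) (hlb : 2 * l * b ≤ 1)
    (k : ℕ) (t : ℝ) :
    P.real {ω | t ≤ ∑ i ∈ Finset.range k, (f (ξ i ω) - ∫ s, f s ∂F)} ≤
      Real.exp (-(l * t) + k * (l ^ 2 * v)) := by
  set c := ∫ s, f s ∂F with hc
  set X : ℕ → Ω → ℝ := fun i ω => f (ξ i ω) - c with hX
  have hXm : ∀ i, Measurable (X i) := fun i => (hf.comp (hξm i)).sub_const c
  have hXind : iIndepFun X P := hind.comp (fun _ s => f s - c) fun _ => hf.sub_const c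
  have hcb : |c| ≤ b := by
    have := norm_integral_le_of_norm_le_const (μ := F) (f := f) (Eventually.of_forall hb)
    simpa using this
  have hXb : ∀ i ω, X i ω ≤ 2 * b := fun i ω => by
    have := abs_sub (f (ξ i ω)) c
    linarith [hb (ξ i ω), le_abs_self (f (ξ i ω) - c)]
  have hint : Integrable (fun ω => Real.exp (l * (∑ i ∈ Finset.range k, X i) ω)) P := by
    refine Integrable.of_bound (C := Real.exp (l * (k * (2 * b)))) ?_ (Eventually.of_forall ?_)
    · have : Measurable (∑ i ∈ Finset.range k, X i) := by
        rw [Finset.sum_fn]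
        exact Finset.measurable_sum _ fun i _ => hXm i
      exact (this.const_mul l).exp.aestronglyMeasurable
    · intro ω
      rw [Real.norm_of_nonneg (Real.exp_pos _).le]
      apply Real.exp_le_exp.2 (mul_le_mul_of_nonneg_left _ hl)
      rw [Finset.sum_apply]
      exact (Finset.sum_le_card_nsmul _ _ (2 * b) fun i _ => hXb i ω).trans_eq (by simp)
  have h1 := measure_ge_le_exp_mul_mgf t hl hint
  rw [hXind.mgf_sum hXm] at h1
  have h2 : ∀ i, mgf (X i) P l ≤ Real.exp (l ^ 2 * v) := by
    intro i
    have e : mgf (X i) P l = ∫ s, Real.exp (l * (f s - c)) ∂F := by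
      rw [← hlaw i, integral_map (hξm i).aemeasurable]
      · rfl
      · exact ((hf.sub_const c).const_mul l).exp.aestronglyMeasurable
    rw [e]
    exact integral_exp_mul_sub_le hf hb hv hl hlb
  have h3 : ∏ i ∈ Finset.range k, mgf (X i) P l ≤ Real.exp (l ^ 2 * v) ^ k := by
    calc _ ≤ ∏ i ∈ Finset.range k, Real.exp (l ^ 2 * v) :=
          Finset.prod_le_prod (fun i _ => mgf_nonneg) fun i _ => h2 i
      _ = _ := by simp
  have h4 : {ω | t ≤ ∑ i ∈ Finset.range k, (f (ξ i ω) - c)}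
      = {ω | t ≤ (∑ i ∈ Finset.range k, X i) ω} := by
    ext ω; simp [hX, Finset.sum_apply]
  rw [h4]
  refine h1.trans ((mul_le_mul_of_nonneg_left h3 (Real.exp_pos _).le).trans_eq ?_)
  rw [← Real.exp_nat_mul, ← Real.exp_add]
  ring_nf

end Bernstein

/-! ### From exponential bounds to an almost sure rate -/

section StrongLaw

variable {S Ω : Type*} [MeasurableSpace S] [MeasurableSpace Ω] {P : Measure Ω}
  {ξ : ℕ → Ω → S} {F : Measure S}

lemma ae_tendsto_average (hξm : ∀ i, Measurable (ξ i)) (hind : iIndepFun ξ P)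
    (hlaw : ∀ i, P.map (ξ i) = F) {f : S → ℝ} (hf : Measurable f) (hfi : Integrable f F) :
    ∀ᵐ ω ∂P, Tendsto (fun n : ℕ => (∑ i ∈ Finset.range n, f (ξ i ω)) / n) atTop
      (𝓝 (∫ s, f s ∂F)) := by
  have h0 : ∫ ω, f (ξ 0 ω) ∂P = ∫ s, f s ∂F := by
    rw [← hlaw 0, integral_map (hξm 0).aemeasurable hf.aestronglyMeasurable]
  rw [← h0]
  refine strong_law_ae_real (fun i ω => f (ξ i ω)) ?_ ?_ ?_
  · have := hfi
    rw [← hlaw 0] at this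
    exact this.comp_measurable (hξm 0)
  · intro i j hij
    exact (hind.indepFun hij).comp hf hf
  · intro i
    have : IdentDistrib (ξ i) (ξ 0) P P :=
      ⟨(hξm i).aemeasurable, (hξm 0).aemeasurable, by rw [hlaw, hlaw]⟩
    exact this.comp hf

variable [IsProbabilityMeasure P] [IsProbabilityMeasure F]

/-- The upper half of the rate for truncated summands. -/
lemma ae_eventually_sum_lt (hξm : ∀ i, Measurable (ξ i)) (hind : iIndepFun ξ P)
    (hlaw : ∀ i, P.map (ξ i) = F) {f : ℕ → S → ℝ} (hf : ∀ n, Measurable (f n)) {v : ℝ}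
    (hb : ∀ᶠ n in atTop, ∀ s, |f n s| ≤ (rate n)⁻¹) (hv : ∀ᶠ n in atTop, ∫ s, f n s ^ 2 ∂F ≤ v)
    (hv0 : 0 ≤ v) {k : ℕ → ℕ} (hk : ∀ n, k n ≤ n) {η : ℝ} (hη : 0 < η) :
    ∀ᵐ ω ∂P, ∀ᶠ n in atTop,
      rate n ^ 2 * ∑ i ∈ Finset.range (k n), (f n (ξ i ω) - ∫ s, f n s ∂F) < η := by
  -- Bernstein is applied with l = δ r and bound 1/r, so δ ≤ 1/2 is its side condition. As n r² =
  -- 1/r, the exponent is at most -(δη - δ²v)/r, and the second bound on δ keeps half of the linear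
  -- term.
  set δ := min (1 / 2) (η / (2 * (v + 1))) with hδ
  have hδ0 : 0 < δ := by positivity
  have hδ1 : δ ≤ 1 / 2 := min_le_left _ _
  have hδ2 : δ * v ≤ η / 2 := by
    have : δ ≤ η / (2 * (v + 1)) := min_le_right _ _
    rw [le_div_iff₀ (by positivity)] at this
    nlinarith
  set A : ℕ → Set Ω := fun n => {ω | η * ((rate n)⁻¹) ^ 2 ≤
    ∑ i ∈ Finset.range (k n), (f n (ξ i ω) - ∫ s, f n s ∂F)} with hA
  have hsum : Summable fun n => P.real (A n) := by
    refine (summable_exp_neg_div_rate (by positivity : 0 < δ * η / 2)).of_norm_bounded_eventually_nat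
      ?_
    filter_upwards [hb, hv, eventually_gt_atTop 0] with n hbn hvn hn
    have hr := rate_pos hn
    rw [Real.norm_of_nonneg measureReal_nonneg]
    refine (measureReal_sum_ge_le hξm hind hlaw (hf n) hbn hvn (l := δ * rate n) (by positivity)
      (by rw [mul_assoc, mul_assoc, mul_inv_cancel₀ hr.ne']; linarith) (k n) _).trans ?_
    apply Real.exp_le_exp.2
    have h1 : δ * rate n * (η * ((rate n)⁻¹) ^ 2) = δ * η * (rate n)⁻¹ := by
      field_simp
    have h2 : (k n : ℝ) * ((δ * rate n) ^ 2 * v) ≤ δ * (δ * v) * (rate n)⁻¹ := by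
      have hkn : (k n : ℝ) ≤ n := by exact_mod_cast hk n
      calc (k n : ℝ) * ((δ * rate n) ^ 2 * v) ≤ n * ((δ * rate n) ^ 2 * v) :=
            mul_le_mul_of_nonneg_right hkn (by positivity)
        _ = δ * (δ * v) * (n * rate n ^ 3) * (rate n)⁻¹ := by field_simp
        _ = _ := by rw [mul_rate_pow hn, mul_one]
    have h3 : δ * (δ * v) * (rate n)⁻¹ ≤ δ * (η / 2) * (rate n)⁻¹ :=
      mul_le_mul_of_nonneg_right (mul_le_mul_of_nonneg_left hδ2 hδ0.le) (by positivity)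
    rw [h1]
    linarith
  have hne : (∑' n, P (A n)) ≠ ⊤ := by
    have : ∀ n, P (A n) = ENNReal.ofReal (P.real (A n)) := fun n =>
      (ofReal_measureReal (measure_ne_top P _)).symm
    simp only [this]
    exact hsum.tsum_ofReal_ne_top
  filter_upwards [ae_eventually_notMem hne] with ω hω
  filter_upwards [hω, eventually_gt_atTop 0] with n hn hn0
  have hr := rate_pos hn0
  have hn' : ∑ i ∈ Finset.range (k n), (f n (ξ i ω) - ∫ s, f n s ∂F) < η * ((rate n)⁻¹) ^ 2 :=
    not_le.1 hn
  calc _ < rate n ^ 2 * (η * ((rate n)⁻¹) ^ 2) := mul_lt_mul_of_pos_left hn' (by positivity)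
    _ = η := by field_simp

/-- Sums of centred functions with a common envelope that has three moments are `o(n^(2/3))`
almost surely, even when the functions change with `n`. -/
theorem ae_tendsto_rate_sum (hξm : ∀ i, Measurable (ξ i)) (hind : iIndepFun ξ P)
    (hlaw : ∀ i, P.map (ξ i) = F) {g : ℕ → S → ℝ} (hg : ∀ n, Measurable (g n)) {m : S → ℝ}
    (hm : Measurable m) (hm1 : ∀ s, 1 ≤ m s) (hm3 : Integrable (fun s => m s ^ 3) F)
    (hgm : ∀ᶠ n in atTop, ∀ s, |g n s| ≤ m s) {k : ℕ → ℕ} (hk : ∀ n, k n ≤ n) :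
    ∀ᵐ ω ∂P, Tendsto (fun n => rate n ^ 2 *
      ∑ i ∈ Finset.range (k n), (g n (ξ i ω) - ∫ s, g n s ∂F)) atTop (𝓝 0) := by
  -- Truncation where the envelope exceeds n^(1/3), so that Bernstein applies to f.
  set f : ℕ → S → ℝ := fun n => {s | m s ≤ (rate n)⁻¹}.indicator (g n) with hf
  have hset : ∀ n, MeasurableSet {s | m s ≤ (rate n)⁻¹} := fun n =>
    measurableSet_le hm measurable_const
  have hfm : ∀ n, Measurable (f n) := fun n => (hg n).indicator (hset n)
  set v := ∫ s, m s ^ 3 ∂F with hvdef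
  have hv0 : 0 ≤ v := integral_nonneg fun s => by have := hm1 s; positivity
  have hfle : ∀ᶠ n in atTop, ∀ s, |f n s| ≤ m s := hgm.mono fun n hn s => by
    simp only [hf, Set.indicator_apply]
    split_ifs
    · exact hn s
    · rw [abs_zero]; linarith [hm1 s]
  have hfb : ∀ᶠ n in atTop, ∀ s, |f n s| ≤ (rate n)⁻¹ := hgm.mono fun n hn s => by
    simp only [hf, Set.indicator_apply]
    split_ifs with h
    · exact (hn s).trans h
    · rw [abs_zero]; exact inv_nonneg.2 (rate_nonneg n)
  have hfv : ∀ᶠ n in atTop, ∫ s, f n s ^ 2 ∂F ≤ v := hfle.mono fun n hn => by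
    refine integral_mono_of_nonneg (Eventually.of_forall fun s => sq_nonneg _) hm3
      (Eventually.of_forall fun s => ?_)
    calc f n s ^ 2 = |f n s| ^ 2 := (sq_abs _).symm
      _ ≤ m s ^ 2 := pow_le_pow_left₀ (abs_nonneg _) (hn s) 2
      _ ≤ m s ^ 3 := pow_le_pow_right₀ (hm1 s) (by norm_num)
  have hrem : ∀ᶠ n in atTop, ∀ s, |g n s - f n s| ≤ rate n ^ 2 * m s ^ 3 := by
    filter_upwards [hgm, eventually_gt_atTop 0] with n hn hn0 s
    have hr := rate_pos hn0
    have hms := hm1 s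
    simp only [hf, Set.indicator_apply]
    split_ifs with h
    · rw [sub_self, abs_zero]; positivity
    -- On the discarded set m r ≥ 1, so m ≤ m (m r)² = r² m³.
    · rw [sub_zero]
      have h1 : 1 ≤ m s * rate n := by
        have : (rate n)⁻¹ < m s := not_le.1 h
        rw [inv_lt_iff_one_lt_mul₀ hr] at this
        linarith
      calc |g n s| ≤ m s := hn s
        _ ≤ m s * (m s * rate n) ^ 2 := le_mul_of_one_le_right (by linarith) (one_le_pow₀ h1)
        _ = _ := by ring
  -- Countably many thresholds 1/(j + 1), applied to f and to -f, keep the exceptional set null.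
  have up := fun j : ℕ => ae_eventually_sum_lt hξm hind hlaw hfm hfb hfv hv0 hk
    (by positivity : 0 < 1 / ((j : ℝ) + 1))
  have down := fun j : ℕ => ae_eventually_sum_lt (f := fun n s => -f n s) hξm hind hlaw
    (fun n => (hfm n).neg) (hfb.mono fun n hn s => by rw [abs_neg]; exact hn s)
    (hfv.mono fun n hn => by simpa using hn) hv0 hk (by positivity : 0 < 1 / ((j : ℝ) + 1))
  filter_upwards [ae_all_iff.2 up, ae_all_iff.2 down,
    ae_tendsto_average hξm hind hlaw (hm.pow_const 3) hm3] with ω hup hdown hlln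
  have hT : Tendsto (fun n => rate n ^ 2 *
      ∑ i ∈ Finset.range (k n), (f n (ξ i ω) - ∫ s, f n s ∂F)) atTop (𝓝 0) := by
    rw [Metric.tendsto_atTop']
    intro ε hε
    obtain ⟨j, hj⟩ := exists_nat_one_div_lt hε
    obtain ⟨N, hN⟩ := eventually_atTop.1 ((hup j).and (hdown j))
    refine ⟨N, fun n hn => ?_⟩
    obtain ⟨h1, h2⟩ := hN n hn.le
    rw [Real.dist_eq, sub_zero, abs_lt]
    have e : ∑ i ∈ Finset.range (k n), (-f n (ξ i ω) - ∫ s, -f n s ∂F)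
        = -∑ i ∈ Finset.range (k n), (f n (ξ i ω) - ∫ s, f n s ∂F) := by
      rw [integral_neg, ← Finset.sum_neg_distrib]
      exact Finset.sum_congr rfl fun i _ => by ring
    rw [e] at h2
    constructor <;> linarith
  -- The scaled truncation error is at most r⁴ (Σ m³ + n v), which is r times an average because n
  -- r³ = 1.
  have hR : Tendsto (fun n => rate n * ((∑ i ∈ Finset.range n, m (ξ i ω) ^ 3) / n + v)) atTop
      (𝓝 0) := by
    simpa using tendsto_rate.mul (hlln.add_const v)
  have hD : Tendsto (fun n => rate n ^ 2 *
      ∑ i ∈ Finset.range (k n), (g n (ξ i ω) - ∫ s, g n s ∂F) - rate n ^ 2 *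
      ∑ i ∈ Finset.range (k n), (f n (ξ i ω) - ∫ s, f n s ∂F)) atTop (𝓝 0) := by
    refine squeeze_zero_norm' ?_ hR
    filter_upwards [hrem, hgm, hfle, eventually_gt_atTop 0] with n h1 h2 h3 hn0
    have hr := rate_pos hn0
    have hn' : (0 : ℝ) < n := by exact_mod_cast hn0
    have hmi : Integrable m F := hm3.mono' hm.aestronglyMeasurable (Eventually.of_forall fun s => by
      rw [Real.norm_of_nonneg (by linarith [hm1 s])]
      exact le_self_pow₀ (hm1 s) (by norm_num))
    have hgi : Integrable (g n) F := hmi.mono' (hg n).aestronglyMeasurable (Eventually.of_forall h2)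
    have hfi : Integrable (f n) F := hmi.mono' (hfm n).aestronglyMeasurable
      (Eventually.of_forall h3)
    have hint : |∫ s, g n s ∂F - ∫ s, f n s ∂F| ≤ rate n ^ 2 * v := by
      rw [← integral_sub hgi hfi, hvdef, ← integral_const_mul]
      exact norm_integral_le_of_norm_le (f := fun s => g n s - f n s) (hm3.const_mul _)
        (Eventually.of_forall h1)
    have hs : |∑ i ∈ Finset.range (k n), (g n (ξ i ω) - ∫ s, g n s ∂F)
        - ∑ i ∈ Finset.range (k n), (f n (ξ i ω) - ∫ s, f n s ∂F)|
        ≤ rate n ^ 2 * ∑ i ∈ Finset.range n, m (ξ i ω) ^ 3 + n * (rate n ^ 2 * v) := by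
      rw [← Finset.sum_sub_distrib]
      calc _ ≤ ∑ i ∈ Finset.range (k n), |(g n (ξ i ω) - ∫ s, g n s ∂F)
              - (f n (ξ i ω) - ∫ s, f n s ∂F)| := Finset.abs_sum_le_sum_abs _ _
        _ ≤ ∑ i ∈ Finset.range (k n), (rate n ^ 2 * m (ξ i ω) ^ 3 + rate n ^ 2 * v) := by
          refine Finset.sum_le_sum fun i _ => ?_
          have e : (g n (ξ i ω) - ∫ s, g n s ∂F) - (f n (ξ i ω) - ∫ s, f n s ∂F)
            = (g n (ξ i ω) - f n (ξ i ω)) - (∫ s, g n s ∂F - ∫ s, f n s ∂F) := by ring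
          rw [e]
          exact (abs_sub _ _).trans (add_le_add (h1 _) hint)
        _ ≤ ∑ i ∈ Finset.range n, (rate n ^ 2 * m (ξ i ω) ^ 3 + rate n ^ 2 * v) := by
          refine Finset.sum_le_sum_of_subset_of_nonneg (Finset.range_mono (hk n)) fun i _ _ => ?_
          have := hm1 (ξ i ω)
          positivity
        _ = _ := by rw [Finset.sum_add_distrib, ← Finset.mul_sum]; simp
    rw [← mul_sub, Real.norm_eq_abs, abs_mul, abs_of_pos (by positivity : 0 < rate n ^ 2)]
    refine (mul_le_mul_of_nonneg_left hs (by positivity)).trans_eq ?_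
    have h4 := mul_rate_pow hn0
    field_simp
    linear_combination (∑ i ∈ Finset.range n, m (ξ i ω) ^ 3 + n * v) * h4
  simpa using hD.add hT

end StrongLaw

/-! ### The population -/

/-- The probability of the response `b`. -/
def respProb (Pop : Measure (Vec p × Bool)) (b : Bool) : ℝ := Pop.real (Prod.snd ⁻¹' {b})

/-- The logistic probability of the response `b` at the covariate `x`. -/
def logisticProb (α : ℝ) (β : Vec p) : Bool → Vec p → ℝ
  | true, x => Real.exp (α + inner ℝ β x) / (1 + Real.exp (α + inner ℝ β x))
  | false, x => 1 / (1 + Real.exp (α + inner ℝ β x))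

lemma logisticProb_pos (α : ℝ) (β : Vec p) (b : Bool) (x : Vec p) : 0 < logisticProb α β b x := by
  cases b <;> simp only [logisticProb] <;> positivity

lemma measurable_logisticProb (α : ℝ) (β : Vec p) (b : Bool) :
    Measurable (logisticProb α β b) := by
  cases b <;> unfold logisticProb <;> simp only <;> fun_prop

lemma fst_apply_eq_add {Pop : Measure (Vec p × Bool)} (A : Set (Vec p)) (hA : MeasurableSet A) :
    Pop.fst A = Pop (A ×ˢ {true}) + Pop (A ×ˢ {false}) := by
  rw [Measure.fst_apply hA, ← measure_union]
  · congr 1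
    ext ⟨x, b⟩
    cases b <;> simp
  · rw [Set.disjoint_left]
    rintro ⟨x, b⟩ h1 h2
    cases b <;> simp_all
  · exact hA.prod (measurableSet_singleton _)

variable {Pop : Measure (Vec p × Bool)} [IsProbabilityMeasure Pop]

lemma measurableSet_snd_preimage (b : Bool) :
    MeasurableSet (Prod.snd ⁻¹' {b} : Set (Vec p × Bool)) :=
  measurable_snd (measurableSet_singleton b)

lemma respProb_add : respProb Pop true + respProb Pop false = 1 := by
  unfold respProb
  rw [← measureReal_union]
  · have : (Prod.snd ⁻¹' {true} ∪ Prod.snd ⁻¹' {false} : Set (Vec p × Bool)) = Set.univ := by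
      ext ⟨x, b⟩
      cases b <;> simp
    rw [this, probReal_univ]
  · rw [Set.disjoint_left]
    rintro ⟨x, b⟩ h1 h2
    cases b <;> simp_all
  · exact measurableSet_snd_preimage _

lemma IsLogistic.apply_prod {α : ℝ} {β : Vec p} (hlog : IsLogistic Pop α β) (b : Bool)
    {A : Set (Vec p)} (hA : MeasurableSet A) :
    Pop (A ×ˢ {b}) = ∫⁻ x in A, ENNReal.ofReal (logisticProb α β b x) ∂Pop.fst := by
  cases b
  · have h1 := fst_apply_eq_add (Pop := Pop) A hA
    have h2 := hlog A hA
    have h3 : Pop.fst A = ∫⁻ x in A, ENNReal.ofReal (logisticProb α β true x) ∂Pop.fst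
        + ∫⁻ x in A, ENNReal.ofReal (logisticProb α β false x) ∂Pop.fst := by
      rw [← lintegral_add_left (measurable_logisticProb α β true).ennreal_ofReal,
        ← setLIntegral_one]
      refine lintegral_congr fun x => ?_
      rw [← ENNReal.ofReal_add (logisticProb_pos _ _ _ _).le (logisticProb_pos _ _ _ _).le]
      have := Real.exp_pos (α + inner ℝ β x)
      rw [show logisticProb α β true x + logisticProb α β false x = 1 by
        simp only [logisticProb]; field_simp; ring]
      simp
    have h4 : Pop (A ×ˢ {true}) = ∫⁻ x in A, ENNReal.ofReal (logisticProb α β true x) ∂Pop.fst := h2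
    rw [← h4, h1] at h3
    exact (ENNReal.add_right_inj (measure_ne_top _ _)).1 h3
  · exact hlog A hA

lemma IsLogistic.respProb_pos {α : ℝ} {β : Vec p} (hlog : IsLogistic Pop α β) (b : Bool) :
    0 < respProb Pop b := by
  have h1 := hlog.apply_prod b MeasurableSet.univ
  rw [setLIntegral_univ] at h1
  have h2 : (Set.univ ×ˢ {b} : Set (Vec p × Bool)) = Prod.snd ⁻¹' {b} := by
    ext ⟨x, c⟩; simp
  rw [h2] at h1
  unfold respProb
  rw [measureReal_def, ENNReal.toReal_pos_iff, h1]
  refine ⟨?_, by rw [← h1]; exact measure_lt_top _ _⟩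
  rw [lintegral_pos_iff_support (measurable_logisticProb α β b).ennreal_ofReal]
  have : (Function.support fun x => ENNReal.ofReal (logisticProb α β b x)) = Set.univ := by
    ext x
    simp [logisticProb_pos]
  rw [this]
  simp

lemma condLaw_apply (b : Bool) {A : Set (Vec p)} (hA : MeasurableSet A) :
    condLaw Pop b A = ENNReal.ofReal (respProb Pop b)⁻¹ * Pop (A ×ˢ {b}) ∨ respProb Pop b = 0 := by
  by_cases h0 : respProb Pop b = 0
  · exact Or.inr h0
  left
  unfold condLaw
  rw [Measure.map_apply measurable_fst hA, cond_apply (measurableSet_snd_preimage b)]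
  have hpos : 0 < respProb Pop b := lt_of_le_of_ne measureReal_nonneg (Ne.symm h0)
  rw [ENNReal.ofReal_inv_of_pos hpos]
  congr 1
  · rw [respProb, ofReal_measureReal (measure_ne_top _ _)]
  · congr 1
    ext ⟨x, c⟩
    simp [and_comm]

lemma IsLogistic.condLaw_eq {α : ℝ} {β : Vec p} (hlog : IsLogistic Pop α β) (b : Bool) :
    condLaw Pop b = Pop.fst.withDensity
      (fun x => ENNReal.ofReal ((respProb Pop b)⁻¹ * logisticProb α β b x)) := by
  ext A hA
  rw [(condLaw_apply b hA).resolve_right (hlog.respProb_pos b).ne', hlog.apply_prod b hA,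
    withDensity_apply _ hA, ← lintegral_const_mul _ (measurable_logisticProb α β b).ennreal_ofReal]
  refine lintegral_congr fun x => ?_
  rw [ENNReal.ofReal_mul (inv_nonneg.2 (hlog.respProb_pos b).le)]

lemma IsLogistic.isProbabilityMeasure_condLaw {α : ℝ} {β : Vec p} (hlog : IsLogistic Pop α β)
    (b : Bool) : IsProbabilityMeasure (condLaw Pop b) := by
  have h0 : Pop (Prod.snd ⁻¹' {b}) ≠ 0 := by
    have := (hlog.respProb_pos b).ne'
    intro h
    apply this
    simp [respProb, measureReal_def, h]
  have := cond_isProbabilityMeasure h0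
  exact Measure.isProbabilityMeasure_map measurable_fst.aemeasurable

lemma IsLogistic.fst_eq {α : ℝ} {β : Vec p} (hlog : IsLogistic Pop α β) :
    Pop.fst = ENNReal.ofReal (respProb Pop true) • condLaw Pop true
      + ENNReal.ofReal (respProb Pop false) • condLaw Pop false := by
  ext A hA
  have h : ∀ b, ENNReal.ofReal (respProb Pop b) * condLaw Pop b A = Pop (A ×ˢ {b}) := fun b => by
    have h0 := hlog.respProb_pos b
    rw [(condLaw_apply b hA).resolve_right h0.ne', ← mul_assoc,
      ← ENNReal.ofReal_mul h0.le, mul_inv_cancel₀ h0.ne', ENNReal.ofReal_one, one_mul]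
  simp only [Measure.coe_add, Measure.coe_smul, Pi.add_apply, Pi.smul_apply, smul_eq_mul, h]
  exact fst_apply_eq_add A hA

lemma IsLogistic.integrable_condLaw {α : ℝ} {β : Vec p} (hlog : IsLogistic Pop α β) (b : Bool)
    {E : Type*} [NormedAddCommGroup E] {f : Vec p → E} (hf : Integrable f Pop.fst) :
    Integrable f (condLaw Pop b) := by
  rw [hlog.fst_eq, integrable_add_measure] at hf
  have h0 : ∀ b, ENNReal.ofReal (respProb Pop b) ≠ 0 := fun b => by
    simpa using hlog.respProb_pos b
  cases b
  · exact (integrable_smul_measure (h0 _) ENNReal.ofReal_ne_top).1 hf.2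
  · exact (integrable_smul_measure (h0 _) ENNReal.ofReal_ne_top).1 hf.1

lemma IsLogistic.integral_fst {α : ℝ} {β : Vec p} (hlog : IsLogistic Pop α β)
    {E : Type*} [NormedAddCommGroup E] [NormedSpace ℝ E] {f : Vec p → E}
    (hf : ∀ b, Integrable f (condLaw Pop b)) :
    ∫ x, f x ∂Pop.fst = respProb Pop true • ∫ x, f x ∂(condLaw Pop true)
      + respProb Pop false • ∫ x, f x ∂(condLaw Pop false) := by
  rw [hlog.fst_eq, integral_add_measure ((hf true).smul_measure ENNReal.ofReal_ne_top)
    ((hf false).smul_measure ENNReal.ofReal_ne_top), integral_smul_measure, integral_smul_measure,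
    ENNReal.toReal_ofReal (hlog.respProb_pos _).le, ENNReal.toReal_ofReal (hlog.respProb_pos _).le]

lemma exp_gammaTrue {α : ℝ} {β : Vec p} (hlog : IsLogistic Pop α β) :
    Real.exp (gammaTrue Pop) = respProb Pop false / respProb Pop true :=
  Real.exp_log (div_pos (hlog.respProb_pos false) (hlog.respProb_pos true))

/-- The exponential tilt at the truth is the density of the law of the cases with respect to the
law of the controls. -/
lemma IsLogistic.condLaw_true_eq {α : ℝ} {β : Vec p} (hlog : IsLogistic Pop α β)
    (h : Vec p → Vec q) :
    condLaw Pop true = (condLaw Pop false).withDensity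
      (fun x => ENNReal.ofReal (tilt (thetaTrue Pop α β h) x)) := by
  have ht : ∀ x, tilt (thetaTrue Pop α β h) x
      = respProb Pop false / respProb Pop true * Real.exp (α + inner ℝ β x) := fun x => by
    simp only [tilt, thetaTrue, astar_mkParam, bet_mkParam]
    rw [add_assoc, Real.exp_add, exp_gammaTrue hlog]
  have htm : Measurable (fun x => tilt (thetaTrue Pop α β h) x) := by
    simp only [ht]; fun_prop
  have hm : ∀ b, Measurable fun x => ENNReal.ofReal ((respProb Pop b)⁻¹ * logisticProb α β b x) :=
    fun b => ((measurable_logisticProb α β b).const_mul _).ennreal_ofReal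
  rw [hlog.condLaw_eq true, hlog.condLaw_eq false, ← withDensity_mul _ (hm false)
    htm.ennreal_ofReal]
  congr 1
  funext x
  have h1 := hlog.respProb_pos true
  have h0 := hlog.respProb_pos false
  simp only [Pi.mul_apply]
  rw [← ENNReal.ofReal_mul (mul_nonneg (inv_nonneg.2 h0.le) (logisticProb_pos _ _ _ _).le), ht]
  congr 1
  simp only [logisticProb]
  field_simp

/-- The logistic density is strictly positive, so a conditional law has no more null sets than the
marginal. Nondegeneracy of X thereby passes to the cases. -/
lemma IsLogistic.ae_fst_of_ae_condLaw {α : ℝ} {β : Vec p} (hlog : IsLogistic Pop α β) (b : Bool)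
    {s : Vec p → Prop} (hs : ∀ᵐ x ∂(condLaw Pop b), s x) : ∀ᵐ x ∂Pop.fst, s x := by
  rw [hlog.condLaw_eq b, ae_withDensity_iff
    ((measurable_logisticProb α β b).const_mul _).ennreal_ofReal] at hs
  filter_upwards [hs] with x hx
  apply hx
  simpa using mul_pos (inv_pos.2 (hlog.respProb_pos b)) (logisticProb_pos α β b x)

/-- An affine function that vanishes almost surely is zero when the covariate is not concentrated
on a proper affine subspace. -/
lemma eq_zero_of_ae_affine_eq_zero {F : Measure (Vec p)} [IsProbabilityMeasure F]
    (hF : ∀ S : AffineSubspace ℝ (Vec p), S ≠ ⊤ → ¬ ∀ᵐ x ∂F, x ∈ S) {a : ℝ} {b : Vec p}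
    (h : ∀ᵐ x ∂F, a + inner ℝ b x = 0) : a = 0 ∧ b = 0 := by
  have hb : b = 0 := by
    by_contra hb
    obtain ⟨x₀, hx₀⟩ := h.exists
    -- The hyperplane through a zero of the affine function; it is proper because it misses x₀ + b.
    set S : AffineSubspace ℝ (Vec p) := AffineSubspace.mk' x₀ (LinearMap.ker (innerₗ (Vec p) b))
      with hS
    have hmem : ∀ x, x ∈ S ↔ inner ℝ b (x - x₀) = 0 := fun x => by
      rw [hS, AffineSubspace.mem_mk']
      simp
    refine hF S ?_ ?_
    · intro htop
      have : x₀ + b ∈ S := by rw [htop]; trivial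
      rw [hmem, add_sub_cancel_left, inner_self_eq_zero] at this
      exact hb this
    · filter_upwards [h] with x hx
      rw [hmem, inner_sub_right]
      linarith
  subst hb
  obtain ⟨x₀, hx₀⟩ := h.exists
  simpa using hx₀

/-- Identification of the intercept and of the case proportion. -/
theorem IsLogistic.identified {α α' : ℝ} {β β' : Vec p} (hlog : IsLogistic Pop α β)
    {h : Vec p → Vec q} (hhi : Integrable h Pop.fst)
    (hne : ∫ x, h x ∂(condLaw Pop true) ≠ ∫ x, h x ∂(condLaw Pop false))
    (hF : ∀ S : AffineSubspace ℝ (Vec p), S ≠ ⊤ → ¬ ∀ᵐ x ∂Pop.fst, x ∈ S)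
    {Pop' : Measure (Vec p × Bool)} [IsProbabilityMeasure Pop'] (hlog' : IsLogistic Pop' α' β')
    (hcond : ∀ b, condLaw Pop' b = condLaw Pop b)
    (hmean : ∫ x, h x ∂Pop'.fst = ∫ x, h x ∂Pop.fst) :
    α' = α ∧ caseProp Pop' = caseProp Pop := by
  have hi := fun b => hlog.integrable_condLaw b hhi
  have h1 := hlog.integral_fst hi
  have h2 := hlog'.integral_fst (f := h) fun b => by rw [hcond]; exact hi b
  rw [hcond, hcond, hmean, h1] at h2
  have hs := respProb_add (Pop := Pop)
  have hs' := respProb_add (Pop := Pop')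
  have hp : respProb Pop' true = respProb Pop true := by
    -- Both mixtures of the same two conditional means have the same value, so their proportions can
    -- differ only if those means coincide.
    have h3 : (respProb Pop' true - respProb Pop true) •
        (∫ x, h x ∂(condLaw Pop true) - ∫ x, h x ∂(condLaw Pop false)) = 0 := by
      rw [eq_sub_of_add_eq' hs, eq_sub_of_add_eq' hs', ← sub_eq_zero] at h2
      rw [← neg_eq_zero, ← h2]
      module
    rcases smul_eq_zero.1 h3 with h4 | h4
    · linarith
    · exact absurd (sub_eq_zero.1 h4) hne
  have hpb : ∀ b, respProb Pop' b = respProb Pop b := fun b => by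
    cases b
    · linarith
    · exact hp
  refine ⟨?_, hp⟩
  have hfst : Pop'.fst = Pop.fst := by
    rw [hlog.fst_eq, hlog'.fst_eq, hcond, hcond, hpb, hpb]
  -- The marginals now agree, so the equal laws of the cases force the two logistic functions, and
  -- hence the two linear predictors, to agree almost everywhere.
  have hd : Pop.fst.withDensity
      (fun x => ENNReal.ofReal ((respProb Pop true)⁻¹ * logisticProb α' β' true x)) =
      Pop.fst.withDensity
      (fun x => ENNReal.ofReal ((respProb Pop true)⁻¹ * logisticProb α β true x)) := by
    rw [← hlog.condLaw_eq true, ← hcond, hlog'.condLaw_eq true, hfst, hpb]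
  have hm : ∀ α β, Measurable fun x : Vec p =>
      ENNReal.ofReal ((respProb Pop true)⁻¹ * logisticProb α β true x) :=
    fun α β => ((measurable_logisticProb α β true).const_mul _).ennreal_ofReal
  have hfin : ∫⁻ x, ENNReal.ofReal ((respProb Pop true)⁻¹ * logisticProb α' β' true x) ∂Pop.fst
      ≠ ⊤ := by
    have := (hlog.isProbabilityMeasure_condLaw true).measure_univ
    rw [hlog.condLaw_eq true, ← hd, withDensity_apply _ MeasurableSet.univ, setLIntegral_univ]
      at this
    rw [this]; simp
  have hae := (withDensity_eq_iff (hm α' β').aemeasurable (hm α β).aemeasurable hfin).1 hd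
  have hzero : ∀ᵐ x ∂Pop.fst, (α' - α) + inner ℝ (β' - β) x = 0 := by
    filter_upwards [hae] with x hx
    have hinv := inv_pos.2 (hlog.respProb_pos true)
    have e := (ENNReal.ofReal_eq_ofReal_iff
      (mul_pos hinv (logisticProb_pos α' β' true x)).le
      (mul_pos hinv (logisticProb_pos α β true x)).le).1 hx
    have e2 := mul_left_cancel₀ hinv.ne' e
    simp only [logisticProb] at e2
    have p1 := Real.exp_pos (α' + inner ℝ β' x)
    have p2 := Real.exp_pos (α + inner ℝ β x)
    rw [div_eq_div_iff (by positivity) (by positivity)] at e2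
    have e3 : α' + inner ℝ β' x = α + inner ℝ β x := Real.exp_injective (by linarith)
    rw [inner_sub_left]
    linarith
  have := (eq_zero_of_ae_affine_eq_zero hF hzero).1
  linarith

/-! ### Events that hold eventually -/

/-- The events `E n` hold almost surely for all large `n`, and their probabilities tend to one. -/
structure HoldsEventually {Ω : Type*} [MeasurableSpace Ω] (P : Measure Ω) (E : ℕ → Set Ω) :
    Prop where
  ae : ∀ᵐ ω ∂P, ∀ᶠ n in atTop, ω ∈ E n
  prob : Tendsto (fun n => P (E n)ᶜ) atTop (𝓝 0)

namespace HoldsEventually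

variable {Ω : Type*} [MeasurableSpace Ω] {P : Measure Ω} {E E' : ℕ → Set Ω}

lemma mono (hE : HoldsEventually P E) (h : ∀ᶠ n in atTop, E n ⊆ E' n) : HoldsEventually P E' := by
  refine ⟨?_, ?_⟩
  · filter_upwards [hE.ae] with ω hω
    filter_upwards [hω, h] with n h1 h2 using h2 h1
  · refine tendsto_of_tendsto_of_tendsto_of_le_of_le' tendsto_const_nhds hE.prob
      (Eventually.of_forall fun _ => zero_le) ?_
    filter_upwards [h] with n hn
    exact measure_mono (Set.compl_subset_compl.2 hn)

lemma inter (hE : HoldsEventually P E) (hE' : HoldsEventually P E') :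
    HoldsEventually P fun n => E n ∩ E' n := by
  refine ⟨?_, ?_⟩
  · filter_upwards [hE.ae, hE'.ae] with ω h1 h2 using h1.and h2
  · have := hE.prob.add hE'.prob
    rw [add_zero] at this
    refine tendsto_of_tendsto_of_tendsto_of_le_of_le tendsto_const_nhds this
      (fun _ => zero_le) fun n => ?_
    simp only [Set.compl_inter]
    exact measure_union_le _ _

lemma univ : HoldsEventually P fun _ => Set.univ :=
  ⟨by simp, by simp⟩

lemma biInter {J : Type*} (s : Finset J) {E : J → ℕ → Set Ω}
    (hE : ∀ j ∈ s, HoldsEventually P (E j)) : HoldsEventually P fun n => ⋂ j ∈ s, E j n := by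
  classical
  induction s using Finset.induction_on with
  | empty => simpa using univ
  | insert a s ha ih =>
    simp only [Finset.set_biInter_insert]
    exact (hE a (Finset.mem_insert_self _ _)).inter
      (ih fun j hj => hE j (Finset.mem_insert_of_mem hj))

lemma iInter {J : Type*} [Fintype J] {E : J → ℕ → Set Ω} (hE : ∀ j, HoldsEventually P (E j)) :
    HoldsEventually P fun n => ⋂ j, E j n := by
  simpa using biInter Finset.univ fun j _ => hE j

lemma comp (hE : HoldsEventually P E) {k : ℕ → ℕ} (hk : Tendsto k atTop atTop) :
    HoldsEventually P fun n => E (k n) :=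
  ⟨hE.ae.mono fun _ h => hk.eventually h, hE.prob.comp hk⟩

/-- Measurability enters here, through the averages f n. Afterwards events are only intersected and
enlarged, so the event about maximizers need not be shown measurable. -/
lemma of_tendsto [IsFiniteMeasure P] {H : Type*} [NormedAddCommGroup H] {f : ℕ → Ω → H}
    (hf : ∀ n, AEStronglyMeasurable (f n) P) {a : H}
    (h : ∀ᵐ ω ∂P, Tendsto (fun n => f n ω) atTop (𝓝 a)) {ε : ℝ} (hε : 0 < ε) :
    HoldsEventually P fun n => {ω | ‖f n ω - a‖ < ε} := by
  refine ⟨?_, ?_⟩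
  · filter_upwards [h] with ω hω
    have := (tendsto_iff_norm_sub_tendsto_zero.1 hω).eventually (gt_mem_nhds hε)
    exact this
  · have := (tendstoInMeasure_iff_norm.1 (tendstoInMeasure_of_tendsto_ae hf h)) ε hε
    refine this.congr fun n => ?_
    congr 1
    ext ω
    simp

end HoldsEventually

/-! ### Uniform positivity of empirical second moments -/

section Gram

variable {S Ω : Type*} [MeasurableSpace S] [MeasurableSpace Ω] {P : Measure Ω}
  [IsProbabilityMeasure P] {ξ : ℕ → Ω → S} {F : Measure S} [IsProbabilityMeasure F]

lemma sq_inner_eq_sum {J : Type*} [Fintype J] (v z : EuclideanSpace ℝ J) :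
    (inner ℝ v z : ℝ) ^ 2 = ∑ j, ∑ k, v j * v k * (z j * z k) := by
  have : (inner ℝ v z : ℝ) = ∑ j, v j * z j := by
    simp [PiLp.inner_apply, mul_comm]
  rw [this, sq, Finset.sum_mul_sum]
  exact Finset.sum_congr rfl fun j _ => Finset.sum_congr rfl fun k _ => by ring

/-- Second-moment matrices of a nondegenerate bounded random vector are eventually uniformly
positive definite. -/
theorem exists_gram_lower_bound (hξm : ∀ i, Measurable (ξ i)) (hind : iIndepFun ξ P)
    (hlaw : ∀ i, P.map (ξ i) = F) {J : Type*} [Fintype J] {z : S → EuclideanSpace ℝ J}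
    (hz : Measurable z) {K : ℝ} (hK : ∀ s, ‖z s‖ ≤ K)
    (hnd : ∀ v : EuclideanSpace ℝ J, (∀ᵐ s ∂F, inner ℝ v (z s) = (0 : ℝ)) → v = 0) :
    ∃ c : ℝ, 0 < c ∧ HoldsEventually P fun n => {ω | ∀ v : EuclideanSpace ℝ J,
      c * n * ‖v‖ ^ 2 ≤ ∑ i ∈ Finset.range n, (inner ℝ v (z (ξ i ω)) : ℝ) ^ 2} := by
  have hzj : ∀ j, Measurable fun s => z s j := fun j => by fun_prop
  have hzb : ∀ j s, |z s j| ≤ K := fun j s => (PiLp.norm_apply_le (z s) j).trans (hK s)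
  have hint : ∀ j k, Integrable (fun s => z s j * z s k) F := fun j k =>
    Integrable.of_bound ((hzj j).mul (hzj k)).aestronglyMeasurable (K * K)
      (Eventually.of_forall fun s => by
        rw [norm_mul]
        exact mul_le_mul (hzb j s) (hzb k s) (norm_nonneg _) ((abs_nonneg _).trans (hzb j s)))
  set A : J → J → ℝ := fun j k => ∫ s, z s j * z s k ∂F with hA
  set Q : EuclideanSpace ℝ J → ℝ := fun v => ∑ j, ∑ k, v j * v k * A j k with hQ
  have hQint : ∀ v, Q v = ∫ s, (inner ℝ v (z s) : ℝ) ^ 2 ∂F := fun v => by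
    simp only [sq_inner_eq_sum]
    rw [integral_finsetSum _ fun j _ => integrable_finsetSum _ fun k _ =>
      (hint j k).const_mul _]
    refine Finset.sum_congr rfl fun j _ => ?_
    rw [integral_finsetSum _ fun k _ => (hint j k).const_mul _]
    refine Finset.sum_congr rfl fun k _ => ?_
    rw [integral_const_mul]
  have hQc : Continuous Q := by
    simp only [hQ]; fun_prop
  have hQpos : ∀ v, v ≠ 0 → 0 < Q v := fun v hv => by
    rw [hQint]
    have hi : Integrable (fun s => (inner ℝ v (z s) : ℝ) ^ 2) F := by
      simp only [sq_inner_eq_sum]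
      exact integrable_finsetSum _ fun j _ => integrable_finsetSum _ fun k _ =>
        (hint j k).const_mul _
    refine lt_of_le_of_ne (integral_nonneg fun s => sq_nonneg _) fun h0 => hv (hnd v ?_)
    have := (integral_eq_zero_iff_of_nonneg (fun s => sq_nonneg (inner ℝ v (z s) : ℝ)) hi).1 h0.symm
    filter_upwards [this] with s hs
    simpa using hs
  have hhom : ∀ (a : ℝ) v, Q (a • v) = a ^ 2 * Q v := fun a v => by
    simp only [hQint, inner_smul_left, conj_trivial, mul_pow]
    rw [integral_const_mul]
  obtain ⟨c, hc, hcb⟩ : ∃ c : ℝ, 0 < c ∧ ∀ v, c * ‖v‖ ^ 2 ≤ Q v := by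
    by_cases hne : (Metric.sphere (0 : EuclideanSpace ℝ J) 1).Nonempty
    · obtain ⟨u, hu, hmin⟩ := (isCompact_sphere (0 : EuclideanSpace ℝ J) 1).exists_isMinOn hne
        hQc.continuousOn
      refine ⟨Q u, hQpos u (by rintro rfl; simp at hu), fun v => ?_⟩
      by_cases hv : v = 0
      · subst hv; simp [hQ]
      have hn : ‖v‖ ≠ 0 := by simpa using hv
      have h1 : Q u ≤ Q (‖v‖⁻¹ • v) := hmin (by
        simp [norm_smul, inv_mul_cancel₀ hn])
      rw [hhom, inv_pow, ← div_eq_inv_mul, le_div_iff₀ (by positivity)] at h1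
      exact h1
    · refine ⟨1, one_pos, fun v => ?_⟩
      by_cases hv : v = 0
      · subst hv; simp [hQ]
      · have hn : ‖v‖ ≠ 0 := by simpa using hv
        exact (hne ⟨‖v‖⁻¹ • v, by simp [norm_smul, inv_mul_cancel₀ hn]⟩).elim
  set d : ℝ := (Fintype.card J : ℝ) with hd
  -- Entrywise errors below η perturb the quadratic form by at most ηd‖v‖², by |v_j v_k| ≤ (v_j² +
  -- v_k²)/2; half of the lower bound c survives.
  set η := c / (2 * (d + 1)) with hη
  have hη0 : 0 < η := by positivity
  have hηd : η * d ≤ c / 2 := by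
    rw [hη, div_mul_eq_mul_div, div_le_div_iff₀ (by positivity) (by norm_num)]
    nlinarith
  have hev : HoldsEventually P fun n => ⋂ jk : J × J,
      {ω | ‖(∑ i ∈ Finset.range n, z (ξ i ω) jk.1 * z (ξ i ω) jk.2) / n - A jk.1 jk.2‖ < η} := by
    refine HoldsEventually.iInter fun jk => HoldsEventually.of_tendsto (fun n => ?_)
      (ae_tendsto_average hξm hind hlaw ((hzj jk.1).mul (hzj jk.2)) (hint jk.1 jk.2)) hη0
    refine Measurable.aestronglyMeasurable ?_
    refine Measurable.div_const (Finset.measurable_sum _ fun i _ => ?_) _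
    exact ((hzj jk.1).comp (hξm i)).mul ((hzj jk.2).comp (hξm i))
  refine ⟨c / 2, by positivity, hev.mono ?_⟩
  filter_upwards [eventually_gt_atTop 0] with n hn ω hω v
  have hn' : (0 : ℝ) < n := by exact_mod_cast hn
  simp only [Set.mem_iInter, Prod.forall, Set.mem_ofPred_eq] at hω
  set G : J → J → ℝ := fun j k => (∑ i ∈ Finset.range n, z (ξ i ω) j * z (ξ i ω) k) / n with hG
  have e1 : ∑ i ∈ Finset.range n, (inner ℝ v (z (ξ i ω)) : ℝ) ^ 2
      = n * ∑ j, ∑ k, v j * v k * G j k := by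
    simp only [sq_inner_eq_sum]
    rw [Finset.sum_comm, Finset.mul_sum]
    refine Finset.sum_congr rfl fun j _ => ?_
    rw [Finset.sum_comm, Finset.mul_sum]
    refine Finset.sum_congr rfl fun k _ => ?_
    rw [← Finset.mul_sum, hG]
    field_simp
  have e2 : Q v - ∑ j, ∑ k, v j * v k * G j k ≤ η * d * ‖v‖ ^ 2 := by
    rw [hQ]
    simp only
    rw [← Finset.sum_sub_distrib]
    have h1 : ∀ j, ∑ k, v j * v k * A j k - ∑ k, v j * v k * G j k
        ≤ ∑ k, η * ((v j ^ 2 + v k ^ 2) / 2) := fun j => by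
      rw [← Finset.sum_sub_distrib]
      refine Finset.sum_le_sum fun k _ => ?_
      have h2 := hω j k
      rw [Real.norm_eq_abs, abs_sub_comm] at h2
      have h3 : v j * v k * A j k - v j * v k * G j k ≤ |v j * v k| * |A j k - G j k| := by
        rw [← mul_sub, ← abs_mul]; exact le_abs_self _
      have h4 : |v j * v k| ≤ (v j ^ 2 + v k ^ 2) / 2 := by
        rw [abs_le]
        constructor <;> nlinarith [sq_nonneg (v j + v k), sq_nonneg (v j - v k)]
      have h5 := mul_le_mul h4 h2.le (abs_nonneg _) (by positivity)
      linarith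
    refine (Finset.sum_le_sum fun j _ => h1 j).trans_eq ?_
    have h6 : ‖v‖ ^ 2 = ∑ j, v j ^ 2 := by
      simp [EuclideanSpace.norm_sq_eq]
    simp only [← Finset.mul_sum, ← Finset.sum_div, Finset.sum_add_distrib, Finset.sum_const,
      Finset.card_univ, nsmul_eq_mul, ← h6]
    rw [← hd]
    ring
  rw [e1]
  have h7 := hcb v
  have h8 : η * d * ‖v‖ ^ 2 ≤ c / 2 * ‖v‖ ^ 2 := mul_le_mul_of_nonneg_right hηd (by positivity)
  have h9 : c / 2 * ‖v‖ ^ 2 ≤ ∑ j, ∑ k, v j * v k * G j k := by linarith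
  calc c / 2 * n * ‖v‖ ^ 2 = n * (c / 2 * ‖v‖ ^ 2) := by ring
    _ ≤ _ := mul_le_mul_of_nonneg_left h9 hn'.le

end Gram

/-! ### Regularity of case-control samples -/

lemma sum_covariate {Ω H : Type*} [AddCommMonoid H] (X : Bool → ℕ → Ω → Vec p) (n₁ n₀ : ℕ) (ω : Ω)
    (f : Vec p → H) : ∑ i, f (covariate X n₁ n₀ ω i)
      = ∑ i ∈ Finset.range n₁, f (X true i ω) + ∑ i ∈ Finset.range n₀, f (X false i ω) := by
  rw [Fintype.sum_sum_type, Finset.sum_range, Finset.sum_range]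
  rfl

lemma norm_le_sum_abs {J : Type*} [Fintype J] (v : EuclideanSpace ℝ J) : ‖v‖ ≤ ∑ j, |v j| := by
  classical
  have h : v = ∑ j, v j • EuclideanSpace.single j (1 : ℝ) := by
    ext k
    simp [Finset.sum_apply, Pi.single_apply]
  calc ‖v‖ = ‖∑ j, v j • EuclideanSpace.single j (1 : ℝ)‖ := by rw [← h]
    _ ≤ ∑ j, ‖v j • EuclideanSpace.single j (1 : ℝ)‖ := norm_sum_le _ _
    _ = ∑ j, |v j| := by simp [norm_smul]

/-- Mixed integrals against the laws of cases and controls, in terms of the law of controls. -/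
lemma mul_integral_add_mul_integral {S : Type*} [MeasurableSpace S] {F₁ F₀ : Measure S}
    {t : S → ℝ} (ht : Measurable t) (ht0 : ∀ x, 0 < t x)
    (hd : F₁ = F₀.withDensity fun x => ENNReal.ofReal (t x)) {a b n : ℝ} {c g z : S → ℝ}
    (hcz₁ : Integrable (fun x => c x * z x) F₁) (hcz₀ : Integrable (fun x => c x * z x) F₀)
    (hcg : ∀ x, (a + b * t x) * c x = n * g x) :
    b * ∫ x, c x * z x ∂F₁ + a * ∫ x, c x * z x ∂F₀ = n * ∫ x, g x * z x ∂F₀ := by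
  have hfin : ∀ᵐ x ∂F₀, ENNReal.ofReal (t x) < ⊤ := by simp
  have e1 : ∫ x, c x * z x ∂F₁ = ∫ x, t x * (c x * z x) ∂F₀ := by
    rw [hd, integral_withDensity_eq_integral_toReal_smul ht.ennreal_ofReal hfin]
    simp only [ENNReal.toReal_ofReal (ht0 _).le, smul_eq_mul]
  have i1 : Integrable (fun x => t x * (c x * z x)) F₀ := by
    rw [hd, integrable_withDensity_iff_integrable_smul' ht.ennreal_ofReal hfin] at hcz₁
    simpa only [ENNReal.toReal_ofReal (ht0 _).le, smul_eq_mul] using hcz₁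
  rw [e1, ← integral_const_mul, ← integral_const_mul, ← integral_const_mul,
    ← integral_add (i1.const_mul b) (hcz₀.const_mul a)]
  refine integral_congr_ae (Eventually.of_forall fun x => ?_)
  simp only
  linear_combination z x * hcg x

/-- Independent samples of `n₁ n` cases with law `F true` and `n₀ n` controls with law `F false`,
where `t` is the density of the former law with respect to the latter and `m` is an envelope with
three moments. -/
structure CaseControlDesign {Ω : Type*} [MeasurableSpace Ω] (P : Measure Ω)
    (X : Bool → ℕ → Ω → Vec p) (F : Bool → Measure (Vec p)) (n₁ n₀ : ℕ → ℕ) (κ : ℝ)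
    (t m : Vec p → ℝ) : Prop where
  measurable : ∀ b i, Measurable (X b i)
  indep : ∀ b, iIndepFun (X b) P
  law : ∀ b i, P.map (X b i) = F b
  size : ∀ n, n₁ n + n₀ n = n
  frac_pos : 0 < κ
  frac_le : κ ≤ 1
  balanced : ∀ᶠ n : ℕ in atTop, κ * n ≤ n₁ n ∧ κ * n ≤ n₀ n
  tilt_measurable : Measurable t
  tilt_pos : ∀ x, 0 < t x
  density : F true = (F false).withDensity fun x => ENNReal.ofReal (t x)
  envelope_measurable : Measurable m
  one_le_envelope : ∀ x, 1 ≤ m x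
  envelope_integrable : ∀ b, Integrable (fun x => m x ^ 3) (F b)

namespace CaseControlDesign

variable {Ω : Type*} [MeasurableSpace Ω] {P : Measure Ω}
  {X : Bool → ℕ → Ω → Vec p} {F : Bool → Measure (Vec p)}
  {n₁ n₀ : ℕ → ℕ} {κ : ℝ} {t m : Vec p → ℝ}

lemma integrable_of_le (D : CaseControlDesign P X F n₁ n₀ κ t m) (b : Bool) {f : Vec p → ℝ}
    (hf : Measurable f) {C : ℝ} (hC : ∀ x, |f x| ≤ C * m x) : Integrable f (F b) := by
  have hC0 : 0 ≤ C := by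
    have h1 := hC 0
    have h2 := D.one_le_envelope 0
    by_contra h
    nlinarith [abs_nonneg (f 0)]
  refine ((D.envelope_integrable b).const_mul C).mono' hf.aestronglyMeasurable
    (Eventually.of_forall fun x => (hC x).trans ?_)
  exact mul_le_mul_of_nonneg_left (le_self_pow₀ (D.one_le_envelope x) (by norm_num)) hC0

lemma tendsto_cases (D : CaseControlDesign P X F n₁ n₀ κ t m) : Tendsto n₁ atTop atTop := by
  have h1 : Tendsto (fun n : ℕ => κ * (n : ℝ)) atTop atTop :=
    tendsto_natCast_atTop_atTop.const_mul_atTop D.frac_pos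
  exact tendsto_natCast_atTop_iff.1
    (tendsto_atTop_mono' atTop (D.balanced.mono fun n hn => hn.1) h1)

lemma tendsto_controls (D : CaseControlDesign P X F n₁ n₀ κ t m) : Tendsto n₀ atTop atTop := by
  have h1 : Tendsto (fun n : ℕ => κ * (n : ℝ)) atTop atTop :=
    tendsto_natCast_atTop_atTop.const_mul_atTop D.frac_pos
  exact tendsto_natCast_atTop_iff.1
    (tendsto_atTop_mono' atTop (D.balanced.mono fun n hn => hn.2) h1)

variable [IsProbabilityMeasure P]

/-- The third moments of the envelope over the sample are eventually bounded. -/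
lemma exists_moment_bound (D : CaseControlDesign P X F n₁ n₀ κ t m) :
    ∃ M : ℝ, 1 ≤ M ∧ HoldsEventually P fun n =>
      {ω | ∑ i, m (covariate X (n₁ n) (n₀ n) ω i) ^ 3 ≤ M * n} := by
  set v : Bool → ℝ := fun b => ∫ x, m x ^ 3 ∂(F b) with hv
  have hv0 : ∀ b, 0 ≤ v b := fun b => integral_nonneg fun x => by
    have := D.one_le_envelope x
    positivity
  have hrow : ∀ b, HoldsEventually P fun n =>
      {ω | ‖(∑ i ∈ Finset.range n, m (X b i ω) ^ 3) / n - v b‖ < 1} := fun b => by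
    refine HoldsEventually.of_tendsto (fun n => ?_) (ae_tendsto_average (D.measurable b) (D.indep b)
      (D.law b) (D.envelope_measurable.pow_const 3) (D.envelope_integrable b)) one_pos
    refine Measurable.aestronglyMeasurable ?_
    refine (Finset.measurable_sum _ fun i _ => ?_).div_const _
    exact (D.envelope_measurable.pow_const 3).comp (D.measurable b i)
  refine ⟨(v true + 1) + (v false + 1), by linarith [hv0 true, hv0 false],
    (((hrow true).comp D.tendsto_cases).inter ((hrow false).comp D.tendsto_controls)).mono ?_⟩
  filter_upwards [D.tendsto_cases.eventually_gt_atTop 0, D.tendsto_controls.eventually_gt_atTop 0]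
    with n h1 h0 ω hω
  have key : ∀ b k, 0 < k → k ≤ n → ‖(∑ i ∈ Finset.range k, m (X b i ω) ^ 3) / k - v b‖ < 1 →
      ∑ i ∈ Finset.range k, m (X b i ω) ^ 3 ≤ (v b + 1) * n := by
    intro b k hk hkn hlt
    have hk' : (0 : ℝ) < k := by exact_mod_cast hk
    have hkn' : (k : ℝ) ≤ n := by exact_mod_cast hkn
    have h2 := (abs_lt.1 hlt).2
    rw [sub_lt_iff_lt_add, div_lt_iff₀ hk'] at h2
    have h3 := mul_le_mul_of_nonneg_left hkn' (by linarith [hv0 b] : 0 ≤ v b + 1)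
    linarith
  have hs := D.size n
  obtain ⟨ω1, ω0⟩ := hω
  rw [Set.mem_ofPred_eq] at ω1 ω0
  have k1 := key true (n₁ n) h1 (by omega) ω1
  have k0 := key false (n₀ n) h0 (by omega) ω0
  rw [Set.mem_ofPred_eq]
  rw [sum_covariate X _ _ ω (fun x => m x ^ 3)]
  linarith

variable [∀ b, IsProbabilityMeasure (F b)]

/-- Weighted sums over the sample, with weights `g / (n₀ + n₁ t)` for `g = 1` or `g = t`, are within
`o(n^(-1/3))` of their means. -/
lemma holdsEventually_weighted_sum (D : CaseControlDesign P X F n₁ n₀ κ t m)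
    {g z : Vec p → ℝ} (hg : g = (fun _ => 1) ∨ g = t) (hz : Measurable z)
    (hzm : ∀ x, |z x| ≤ m x) {ε : ℝ} (hε : 0 < ε) :
    HoldsEventually P fun n => {ω | |∑ i, g (covariate X (n₁ n) (n₀ n) ω i) /
      (n₀ n + n₁ n * t (covariate X (n₁ n) (n₀ n) ω i)) * z (covariate X (n₁ n) (n₀ n) ω i)
      - ∫ x, g x * z x ∂(F false)| < ε * rate n} := by
  have hκ := D.frac_pos
  have htm := D.tilt_measurable
  have hgm : Measurable g := by
    rcases hg with rfl | rfl
    · exact measurable_const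
    · exact D.tilt_measurable
  -- The factor n makes the weights bounded by κ⁻¹ uniformly in n and x: for g = 1 through n₀ ≥ κn,
  -- for g = t through n₁ ≥ κn.
  set c : ℕ → Vec p → ℝ := fun n x => n * (g x / (n₀ n + n₁ n * t x)) with hc
  have hcm : ∀ n, Measurable (c n) := fun n =>
    (hgm.div ((D.tilt_measurable.const_mul _).const_add _)).const_mul _
  have hcb : ∀ᶠ n in atTop, ∀ x, |c n x| ≤ κ⁻¹ := by
    filter_upwards [D.balanced, eventually_gt_atTop 0] with n hn hn0 x
    have hn' : (0 : ℝ) < n := by exact_mod_cast hn0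
    have h1 : (0 : ℝ) < n₁ n := (mul_pos hκ hn').trans_le hn.1
    have h0 : (0 : ℝ) < n₀ n := (mul_pos hκ hn').trans_le hn.2
    have htx := D.tilt_pos x
    have hgx : 0 ≤ g x := by
      rcases hg with rfl | rfl
      · exact zero_le_one
      · exact htx.le
    simp only [hc]
    rw [abs_of_nonneg (by positivity), ← mul_div_assoc, div_le_iff₀ (by positivity),
      ← div_eq_inv_mul, le_div_iff₀ hκ]
    have h2 := mul_pos h1 htx
    rcases hg with rfl | rfl
    · linarith [hn.2]
    · have := mul_le_mul_of_nonneg_right hn.1 htx.le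
      linarith
  have henv : ∀ᶠ n in atTop, ∀ x, |c n x * z x| ≤ κ⁻¹ * m x := hcb.mono fun n hn x => by
    rw [abs_mul]
    exact mul_le_mul (hn x) (hzm x) (abs_nonneg _) (by positivity)
  have hk1 : ∀ n, n₁ n ≤ n := fun n => by have := D.size n; omega
  have hk0 : ∀ n, n₀ n ≤ n := fun n => by have := D.size n; omega
  have hrow := fun (b : Bool) (k : ℕ → ℕ) (hk : ∀ n, k n ≤ n) =>
    ae_tendsto_rate_sum (D.measurable b) (D.indep b) (D.law b)
      (g := fun n x => c n x * z x) (fun n => (hcm n).mul hz) (m := fun x => κ⁻¹ * m x)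
      (D.envelope_measurable.const_mul _)
      (fun x => one_le_mul_of_one_le_of_one_le ((one_le_inv₀ hκ).2 D.frac_le) (D.one_le_envelope x))
      (by simpa only [mul_pow] using (D.envelope_integrable b).const_mul _) henv hk
  set T : ℕ → Ω → ℝ := fun n ω =>
    rate n ^ 2 * ∑ i ∈ Finset.range (n₁ n),
      (c n (X true i ω) * z (X true i ω) - ∫ x, c n x * z x ∂(F true)) +
    rate n ^ 2 * ∑ i ∈ Finset.range (n₀ n),
      (c n (X false i ω) * z (X false i ω) - ∫ x, c n x * z x ∂(F false)) with hT
  have hTm : ∀ n, AEStronglyMeasurable (T n) P := fun n => by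
    refine Measurable.aestronglyMeasurable (Measurable.add ?_ ?_)
    all_goals
      refine (Finset.measurable_sum _ fun i _ => ?_).const_mul _
      exact (((hcm n).mul hz).comp (D.measurable _ i)).sub_const _
  have hTt : ∀ᵐ ω ∂P, Tendsto (fun n => T n ω) atTop (𝓝 0) := by
    filter_upwards [hrow true n₁ hk1, hrow false n₀ hk0] with ω h1 h0
    have := h1.add h0
    rwa [add_zero] at this
  refine (HoldsEventually.of_tendsto hTm hTt hε).mono ?_
  filter_upwards [D.balanced, henv, eventually_gt_atTop 0] with n hn hen hn0 ω hω
  have hn' : (0 : ℝ) < n := by exact_mod_cast hn0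
  have h1 : (0 : ℝ) < n₁ n := (mul_pos hκ hn').trans_le hn.1
  have h0 : (0 : ℝ) < n₀ n := (mul_pos hκ hn').trans_le hn.2
  have hr := rate_pos hn0
  -- Relative to the controls the combined sample has intensity n₀ + n₁t, which cancels the
  -- denominator of the weight.
  have hint : n₁ n * ∫ x, c n x * z x ∂(F true) + n₀ n * ∫ x, c n x * z x ∂(F false)
      = n * ∫ x, g x * z x ∂(F false) := by
    refine mul_integral_add_mul_integral D.tilt_measurable D.tilt_pos D.density
      (D.integrable_of_le true ((hcm n).mul hz) hen)
      (D.integrable_of_le false ((hcm n).mul hz) hen) fun x => ?_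
    have htx := D.tilt_pos x
    simp only [hc]
    have : (n₀ n : ℝ) + n₁ n * t x ≠ 0 := by positivity
    field_simp
  -- The prefactor r²n is 1/r, so smallness of T is accuracy o(r).
  have hTe : T n ω = rate n ^ 2 * n * (∑ i, g (covariate X (n₁ n) (n₀ n) ω i) /
      (n₀ n + n₁ n * t (covariate X (n₁ n) (n₀ n) ω i)) * z (covariate X (n₁ n) (n₀ n) ω i)
      - ∫ x, g x * z x ∂(F false)) := by
    rw [sum_covariate X _ _ ω (fun x => g x / (n₀ n + n₁ n * t x) * z x)]
    simp only [hT, Finset.sum_sub_distrib, Finset.sum_const, Finset.card_range, nsmul_eq_mul]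
    have e : ∀ x, c n x * z x = n * (g x / (n₀ n + n₁ n * t x) * z x) := fun x => by
      simp only [hc]; ring
    have e2 : ∀ b k, ∑ i ∈ Finset.range k, c n (X b i ω) * z (X b i ω)
        = n * ∑ i ∈ Finset.range k, g (X b i ω) / (n₀ n + n₁ n * t (X b i ω)) * z (X b i ω) :=
      fun b k => by
        rw [Finset.mul_sum]
        exact Finset.sum_congr rfl fun i _ => e _
    rw [e2, e2]
    linear_combination (-rate n ^ 2) * hint
  have hω' : ‖T n ω - 0‖ < ε := hω
  rw [sub_zero, hTe, Real.norm_eq_abs, abs_mul, abs_of_pos (by positivity)] at hω'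
  have h3 : rate n ^ 2 * n * rate n = 1 := by rw [← mul_rate_pow hn0]; ring
  rw [Set.mem_ofPred_eq]
  have h4 := mul_lt_mul_of_pos_left hω' hr
  rw [← mul_assoc, show rate n * (rate n ^ 2 * n) = 1 by linarith, one_mul] at h4
  linarith

/-- Sums over the cases are within `o(n^(2/3))` of their means. -/
lemma holdsEventually_sum_cases (D : CaseControlDesign P X F n₁ n₀ κ t m)
    {z : Vec p → ℝ} (hz : Measurable z) (hzm : ∀ x, |z x| ≤ m x) {ε : ℝ} (hε : 0 < ε) :
    HoldsEventually P fun n => {ω | |∑ i ∈ Finset.range (n₁ n), z (X true i ω)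
      - n₁ n * ∫ x, z x ∂(F true)| < ε * (n * rate n)} := by
  have hk1 : ∀ n, n₁ n ≤ n := fun n => by have := D.size n; omega
  have h := ae_tendsto_rate_sum (D.measurable true) (D.indep true) (D.law true)
      (g := fun _ => z) (fun n => hz) D.envelope_measurable D.one_le_envelope
      (D.envelope_integrable true) (Eventually.of_forall fun _ => hzm) hk1
  refine (HoldsEventually.of_tendsto (fun n => ?_) h hε).mono ?_
  · refine Measurable.aestronglyMeasurable ?_
    refine (Finset.measurable_sum _ fun i _ => ?_).const_mul _
    exact (hz.comp (D.measurable _ i)).sub_const _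
  · filter_upwards [eventually_gt_atTop 0] with n hn0 ω hω
    have hr := rate_pos hn0
    have hn' : (0 : ℝ) < n := by exact_mod_cast hn0
    have hω' : ‖rate n ^ 2 * ∑ i ∈ Finset.range (n₁ n), (z (X true i ω) - ∫ x, z x ∂(F true)) - 0‖
      < ε := hω
    rw [sub_zero, Real.norm_eq_abs, abs_mul, abs_of_pos (by positivity), Finset.sum_sub_distrib,
      Finset.sum_const, Finset.card_range, nsmul_eq_mul] at hω'
    rw [Set.mem_ofPred_eq]
    have h4 := mul_lt_mul_of_pos_left hω' (mul_pos hn' hr)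
    rw [← mul_assoc, show n * rate n * (rate n ^ 2) = 1 by rw [← mul_rate_pow hn0]; ring,
      one_mul] at h4
    linarith

end CaseControlDesign

/-- The covariate with an intercept, damped exponentially. -/
def dampedDesign (B : ℝ) (x : Vec p) : EuclideanSpace ℝ (Unit ⊕ Fin p) :=
  WithLp.toLp 2 (Sum.elim (fun _ => Real.exp (-(B / 2) * ‖x‖))
    (fun j => Real.exp (-(B / 2) * ‖x‖) * x j))

lemma inner_dampedDesign (B : ℝ) (v : EuclideanSpace ℝ (Unit ⊕ Fin p)) (x : Vec p) :
    inner ℝ v (dampedDesign B x) = Real.exp (-(B / 2) * ‖x‖) * (v (Sum.inl ()) +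
      inner ℝ (WithLp.toLp 2 fun j => v (Sum.inr j) : Vec p) x) := by
  simp only [PiLp.inner_apply, Fintype.sum_sum_type, dampedDesign, RCLike.inner_apply,
    conj_trivial, Finset.univ_unique, Finset.sum_singleton, Sum.elim_inl, Sum.elim_inr,
    PUnit.default_eq_unit, mul_add, Finset.mul_sum]
  congr 1
  exact Finset.sum_congr rfl fun j _ => by ring

lemma measurable_dampedDesign (B : ℝ) : Measurable (dampedDesign (p := p) B) := by
  unfold dampedDesign
  refine (WithLp.measurable_toLp 2 _).comp (measurable_pi_lambda _ fun j => ?_)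
  rcases j with j | j
  · simp only [Sum.elim_inl]; fun_prop
  · simp only [Sum.elim_inr]; fun_prop

/-- Since B/2 ≥ 1, damping by exp(-(B/2)‖x‖) beats the linear growth 1 + ‖x‖. Boundedness makes the
Gram estimate applicable, and squaring restores the exponent B. -/
lemma norm_dampedDesign_le {B : ℝ} (hB : 2 ≤ B) (x : Vec p) : ‖dampedDesign B x‖ ≤ 1 := by
  have h1 : ‖dampedDesign B x‖ ^ 2 = Real.exp (-(B / 2) * ‖x‖) ^ 2 * (1 + ‖x‖ ^ 2) := by
    simp only [EuclideanSpace.norm_sq_eq, Fintype.sum_sum_type, dampedDesign, Sum.elim_inl,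
      Sum.elim_inr, Finset.univ_unique, Finset.sum_singleton, Real.norm_eq_abs, sq_abs, mul_pow,
      ← Finset.mul_sum]
    ring
  have h2 : Real.exp (-(B / 2) * ‖x‖) * (1 + ‖x‖) ≤ 1 := by
    have h3 : 1 + ‖x‖ ≤ Real.exp (B / 2 * ‖x‖) := by
      have := Real.add_one_le_exp (B / 2 * ‖x‖)
      nlinarith [norm_nonneg x]
    calc _ ≤ Real.exp (-(B / 2) * ‖x‖) * Real.exp (B / 2 * ‖x‖) :=
          mul_le_mul_of_nonneg_left h3 (Real.exp_pos _).le
      _ = 1 := by rw [← Real.exp_add]; simp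
  have h4 := Real.exp_pos (-(B / 2) * ‖x‖)
  have h5 := norm_nonneg x
  refine (pow_le_pow_iff_left₀ (norm_nonneg _) zero_le_one (by norm_num : (2 : ℕ) ≠ 0)).1 ?_
  rw [h1]
  calc _ ≤ (Real.exp (-(B / 2) * ‖x‖) * (1 + ‖x‖)) ^ 2 := by
        rw [mul_pow]
        exact mul_le_mul_of_nonneg_left (by nlinarith) (by positivity)
    _ ≤ 1 ^ 2 := pow_le_pow_left₀ (by positivity) h2 2

lemma integral_apply_eq {S : Type*} [MeasurableSpace S] {F : Measure S} {d : ℕ} {f : S → Vec d}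
    (hf : Integrable f F) (j : Fin d) : (∫ x, f x ∂F) j = ∫ x, f x j ∂F := by
  have := ((PiLp.proj (𝕜 := ℝ) 2 (fun _ : Fin d => ℝ) j).integral_comp_comm hf)
  exact this.symm

lemma integral_mul_eq_of_density {S : Type*} [MeasurableSpace S] {F₁ F₀ : Measure S} {t : S → ℝ}
    (ht : Measurable t) (ht0 : ∀ x, 0 < t x)
    (hd : F₁ = F₀.withDensity fun x => ENNReal.ofReal (t x)) (z : S → ℝ) :
    ∫ x, t x * z x ∂F₀ = ∫ x, z x ∂F₁ := by
  rw [hd, integral_withDensity_eq_integral_toReal_smul ht.ennreal_ofReal (by simp)]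
  simp only [ENNReal.toReal_ofReal (ht0 _).le, smul_eq_mul]

lemma norm_le_of_forall_abs_lt {d : ℕ} {v : Vec d} {e : ℝ} (he : 0 ≤ e)
    (h : ∀ j, |v j| < e / (d + 1)) : ‖v‖ ≤ e := by
  refine (norm_le_sum_abs v).trans ((Finset.sum_le_sum fun j _ => (h j).le).trans ?_)
  rw [Finset.sum_const, Finset.card_univ, Fintype.card_fin, nsmul_eq_mul, mul_div_assoc',
    div_le_iff₀ (by positivity)]
  nlinarith

namespace CaseControlDesign

variable {Ω : Type*} [MeasurableSpace Ω] {P : Measure Ω} [IsProbabilityMeasure P]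
  {X : Bool → ℕ → Ω → Vec p} {F : Bool → Measure (Vec p)} [∀ b, IsProbabilityMeasure (F b)]
  {n₁ n₀ : ℕ → ℕ} {κ : ℝ}

/-- The cases alone suffice: the controls add nonnegative terms, and n₁ ≥ κn accounts for the factor
κ. -/
lemma exists_gram {t m : Vec p → ℝ} (D : CaseControlDesign P X F n₁ n₀ κ t m)
    (hF : ∀ (a : ℝ) (b : Vec p), (∀ᵐ x ∂(F true), a + inner ℝ b x = 0) → a = 0 ∧ b = 0)
    {B : ℝ} (hB : 2 ≤ B) :
    ∃ cG : ℝ, 0 < cG ∧ HoldsEventually P fun n => {ω | ∀ (a : ℝ) (b : Vec p),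
      cG * n * (a ^ 2 + ‖b‖ ^ 2) ≤ ∑ i, Real.exp (-B * ‖covariate X (n₁ n) (n₀ n) ω i‖) *
        (a + inner ℝ b (covariate X (n₁ n) (n₀ n) ω i)) ^ 2} := by
  obtain ⟨c, hc, hev⟩ := exists_gram_lower_bound (D.measurable true) (D.indep true) (D.law true)
    (measurable_dampedDesign B) (norm_dampedDesign_le hB) fun v hv => by
      have h := hF (v (Sum.inl ())) (WithLp.toLp 2 fun j => v (Sum.inr j)) (by
        filter_upwards [hv] with x hx
        rw [inner_dampedDesign] at hx
        exact (mul_eq_zero.1 hx).resolve_left (Real.exp_pos _).ne')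
      ext k
      rcases k with k | k
      · exact h.1
      · exact congrArg (fun w : Vec p => w k) h.2
  refine ⟨c * κ, mul_pos hc D.frac_pos, (hev.comp D.tendsto_cases).mono ?_⟩
  filter_upwards [D.balanced] with n hn ω hω
  rw [Set.mem_ofPred_eq] at hω ⊢
  intro a b
  have h1 := hω (WithLp.toLp 2 (Sum.elim (fun _ => a) (fun j => b j)))
  have h2 : ‖(WithLp.toLp 2 (Sum.elim (fun _ => a) (fun j => b j)) :
      EuclideanSpace ℝ (Unit ⊕ Fin p))‖ ^ 2 = a ^ 2 + ‖b‖ ^ 2 := by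
    simp [EuclideanSpace.norm_sq_eq, Fintype.sum_sum_type]
  rw [h2] at h1
  rw [sum_covariate X _ _ ω (fun x => Real.exp (-B * ‖x‖) * (a + inner ℝ b x) ^ 2)]
  have h3 : ∑ i ∈ Finset.range (n₁ n), (inner ℝ (WithLp.toLp 2 (Sum.elim (fun _ => a)
      (fun j => b j)) : EuclideanSpace ℝ (Unit ⊕ Fin p)) (dampedDesign B (X true i ω)) : ℝ) ^ 2
      = ∑ i ∈ Finset.range (n₁ n), Real.exp (-B * ‖X true i ω‖) *
        (a + inner ℝ b (X true i ω)) ^ 2 := by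
    refine Finset.sum_congr rfl fun i _ => ?_
    rw [inner_dampedDesign, mul_pow, ← Real.exp_nat_mul]
    congr 1
    congr 1
    push_cast
    ring
  rw [h3] at h1
  have h4 : 0 ≤ ∑ i ∈ Finset.range (n₀ n), Real.exp (-B * ‖X false i ω‖) *
      (a + inner ℝ b (X false i ω)) ^ 2 := Finset.sum_nonneg fun i _ => by positivity
  have h5 : c * κ * n * (a ^ 2 + ‖b‖ ^ 2) ≤ c * n₁ n * (a ^ 2 + ‖b‖ ^ 2) := by
    have := mul_le_mul_of_nonneg_left hn.1 hc.le
    exact mul_le_mul_of_nonneg_right (by linarith) (by positivity)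
  linarith

/-- Case-control samples are eventually regular, with any prescribed accuracy. -/
theorem exists_regularSample {h : Vec p → Vec q} {θ₀ : Param p q}
    (D : CaseControlDesign P X F n₁ n₀ κ (tilt θ₀) (fun x => 1 + ‖x‖ + ‖h x‖)) (hh : Measurable h)
    (hF : ∀ (a : ℝ) (b : Vec p), (∀ᵐ x ∂(F true), a + inner ℝ b x = 0) → a = 0 ∧ b = 0)
    {B : ℝ} (hB : 2 ≤ B) :
    ∃ M cG : ℝ, 1 ≤ M ∧ 0 < cG ∧ ∀ ε, 0 < ε → HoldsEventually P fun n =>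
      {ω | RegularSample h θ₀ (∫ x, h x ∂(F false)) (∫ x, h x ∂(F true)) κ M cG B (n₁ n) (n₀ n)
        (rate n) ε (response (n₁ n) (n₀ n)) (covariate X (n₁ n) (n₀ n) ω)} := by
  obtain ⟨M, hM, hMev⟩ := D.exists_moment_bound
  obtain ⟨cG, hcG, hGev⟩ := D.exists_gram hF hB
  refine ⟨M, cG, hM, hcG, fun ε hε => ?_⟩
  have hhj : ∀ j, Measurable fun x => h x j := fun j => by fun_prop
  have hxj : ∀ j, Measurable fun x : Vec p => x j := fun j => by fun_prop
  have hone : ∀ x : Vec p, |(1 : ℝ)| ≤ 1 + ‖x‖ + ‖h x‖ := fun x => by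
    rw [abs_one]; linarith [norm_nonneg x, norm_nonneg (h x)]
  have hhb : ∀ j x, |h x j| ≤ 1 + ‖x‖ + ‖h x‖ := fun j x => by
    have := PiLp.norm_apply_le (h x) j
    rw [Real.norm_eq_abs] at this
    linarith [norm_nonneg x]
  have hxb : ∀ j, ∀ x : Vec p, |x j| ≤ 1 + ‖x‖ + ‖h x‖ := fun j x => by
    have := PiLp.norm_apply_le x j
    rw [Real.norm_eq_abs] at this
    linarith [norm_nonneg (h x)]
  have hhi : ∀ b, Integrable h (F b) := fun b => by
    refine Integrable.mono' (D.integrable_of_le b (f := fun x => ‖h x‖) hh.norm (C := 1) fun x => ?_)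
      hh.aestronglyMeasurable (Eventually.of_forall fun x => le_rfl)
    rw [abs_norm]; linarith [norm_nonneg x]
  have hq : 0 < ε / (q + 1) := by positivity
  -- Dividing by p + 1 shares the error among coordinates; the extra half is for the two parts of
  -- the score.
  have hp : 0 < ε / (p + 1) / 2 := by positivity
  have E1 := D.holdsEventually_weighted_sum (Or.inl rfl) (measurable_const (a := (1 : ℝ))) hone hε
  have E2 := D.holdsEventually_weighted_sum (Or.inr rfl) (measurable_const (a := (1 : ℝ))) hone hε
  have E3 := HoldsEventually.iInter fun j =>
    D.holdsEventually_weighted_sum (Or.inl rfl) (hhj j) (hhb j) hq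
  have E4 := HoldsEventually.iInter fun j =>
    D.holdsEventually_weighted_sum (Or.inr rfl) (hhj j) (hhb j) hq
  have E5 := HoldsEventually.iInter fun j =>
    D.holdsEventually_weighted_sum (Or.inr rfl) (hxj j) (hxb j) hp
  have E6 := HoldsEventually.iInter fun j =>
    D.holdsEventually_sum_cases (hxj j) (hxb j) hp
  refine ((((((E1.inter E2).inter E3).inter E4).inter E5).inter E6).inter
    (hMev.inter hGev)).mono ?_
  filter_upwards [D.balanced, eventually_gt_atTop 0] with n hn hn0 ω hω
  obtain ⟨⟨⟨⟨⟨⟨ω1, ω2⟩, ω3⟩, ω4⟩, ω5⟩, ω6⟩, ω7, ω8⟩ := hω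
  simp only [Set.mem_iInter, Set.mem_ofPred_eq, one_mul, mul_one,
    integral_mul_eq_of_density D.tilt_measurable D.tilt_pos D.density] at ω1 ω2 ω3 ω4 ω5 ω6 ω7 ω8
  have hI : ∫ x, tilt θ₀ x ∂(F false) = 1 := by
    have := integral_mul_eq_of_density D.tilt_measurable D.tilt_pos D.density fun _ => 1
    simpa using this
  simp only [integral_const, probReal_univ, smul_eq_mul, one_mul] at ω1
  rw [hI] at ω2
  have hn' : (0 : ℝ) < n := by exact_mod_cast hn0
  have hr := rate_pos hn0
  have hcard : (Fintype.card (Fin (n₁ n) ⊕ Fin (n₀ n)) : ℝ) = n := by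
    rw [Fintype.card_sum, Fintype.card_fin, Fintype.card_fin, D.size]
  rw [Set.mem_ofPred_eq]
  refine ⟨hr, ?_, ?_, ?_, ?_, ?_, ?_, ?_, ?_, ?_, ?_, ?_, ?_⟩
  · rw [hcard]
    have := D.size n
    norm_cast
    omega
  · rw [hcard]; exact mul_rate_pow hn0
  · rw [hcard]; exact hn.2
  · rw [hcard]; exact hn.1
  · simp [response]
  · simpa only [one_div] using ω1.le
  · exact ω2.le
  · refine norm_le_of_forall_abs_lt (by positivity) fun j => ?_
    rw [PiLp.sub_apply, integral_apply_eq (hhi false)]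
    have := ω3 j
    simp only [one_div] at this
    simp only [WithLp.ofLp_sum, WithLp.ofLp_smul, Finset.sum_apply, Pi.smul_apply, smul_eq_mul]
    rwa [mul_div_right_comm]
  · refine norm_le_of_forall_abs_lt (by positivity) fun j => ?_
    rw [PiLp.sub_apply, integral_apply_eq (hhi true)]
    have := ω4 j
    simp only [WithLp.ofLp_sum, WithLp.ofLp_smul, Finset.sum_apply, Pi.smul_apply, smul_eq_mul]
    rwa [mul_div_right_comm]
  · rw [hcard]
    refine norm_le_of_forall_abs_lt (by positivity) fun j => ?_
    have h5 := ω5 j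
    have h6 := ω6 j
    simp only [WithLp.ofLp_sum, WithLp.ofLp_smul, Finset.sum_apply, Pi.smul_apply, smul_eq_mul]
    set I := ∫ x : Vec p, x j ∂(F true) with hI
    set T := ∑ i, tilt θ₀ (covariate X (n₁ n) (n₀ n) ω i) / (n₀ n + n₁ n *
      tilt θ₀ (covariate X (n₁ n) (n₀ n) ω i)) * covariate X (n₁ n) (n₀ n) ω i j with hT
    -- Both the sum over the cases and n₁ times the weighted sum are centred at n₁ I, so the score
    -- is a difference of two small errors.
    have e : ∑ i, (response (n₁ n) (n₀ n) i - n₁ n * (tilt θ₀ (covariate X (n₁ n) (n₀ n) ω i) /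
        (n₀ n + n₁ n * tilt θ₀ (covariate X (n₁ n) (n₀ n) ω i)))) *
        covariate X (n₁ n) (n₀ n) ω i j
        = (∑ i ∈ Finset.range (n₁ n), X true i ω j - n₁ n * I) - n₁ n * (T - I) := by
      simp only [sub_mul, Finset.sum_sub_distrib, mul_assoc]
      rw [← Finset.mul_sum, ← hT]
      have : ∑ i, response (n₁ n) (n₀ n) i * covariate X (n₁ n) (n₀ n) ω i j
          = ∑ i ∈ Finset.range (n₁ n), X true i ω j := by
        rw [Fintype.sum_sum_type, Finset.sum_range]
        simp [response, covariate]
      rw [this]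
      ring
    rw [e]
    refine (abs_sub _ _).trans_lt ?_
    rw [abs_mul, abs_of_nonneg (Nat.cast_nonneg (α := ℝ) (n₁ n))]
    have hk : (n₁ n : ℝ) ≤ n := by
      have := D.size n
      exact_mod_cast (by omega : n₁ n ≤ n)
    have h7 := mul_le_mul hk h5.le (abs_nonneg _) hn'.le
    calc _ < ε / (p + 1) / 2 * (n * rate n) + n * (ε / (p + 1) / 2 * rate n) := by linarith
      _ = _ := by ring
  · rw [hcard]; exact ω7
  · rw [hcard]; exact ω8

end CaseControlDesign

/-! ### Existence, localization and consistency of the estimator -/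

section Convergence

variable {Ω : Type*} [MeasurableSpace Ω] {P : Measure Ω}

/-- By Slutsky a_n Y_n tends to 0 in distribution, and the closed set {‖v‖ ≥ 1} is null for the
limit, so the portmanteau theorem applies. -/
lemma tendsto_measure_le_norm_smul [IsProbabilityMeasure P] {d : ℕ} {Y : ℕ → Ω → Vec d}
    {μ : Measure (Vec d)} [IsProbabilityMeasure μ]
    (h : TendstoInDistribution Y atTop (id : Vec d → Vec d) (fun _ => P) μ) {a : ℕ → ℝ}
    (ha : Tendsto a atTop (𝓝 0)) :
    Tendsto (fun n => P {ω | 1 ≤ ‖a n • Y n ω‖}) atTop (𝓝 0) := by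
  have hc : Continuous fun z : Vec d × ℝ => z.2 • z.1 := by fun_prop
  have ham : TendstoInMeasure P (fun n (_ : Ω) => a n) atTop (fun _ => (0 : ℝ)) :=
    tendstoInMeasure_of_tendsto_ae (fun n => aestronglyMeasurable_const) (by simpa using ha)
  have h2 := h.continuous_comp_prodMk_of_tendstoInMeasure_const hc ham
    (fun n => aemeasurable_const)
  have hcl : IsClosed {v : Vec d | 1 ≤ ‖v‖} := isClosed_le continuous_const continuous_norm
  have h3 := ProbabilityMeasure.limsup_measure_closed_le_of_tendsto h2.tendsto hcl
  simp only [ProbabilityMeasure.coe_mk] at h3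
  rw [Measure.map_apply_of_aemeasurable h2.aemeasurable_limit hcl.measurableSet] at h3
  simp only [Measure.map_apply_of_aemeasurable (h2.forall_aemeasurable _) hcl.measurableSet] at h3
  refine tendsto_of_le_liminf_of_limsup_le zero_le (h3.trans ?_)
  have hempty : {v : Vec d | 1 ≤ ‖(0 : ℝ) • v‖} = ∅ := by
    ext v
    simp
  exact ((congrArg μ hempty).trans measure_empty).le

/-- An external estimate that converges at the root-`N` rate is within `ε n^(-1/3)` of its target
with probability tending to one. -/
lemma tendsto_measure_not_norm_le [IsProbabilityMeasure P] {d : ℕ} {N : ℕ → ℕ} {cN : ℝ}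
    (hcN : 0 < cN) (hN : ∀ᶠ n : ℕ in atTop, cN * n ≤ N n) {m : ℕ → Ω → Vec d} {μ₀ : Vec d}
    {μ : Measure (Vec d)} [IsProbabilityMeasure μ]
    (h : TendstoInDistribution (fun (n : ℕ) ω => √(N n : ℝ) • (m n ω - μ₀)) atTop
      (id : Vec d → Vec d) (fun _ => P) μ) {ε : ℝ} (hε : 0 < ε) :
    Tendsto (fun n => P {ω | ¬ ‖m n ω - μ₀‖ ≤ ε * rate n}) atTop (𝓝 0) := by
  -- With this factor, a failed error bound means norm at least one after scaling. Since n r³ = 1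
  -- and N ≥ cN · n, a² ≤ r/(ε² cN), which tends to zero.
  set a : ℕ → ℝ := fun n => (ε * rate n * √(N n : ℝ))⁻¹ with hadef
  have ha : Tendsto a atTop (𝓝 0) := by
    have h1 : Tendsto (fun n => √(rate n / (ε ^ 2 * cN))) atTop (𝓝 0) := by
      have := ((tendsto_rate.div_const (ε ^ 2 * cN))).sqrt
      simpa using this
    refine tendsto_of_tendsto_of_tendsto_of_le_of_le' tendsto_const_nhds h1
      (Eventually.of_forall fun n => ?_) ?_
    · have := rate_nonneg n
      positivity
    · filter_upwards [hN, eventually_gt_atTop 0] with n hn hn0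
      have hr := rate_pos hn0
      have hn' : (0 : ℝ) < n := by exact_mod_cast hn0
      have hNp : (0 : ℝ) < N n := (mul_pos hcN hn').trans_le hn
      refine Real.le_sqrt_of_sq_le ?_
      have e : a n ^ 2 = (ε ^ 2 * (rate n ^ 2 * N n))⁻¹ := by
        simp only [hadef]
        rw [inv_pow, mul_pow, mul_pow, Real.sq_sqrt hNp.le, mul_assoc]
      rw [e, inv_le_comm₀ (by positivity) (by positivity), inv_div, div_le_iff₀ hr]
      have h2 := mul_le_mul_of_nonneg_left hn (by positivity : 0 ≤ ε ^ 2 * rate n ^ 3)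
      have h3 := mul_rate_pow hn0
      calc ε ^ 2 * cN = ε ^ 2 * rate n ^ 3 * (cN * n) := by linear_combination (-ε ^ 2 * cN) * h3
        _ ≤ _ := h2
        _ = _ := by ring
  refine tendsto_of_tendsto_of_tendsto_of_le_of_le' tendsto_const_nhds
    (tendsto_measure_le_norm_smul h ha) (Eventually.of_forall fun _ => zero_le) ?_
  filter_upwards [hN, eventually_gt_atTop 0] with n hn hn0
  have hr := rate_pos hn0
  have hn' : (0 : ℝ) < n := by exact_mod_cast hn0
  have hNp : (0 : ℝ) < N n := (mul_pos hcN hn').trans_le hn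
  refine measure_mono fun ω hω => ?_
  rw [Set.mem_ofPred_eq, not_le] at hω
  rw [Set.mem_ofPred_eq, smul_smul, norm_smul, Real.norm_eq_abs]
  have hs : 0 < √(N n : ℝ) := Real.sqrt_pos.2 hNp
  have e : a n * √(N n : ℝ) = (ε * rate n)⁻¹ := by
    simp only [hadef]; field_simp
  rw [e, abs_of_pos (by positivity), ← div_eq_inv_mul, le_div_iff₀ (by positivity)]
  linarith

/-- Only monotonicity of the measure on the bad sets is used, so an arbitrary, possibly
nonmeasurable, selection of maximizers is allowed. -/
lemma tendstoInMeasure_comp_of_dist_le {E E' : Type*} [PseudoMetricSpace E] [PseudoMetricSpace E']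
    {bad : ℕ → Set Ω} (hbad : Tendsto (fun n => P (bad n)) atTop (𝓝 0)) {r : ℕ → ℝ}
    (hr : Tendsto r atTop (𝓝 0)) {θ : ℕ → Ω → E} {θ₀ : E}
    (h : ∀ n ω, ω ∉ bad n → dist (θ n ω) θ₀ ≤ r n) {f : E → E'} (hf : ContinuousAt f θ₀) :
    TendstoInMeasure P (fun n ω => f (θ n ω)) atTop (fun _ => f θ₀) := by
  intro ε hε
  obtain ⟨δ, hδ, hδf⟩ := Metric.mem_nhds_iff.1 (hf (Metric.eball_mem_nhds (f θ₀) hε))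
  refine tendsto_of_tendsto_of_tendsto_of_le_of_le' tendsto_const_nhds hbad
    (Eventually.of_forall fun _ => zero_le) ?_
  filter_upwards [hr.eventually (gt_mem_nhds hδ)] with n hn
  refine measure_mono fun ω hω => ?_
  have hω' : ε ≤ edist (f (θ n ω)) (f θ₀) := hω
  by_contra hb
  have h1 : θ n ω ∈ Metric.ball θ₀ δ := (h n ω hb).trans_lt hn
  exact (not_lt.2 hω') (Metric.mem_eball.1 (hδf h1))

lemma eventually_mul_le_and_le_mul {N : ℕ → ℕ} {c : ℝ} (hc : 0 < c)
    (hN : Tendsto (fun n : ℕ => (n : ℝ) / (N n : ℝ)) atTop (𝓝 c)) :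
    ∀ᶠ n : ℕ in atTop, (2 * c)⁻¹ * n ≤ N n ∧ N n ≤ 2 / c * n := by
  filter_upwards [hN.eventually (lt_mem_nhds (half_lt_self hc)),
    hN.eventually (gt_mem_nhds (by linarith : c < 2 * c))] with n h1 h2
  have hNp : (0 : ℝ) < N n := by
    -- For N n = 0 the quotient is 0 by convention, below c/2.
    rcases (Nat.cast_nonneg (α := ℝ) (N n)).eq_or_lt with h0 | h0
    · rw [← h0, div_zero] at h1
      linarith
    · exact h0
  rw [lt_div_iff₀ hNp] at h1
  rw [div_lt_iff₀ hNp] at h2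
  constructor
  · rw [← div_eq_inv_mul, div_le_iff₀ (by positivity)]
    linarith
  · rw [div_mul_eq_mul_div, le_div_iff₀ hc]
    linarith

end Convergence

lemma measurable_tilt (θ : Param p q) : Measurable (tilt θ) := by
  unfold tilt; fun_prop

/-- The estimator is eventually well behaved whenever the external error is a small multiple
of `n^(-1/3)`. -/
theorem IsLogistic.exists_holdsEventually_goodEstimator {Pop : Measure (Vec p × Bool)}
    [IsProbabilityMeasure Pop] {α₀ : ℝ} {β₀ : Vec p} (hlog : IsLogistic Pop α₀ β₀)
    {h : Vec p → Vec q} (hh : Measurable h)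
    (hne : ∫ x, h x ∂(condLaw Pop true) ≠ ∫ x, h x ∂(condLaw Pop false))
    {Ω : Type*} [MeasurableSpace Ω] {P : Measure Ω} [IsProbabilityMeasure P]
    {X : Bool → ℕ → Ω → Vec p} (hXm : ∀ b i, Measurable (X b i)) (hXind : ∀ b, iIndepFun (X b) P)
    (hXlaw : ∀ b i, P.map (X b i) = condLaw Pop b)
    {n₁ n₀ N : ℕ → ℕ} (hn : ∀ n, n₁ n + n₀ n = n) {κ : ℝ} (hκ : 0 < κ)
    (hbal : ∀ᶠ n : ℕ in atTop, κ * n ≤ n₁ n ∧ κ * n ≤ n₀ n) {cN CN : ℝ} (hcN : 0 < cN)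
    (hCN : 0 < CN) (hN : ∀ᶠ n : ℕ in atTop, cN * n ≤ N n ∧ N n ≤ CN * n)
    (mtilde : ℕ → Ω → Vec q) {W : Matrix (Fin q) (Fin q) ℝ} (hW : W.PosDef)
    {Θ : Set (Param p q)} (hΘ : IsCompact Θ) (hint : thetaTrue Pop α₀ β₀ h ∈ interior Θ)
    (hX3 : Integrable (fun x => ‖x‖ ^ 3) Pop.fst) (hh3 : Integrable (fun x => ‖h x‖ ^ 3) Pop.fst)
    (hF : ∀ S : AffineSubspace ℝ (Vec p), S ≠ ⊤ → ¬ ∀ᵐ x ∂Pop.fst, x ∈ S) :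
    ∃ ε : ℝ, 0 < ε ∧ HoldsEventually P fun n =>
      {ω | ‖mtilde n ω - ∫ x, h x ∂Pop.fst‖ ≤ ε * rate n →
        GoodEstimator h Θ W (N n) (mtilde n ω) (response (n₁ n) (n₀ n))
          (covariate X (n₁ n) (n₀ n) ω) (thetaTrue Pop α₀ β₀ h)} := by
  have hprob := fun b => hlog.isProbabilityMeasure_condLaw b
  set θ₀ := thetaTrue Pop α₀ β₀ h with hθ₀
  have henv : Integrable (fun x => (1 + ‖x‖ + ‖h x‖) ^ 3) Pop.fst := by
    refine (((integrable_const (1 : ℝ)).add hX3).add hh3 |>.const_mul 9).mono'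
      (by fun_prop) (Eventually.of_forall fun x => ?_)
    have hx := norm_nonneg x
    have hy := norm_nonneg (h x)
    rw [Real.norm_eq_abs, abs_of_nonneg (by positivity)]
    have h9 : ∀ a b c : ℝ, 0 ≤ a → 0 ≤ b → 0 ≤ c → (a + b + c) ^ 3 ≤ 9 * (a ^ 3 + b ^ 3 + c ^ 3) :=
      fun a b c ha hb hc => by
        nlinarith [mul_nonneg (add_nonneg ha hb) (sq_nonneg (a - b)),
          mul_nonneg (add_nonneg hb hc) (sq_nonneg (b - c)),
          mul_nonneg (add_nonneg ha hc) (sq_nonneg (a - c)),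
          mul_nonneg ha (sq_nonneg (b - c)), mul_nonneg hb (sq_nonneg (a - c)),
          mul_nonneg hc (sq_nonneg (a - b))]
    simpa using h9 1 ‖x‖ ‖h x‖ zero_le_one hx hy
  have hhi : ∀ b, Integrable h (condLaw Pop b) := fun b => by
    refine (hlog.integrable_condLaw b henv).mono' hh.aestronglyMeasurable
      (Eventually.of_forall fun x => ?_)
    have h1 : 1 ≤ 1 + ‖x‖ + ‖h x‖ := by linarith [norm_nonneg x, norm_nonneg (h x)]
    have h2 := le_self_pow₀ h1 (by norm_num : (3 : ℕ) ≠ 0)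
    linarith [norm_nonneg x]
  -- The fraction is capped at one so that the rescaled envelope κ⁻¹ m still dominates one.
  have D : CaseControlDesign P X (condLaw Pop) n₁ n₀ (min κ 1) (tilt θ₀)
      (fun x => 1 + ‖x‖ + ‖h x‖) :=
    { measurable := hXm
      indep := hXind
      law := hXlaw
      size := hn
      frac_pos := lt_min hκ one_pos
      frac_le := min_le_right _ _
      balanced := hbal.mono fun n h =>
        ⟨(mul_le_mul_of_nonneg_right (min_le_left _ _) (Nat.cast_nonneg _)).trans h.1,
          (mul_le_mul_of_nonneg_right (min_le_left _ _) (Nat.cast_nonneg _)).trans h.2⟩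
      tilt_measurable := measurable_tilt θ₀
      tilt_pos := fun x => Real.exp_pos _
      density := hlog.condLaw_true_eq h
      envelope_measurable := by fun_prop
      one_le_envelope := fun x => by linarith [norm_nonneg x, norm_nonneg (h x)]
      envelope_integrable := fun b => hlog.integrable_condLaw b henv }
  obtain ⟨Λ, hΛ⟩ := hΘ.isBounded.exists_norm_le
  -- The damping exponent must be three times a bound on Θ; the maximum with 1 secures B ≥ 2.
  obtain ⟨M, cG, hM, hcG, hreg⟩ := D.exists_regularSample hh
    (fun a b hab => eq_zero_of_ae_affine_eq_zero hF (hlog.ae_fst_of_ae_condLaw true hab))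
    (B := 3 * max Λ 1) (by linarith [le_max_right Λ 1])
  have hμ : mom θ₀ = (1 + Real.exp (gam θ₀))⁻¹ • (∫ x, h x ∂(condLaw Pop true)
      + Real.exp (gam θ₀) • ∫ x, h x ∂(condLaw Pop false)) := by
    have h1 := hlog.respProb_pos true
    have h0 := hlog.respProb_pos false
    have hs := respProb_add (Pop := Pop)
    simp only [hθ₀, thetaTrue, mom_mkParam, gam_mkParam, exp_gammaTrue hlog]
    have e : (1 + respProb Pop false / respProb Pop true)⁻¹ = respProb Pop true := by
      rw [one_add_div h1.ne', hs, one_div, inv_inv]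
    rw [hlog.integral_fst hhi, e, smul_add, smul_smul, mul_div_cancel₀ _ h1.ne']
  obtain ⟨ε, hε, hgood⟩ := exists_goodEstimator (Λ := max Λ 1) hne.symm hμ hΘ hint hW
    (lt_min hκ one_pos) hM hcG (fun θ hθ => (hΛ θ hθ).trans (le_max_left _ _)) hcN hCN
  refine ⟨ε, hε, (hreg ε hε).mono ?_⟩
  filter_upwards [hN] with n hNn ω hω hm
  have hcard : (Fintype.card (Fin (n₁ n) ⊕ Fin (n₀ n)) : ℝ) = n := by
    rw [Fintype.card_sum, Fintype.card_fin, Fintype.card_fin, hn]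
  exact hgood hω (N n) (mtilde n ω) (by rw [hcard]; exact hNn.1) (by rw [hcard]; exact hNn.2) hm

end CaseControl

end

/-! ### The main theorem -/

theorem theorem1 {p q : ℕ}
    -- population: joint law of the covariate and the response, logistic model
    (Pop : Measure (CaseControl.Vec p × Bool)) [IsProbabilityMeasure Pop]
    (α₀ : ℝ) (β₀ : CaseControl.Vec p) (hlog : CaseControl.IsLogistic Pop α₀ β₀)
    -- the summary function; its means in the two sub-populations differ
    (h : CaseControl.Vec p → CaseControl.Vec q) (hh : Measurable h)
    (hne : ∫ x, h x ∂(CaseControl.condLaw Pop true) ≠ ∫ x, h x ∂(CaseControl.condLaw Pop false))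
    -- internal data: independent random samples from the cases and from the controls
    {Ω : Type*} [MeasurableSpace Ω] (P : Measure Ω) [IsProbabilityMeasure P]
    (X : Bool → ℕ → Ω → CaseControl.Vec p)
    (hXm : ∀ b i, Measurable (X b i))
    (hXind : iIndepFun (fun k : Bool × ℕ => X k.1 k.2) P)
    (hXlaw : ∀ b i, P.map (X b i) = CaseControl.condLaw Pop b)
    -- sample sizes; cases and controls both make up a non-vanishing fraction
    (n₁ n₀ N : ℕ → ℕ) (hn : ∀ n, n₁ n + n₀ n = n)
    (hbal : ∃ κ : ℝ, 0 < κ ∧ ∀ᶠ n : ℕ in atTop, κ * n ≤ n₁ n ∧ κ * n ≤ n₀ n)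
    (c : ℝ) (hc : 0 < c) (hN : Tendsto (fun n : ℕ => (n : ℝ) / (N n : ℝ)) atTop (𝓝 c))
    -- external summary estimate and weight matrix
    (mtilde : ℕ → Ω → CaseControl.Vec q)
    (W : Matrix (Fin q) (Fin q) ℝ) (hW : W.PosDef)
    -- Condition 1
    (Θ : Set (CaseControl.Param p q)) (hΘ : IsCompact Θ)
    (hcond1 : CaseControl.thetaTrue Pop α₀ β₀ h ∈ interior Θ)
    -- Condition 2
    (hcond2 : ∀ μ : CaseControl.Vec q,
      ∫ x, CaseControl.H h (CaseControl.mkParam (CaseControl.gammaTrue Pop)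
        (CaseControl.gammaTrue Pop + α₀) β₀ μ) x ∂(CaseControl.condLaw Pop false) = 0 ↔
      μ = ∫ x, h x ∂Pop.fst)
    -- Condition 3
    (hcond3a : Integrable (fun x => ‖x‖ ^ 3) Pop.fst)
    (hcond3b : Integrable (fun x => ‖h x‖ ^ 3) Pop.fst)
    (hcond3c : ∀ S : AffineSubspace ℝ (CaseControl.Vec p), S ≠ ⊤ → ¬ ∀ᵐ x ∂Pop.fst, x ∈ S)
    -- Condition 4
    (V : Matrix (Fin q) (Fin q) ℝ) (hV : V.PosSemidef)
    (hcond4 : TendstoInDistribution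
      (fun (n : ℕ) ω => √(N n : ℝ) • (mtilde n ω - ∫ x, h x ∂Pop.fst)) atTop
      (id : CaseControl.Vec q → CaseControl.Vec q) (fun _ => P) (multivariateGaussian 0 V)) :
    -- with probability tending to one, the estimator is a stationary point in the small ball
    Tendsto (fun n : ℕ => P {ω | ¬ CaseControl.GoodEstimator h Θ W (N n) (mtilde n ω)
      (CaseControl.response (n₁ n) (n₀ n)) (CaseControl.covariate X (n₁ n) (n₀ n) ω)
      (CaseControl.thetaTrue Pop α₀ β₀ h)}) atTop (𝓝 0) ∧
    -- almost surely, this holds for all large `n` if the external error is `o(n^(-1/3))`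
    (∀ᵐ ω ∂P, Tendsto (fun n : ℕ => (n : ℝ) ^ (1 / 3 : ℝ) *
        ‖mtilde n ω - ∫ x, h x ∂Pop.fst‖) atTop (𝓝 0) →
      ∀ᶠ n : ℕ in atTop, CaseControl.GoodEstimator h Θ W (N n) (mtilde n ω)
        (CaseControl.response (n₁ n) (n₀ n)) (CaseControl.covariate X (n₁ n) (n₀ n) ω)
        (CaseControl.thetaTrue Pop α₀ β₀ h)) ∧
    -- consistency of the estimators of `θ`, of the intercept and of the case proportion
    (∀ θhat : ℕ → Ω → CaseControl.Param p q,
      (∀ n ω, (∃ θ w, CaseControl.IsMaximizer h Θ W (N n) (mtilde n ω)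
          (CaseControl.response (n₁ n) (n₀ n)) (CaseControl.covariate X (n₁ n) (n₀ n) ω) θ w) →
        ∃ w, CaseControl.IsMaximizer h Θ W (N n) (mtilde n ω)
          (CaseControl.response (n₁ n) (n₀ n)) (CaseControl.covariate X (n₁ n) (n₀ n) ω)
          (θhat n ω) w) →
      TendstoInMeasure P θhat atTop (fun _ => CaseControl.thetaTrue Pop α₀ β₀ h) ∧
      TendstoInMeasure P
        (fun n ω => CaseControl.astar (θhat n ω) - CaseControl.gam (θhat n ω)) atTop
        (fun _ => α₀) ∧
      TendstoInMeasure P (fun n ω => 1 / (1 + Real.exp (CaseControl.gam (θhat n ω)))) atTop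
        (fun _ => CaseControl.caseProp Pop)) ∧
    -- identifiability of the intercept and of the case proportion
    (∀ (Pop' : Measure (CaseControl.Vec p × Bool)) (α' : ℝ) (β' : CaseControl.Vec p),
      IsProbabilityMeasure Pop' → CaseControl.IsLogistic Pop' α' β' →
      (∀ b, CaseControl.condLaw Pop' b = CaseControl.condLaw Pop b) →
      ∫ x, h x ∂Pop'.fst = ∫ x, h x ∂Pop.fst →
      α' = α₀ ∧ CaseControl.caseProp Pop' = CaseControl.caseProp Pop)
 := by
  obtain ⟨κ, hκ, hbal⟩ := hbal
  have hNn := CaseControl.eventually_mul_le_and_le_mul hc hN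
  obtain ⟨ε, hε, hgood⟩ := hlog.exists_holdsEventually_goodEstimator hh hne hXm
    (fun b => hXind.precomp (g := fun i => (b, i)) fun i j hij => (Prod.mk.inj hij).2) hXlaw hn hκ
    hbal (by positivity) (by positivity) hNn mtilde hW hΘ hcond1 hcond3a hcond3b hcond3c
  have hbad : Tendsto (fun n : ℕ => P {ω | ¬ CaseControl.GoodEstimator h Θ W (N n) (mtilde n ω)
      (CaseControl.response (n₁ n) (n₀ n)) (CaseControl.covariate X (n₁ n) (n₀ n) ω)
      (CaseControl.thetaTrue Pop α₀ β₀ h)}) atTop (𝓝 0) := by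
    have hext := CaseControl.tendsto_measure_not_norm_le (by positivity)
      (hNn.mono fun n hn => hn.1) hcond4 hε
    have hsum := hgood.prob.add hext
    rw [add_zero] at hsum
    refine tendsto_of_tendsto_of_tendsto_of_le_of_le tendsto_const_nhds hsum
      (fun _ => zero_le) fun n => (measure_mono fun ω hω => ?_).trans (measure_union_le _ _)
    -- A bad estimator is due either to an irregular internal sample or to an external error above
    -- εr.
    by_cases hm : ‖mtilde n ω - ∫ x, h x ∂Pop.fst‖ ≤ ε * CaseControl.rate n
    · exact Or.inl fun hω' => hω (hω' hm)
    · exact Or.inr hm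
  refine ⟨hbad, ?_, ?_, ?_⟩
  · filter_upwards [hgood.ae] with ω hω hlim
    filter_upwards [hω, hlim.eventually (gt_mem_nhds hε), eventually_gt_atTop 0]
      with n hn hlt hn0
    refine hn ?_
    have hn' : (0 : ℝ) < n := by exact_mod_cast hn0
    rw [CaseControl.rate, Real.rpow_neg hn'.le, ← div_eq_mul_inv, le_div_iff₀ (by positivity),
      mul_comm]
    exact hlt.le
  · intro θhat hθhat
    have hdist : ∀ n ω, ω ∉ {ω | ¬ CaseControl.GoodEstimator h Θ W (N n) (mtilde n ω)
        (CaseControl.response (n₁ n) (n₀ n)) (CaseControl.covariate X (n₁ n) (n₀ n) ω)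
        (CaseControl.thetaTrue Pop α₀ β₀ h)} →
        dist (θhat n ω) (CaseControl.thetaTrue Pop α₀ β₀ h) ≤ CaseControl.rate n := by
      intro n ω hω
      have hG := not_not.1 hω
      obtain ⟨w, hw⟩ := hθhat n ω hG.1
      have hmem := interior_subset (hG.2 _ _ hw).1
      rw [Metric.mem_closedBall, Fintype.card_sum, Fintype.card_fin, Fintype.card_fin, hn] at hmem
      exact hmem
    have hcons := fun {E : Type} [PseudoMetricSpace E] {f : CaseControl.Param p q → E}
      (hf : Continuous f) => CaseControl.tendstoInMeasure_comp_of_dist_le hbad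
        CaseControl.tendsto_rate hdist hf.continuousAt
    have hgam := (CaseControl.contDiff_gam (p := p) (q := q)).continuous
    have hast := (CaseControl.contDiff_astar (p := p) (q := q)).continuous
    refine ⟨CaseControl.tendstoInMeasure_comp_of_dist_le hbad CaseControl.tendsto_rate hdist
      continuousAt_id, ?_, ?_⟩
    · have := hcons (hast.sub hgam)
      simpa [CaseControl.thetaTrue] using this
    · have hinv : Continuous fun θ : CaseControl.Param p q =>
          1 / (1 + Real.exp (CaseControl.gam θ)) :=
        continuous_const.div (continuous_const.add (Real.continuous_exp.comp hgam))
          fun θ => (add_pos one_pos (Real.exp_pos (CaseControl.gam θ))).ne'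
      have := hcons hinv
      have e : 1 / (1 + Real.exp (CaseControl.gam (CaseControl.thetaTrue Pop α₀ β₀ h)))
          = CaseControl.caseProp Pop := by
        have h1 := hlog.respProb_pos true
        rw [CaseControl.thetaTrue, CaseControl.gam_mkParam, CaseControl.exp_gammaTrue hlog,
          one_add_div h1.ne', CaseControl.respProb_add, one_div, one_div, inv_inv]
        rfl
      rwa [e] at this
  · intro Pop' α' β' hprob hlog' hcond hmean
    refine hlog.identified ?_ hne hcond3c hlog' hcond hmean
    -- Integrability of h from ‖h‖ ≤ 1 + ‖h‖³.
    refine ((integrable_const (1 : ℝ)).add hcond3b).mono' hh.aestronglyMeasurable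
      (Eventually.of_forall fun x => ?_)
    rcases le_total ‖h x‖ 1 with h1 | h1
    · have := pow_nonneg (norm_nonneg (h x)) 3
      simp only [Pi.add_apply]
      linarith
    · have := le_self_pow₀ h1 (by norm_num : (3 : ℕ) ≠ 0)
      simp only [Pi.add_apply]
      linarith
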